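/- Consider an FCFS M/G/1/D update-and-decide system. Updates arrive as a Poisson process of rate $\lambda>0$. Service times $S_k\ge 0$ are i.i.d., independent of the arrivals, with mean $1/\mu$ and finite second moment, and $\rho=\lambda/\mu<1$. Decisions are made periodically with spacing $1/\nu$, $\nu>0$. Let $t_k$ be the arrival time of update $k$, $X_k=t_k-t_{k-1}$, $T_k=\max(T_{k-1}-X_k,0)+S_k$ its system time, and $t_k'=t_k+T_k$ its departure time; the queue is in steady state, and $t_0=0$ is taken as the origin of time. The age upon decision (AuD) of a decision made at time $\tau$ is $\tau-t_{N(\tau)}$ with $N(\tau)=\max\{k: t_k'\le \tau\}$, and the average AuD is the long-run average of the AuD over all decisions. Let $N_k^1$ be the number of decisions during the inter-departure interval $[t_{k-1}',t_k')$, given $X_k\le T_{k-1}$. Let $N_k^2$ and $N_k^3$ be the numbers of decisions during $[t_{k-1}',t_k)$ and during $[t_k,t_k')$, given $X_k>T_{k-1}$. In each of these counts the delay from the beginning of the interval to the first decision epoch is taken to be uniform on $(0,1/\nu)$ and independent of the queue, and the following decisions have spacing $1/\nu$. Put $$F=\frac{\lambda\rho}{\nu}\Big(\mathbb E[T_{k-1}\mid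 X_k\le T_{k-1}]\,\mathbb E[N_k^1]+\frac{\mathbb E[(N_k^1)^2]}{2\nu}\Big)+\frac{\lambda(1-\rho)}{\nu}\Big(\mathbb E[T_{k-1}\mid X_k>T_{k-1}]\big(\mathbb E[N_k^2]+\mathbb E[N_k^3]\big)+\frac{\mathbb E[(N_k^2)^2]+\mathbb E[(N_k^3)^2]+2\,\mathbb E[N_k^2]\,\mathbb E[N_k^3]}{2\nu}\Big).$$ All conditional means and moments in $F$ are well defined and finite, $F$ does not depend on $k\ge 1$, and the following holds. (a) In the uniform-offset approximation the average AuD exists almost surely and equals $F$. In this approximation the interval $[t_{k-1}',t_k')$ contains $N_k^1$ decisions if $X_k\le T_{k-1}$ and $N_k^2+N_k^3$ decisions if $X_k>T_{k-1}$. The $i$-th of them has AuD $T_{k-1}+a_k+\frac{i-1}{\nu}$, where $a_k$ is uniform on $(0,1/\nu)$. The delays $a_k$ and the delays used in the counts $N_k^1,N_k^2,N_k^3$, over all $k$, are independent of each other and of the queue. (b) In the system itself, with the decision epochs $\tau_0+j/\nu$, $j=0,1,2,\dots$, the average AuD exists almost surely, is a constant $\bar\Delta_{\mathrm D}$ that does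 not depend on $\tau_0\in\mathbb R$, and is given by $F$ up to a small error: $$0\le F-\bar\Delta_{\mathrm D}\le\frac{\lambda(2-\rho)}{8\nu^2}.$$ -/

import Mathlib

open MeasureTheory ProbabilityTheory Filter Topology

namespace MG1D

/-- The labels of the independent random sources that drive the system: the system time of the
update `0`, the inter-arrival times, the service times, and four auxiliary offsets per
inter-departure interval, used only in the uniform-offset approximation. -/
inductive Source : Type
  | init : Source
  | interArrival (k : ℕ) : Source
  | service (k : ℕ) : Source
  | offset1 (k : ℕ) : Source
  | offset2 (k : ℕ) : Source
  | offset3 (k : ℕ) : Source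
  | ageOffset (k : ℕ) : Source

noncomputable section

variable {Ω : Type*}

/-! ### The FCFS queue -/

/-- The inter-arrival time `X_k` between the updates `k - 1` and `k` (used for `k ≥ 1`). -/
def interArrival (Z : Source → Ω → ℝ) (k : ℕ) : Ω → ℝ := Z (Source.interArrival k)

/-- The service time `S_k` of the update `k` (used for `k ≥ 1`). -/
def service (Z : Source → Ω → ℝ) (k : ℕ) : Ω → ℝ := Z (Source.service k)

/-- The system time `T_k = W_k + S_k` under the first-come-first-served discipline: the update
`k + 1` waits for `W_{k+1} = max (T_k - X_{k+1}) 0`. -/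
def sysTime (Z : Source → Ω → ℝ) : ℕ → Ω → ℝ
  | 0 => Z Source.init
  | k + 1 => fun ω => max (sysTime Z k ω - interArrival Z (k + 1) ω) 0 + service Z (k + 1) ω

/-- The arrival (generation) time `t_k` of the update `k`; the origin of time is `t_0`. -/
def arrivalTime (Z : Source → Ω → ℝ) : ℕ → Ω → ℝ
  | 0 => fun _ => 0
  | k + 1 => fun ω => arrivalTime Z k ω + interArrival Z (k + 1) ω

/-- The departure time `t'_k = t_k + T_k` of the update `k`. -/
def departureTime (Z : Source → Ω → ℝ) (k : ℕ) (ω : Ω) : ℝ :=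
  arrivalTime Z k ω + sysTime Z k ω

/-- The event `X_{k+1} ≤ T_k`: the update `k + 1` arrives before the update `k` has left. Its
complement is the event `X_{k+1} > T_k`. -/
def busy (Z : Source → Ω → ℝ) (k : ℕ) : Set Ω :=
  {ω | interArrival Z (k + 1) ω ≤ sysTime Z k ω}

/-! ### Periodic decisions and the age upon decisions -/

/-- The periodic decision epochs, with spacing `1 / ν` and first epoch `τ₀`. -/
def decisionEpoch (nu τ₀ : ℝ) (j : ℕ) : ℝ := τ₀ + j / nu

/-- The index of the most recently received update at the time `τ`: the largest `k` with
`t'_k ≤ τ` (by convention `0` before the first departure). -/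
def lastReceived (Z : Source → Ω → ℝ) (τ : ℝ) (ω : Ω) : ℕ :=
  sSup {k : ℕ | departureTime Z k ω ≤ τ}

/-- The age upon decision of a decision made at the time `τ`. -/
def aud (Z : Source → Ω → ℝ) (τ : ℝ) (ω : Ω) : ℝ :=
  τ - arrivalTime Z (lastReceived Z τ ω) ω

/-- The mean of the ages upon decision over the first `n` decision epochs. -/
def meanAuD (Z : Source → Ω → ℝ) (nu τ₀ : ℝ) (n : ℕ) (ω : Ω) : ℝ :=
  (∑ j ∈ Finset.range n, aud Z (decisionEpoch nu τ₀ j) ω) / n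

/-! ### Decision counts -/

/-- The number of decisions made during an interval of length `L` (left end included, right end
excluded), if the first decision epoch after its beginning comes with the delay `a` and the
following ones with the spacing `1 / ν`. -/
def countDecisions (nu a L : ℝ) : ℕ := {i : ℕ | a + i / nu < L}.ncard

/-- The number `N¹` of decisions between the departures of the updates `k` and `k + 1`
(relevant if `X_{k+1} ≤ T_k`). -/
def count1 (Z : Source → Ω → ℝ) (nu : ℝ) (k : ℕ) (ω : Ω) : ℕ :=
  countDecisions nu (Z (Source.offset1 k) ω) (departureTime Z (k + 1) ω - departureTime Z k ω)

/-- The number `N²` of decisions between the departure of the update `k` and the arrival of the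
update `k + 1` (relevant if `X_{k+1} > T_k`). -/
def count2 (Z : Source → Ω → ℝ) (nu : ℝ) (k : ℕ) (ω : Ω) : ℕ :=
  countDecisions nu (Z (Source.offset2 k) ω) (arrivalTime Z (k + 1) ω - departureTime Z k ω)

/-- The number `N³` of decisions between the arrival and the departure of the update `k + 1`
(relevant if `X_{k+1} > T_k`). -/
def count3 (Z : Source → Ω → ℝ) (nu : ℝ) (k : ℕ) (ω : Ω) : ℕ :=
  countDecisions nu (Z (Source.offset3 k) ω) (departureTime Z (k + 1) ω - arrivalTime Z (k + 1) ω)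

open Classical in
/-- The number of decisions between the departures of the updates `k` and `k + 1`, in the
uniform-offset approximation. -/
def approxCount (Z : Source → Ω → ℝ) (nu : ℝ) (k : ℕ) (ω : Ω) : ℕ :=
  if ω ∈ busy Z k then count1 Z nu k ω else count2 Z nu k ω + count3 Z nu k ω

/-- The sum of the ages of these decisions, in the uniform-offset approximation: the first one is
made with a uniform delay after the departure of the update `k`, when that update has the age
`T_k`, and the following ones with the spacing `1 / ν`. -/
def approxAgeSum (Z : Source → Ω → ℝ) (nu : ℝ) (k : ℕ) (ω : Ω) : ℝ :=
  ∑ i ∈ Finset.range (approxCount Z nu k ω),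
    (sysTime Z k ω + Z (Source.ageOffset k) ω + i / nu)

/-- The mean age over all decisions made in the first `K` inter-departure intervals, in the
uniform-offset approximation. -/
def approxMeanAuD (Z : Source → Ω → ℝ) (nu : ℝ) (K : ℕ) (ω : Ω) : ℝ :=
  (∑ k ∈ Finset.range K, approxAgeSum Z nu k ω) /
    ∑ k ∈ Finset.range K, (approxCount Z nu k ω : ℝ)

/-! ### The probabilistic model -/

/-- A stationary M/G/1 queue with arrival rate `λ` and service rate `μ`, together with the offsets
of the uniform-offset approximation for the decision rate `ν`. -/
structure IsStationaryMG1D [MeasurableSpace Ω] (P : Measure Ω) (Z : Source → Ω → ℝ)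
    (lam mu nu : ℝ) : Prop where
  measurable : ∀ s, Measurable (Z s)
  indep : iIndepFun Z P
  interArrival_law : ∀ k, P.map (interArrival Z k) = expMeasure lam
  service_ident : ∀ k, IdentDistrib (service Z k) (service Z 0) P P
  service_nonneg : ∀ k, 0 ≤ᵐ[P] service Z k
  service_memLp : MemLp (service Z 0) 2 P
  service_mean : ∫ ω, service Z 0 ω ∂P = 1 / mu
  offset1_uniform : ∀ k, pdf.IsUniform (Z (Source.offset1 k)) (Set.Ioo 0 (1 / nu)) P
  offset2_uniform : ∀ k, pdf.IsUniform (Z (Source.offset2 k)) (Set.Ioo 0 (1 / nu)) P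
  offset3_uniform : ∀ k, pdf.IsUniform (Z (Source.offset3 k)) (Set.Ioo 0 (1 / nu)) P
  ageOffset_uniform : ∀ k, pdf.IsUniform (Z (Source.ageOffset k)) (Set.Ioo 0 (1 / nu)) P
  /-- The queue is in its steady state. -/
  stationary : P.map (sysTime Z 1) = P.map (sysTime Z 0)

/-- The expectation `E[f | A]` of a random variable given an event. -/
def condMean [MeasurableSpace Ω] (P : Measure Ω) (A : Set Ω) (f : Ω → ℝ) : ℝ :=
  ∫ ω, f ω ∂(cond P A)

/-- The closed expression for the average age upon decisions, written with the quantities of the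
inter-departure interval between the updates `k` and `k + 1`. -/
def formula [MeasurableSpace Ω] (P : Measure Ω) (Z : Source → Ω → ℝ) (lam mu nu : ℝ) (k : ℕ) : ℝ :=
  let ρ : ℝ := lam / mu
  let A : Set Ω := busy Z k
  let T1 : ℝ := condMean P A (sysTime Z k)
  let T2 : ℝ := condMean P Aᶜ (sysTime Z k)
  let N1 : ℝ := condMean P A fun ω => (count1 Z nu k ω : ℝ)
  let N1sq : ℝ := condMean P A fun ω => (count1 Z nu k ω : ℝ) ^ 2
  let N2 : ℝ := condMean P Aᶜ fun ω => (count2 Z nu k ω : ℝ)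
  let N2sq : ℝ := condMean P Aᶜ fun ω => (count2 Z nu k ω : ℝ) ^ 2
  let N3 : ℝ := condMean P Aᶜ fun ω => (count3 Z nu k ω : ℝ)
  let N3sq : ℝ := condMean P Aᶜ fun ω => (count3 Z nu k ω : ℝ) ^ 2
  lam * ρ / nu * (T1 * N1 + N1sq / (2 * nu))
    + lam * (1 - ρ) / nu * (T2 * (N2 + N3) + (N2sq + N3sq + 2 * (N2 * N3)) / (2 * nu))

end

end MG1D

/-! Both long-run averages are ratios of stationary means over one inter-departure interval, a cycle
of length `L` that starts with system time `T`. The error bound compares these two ratios.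

The sources are moved to their canonical space, where passing from the update `0` to the update `1`
is the measure preserving map `shiftMap`. The periodic clock contributes a point of the circle, its
phase at the arrivals, which turns by `-νX`; so `phaseShift` is a skew product preserving the law of
the queue times Haar measure. Since `τ₀` is arbitrary, an ergodic theorem is needed for every
initial phase, not for almost every one. Its core is the zero-one law
`measure_eq_zero_or_one_of_invariant`. As `ρ < 1`, the queue almost surely becomes idle and forgets
`T_0`; hence, up to a null set, the first `n` sources influence an invariant event only through the
phase at `t_n`. Its probability as a function of the phase is then bounded and harmonic for a random
walk with exponential steps, hence constant (`eq_of_integral_expMeasure_eq`). So the event is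
independent of the sources of each bounded rank, and finally of itself. The maximal inequality
`integral_nonneg_of_not_bddAbove_birkhoffSum` turns this into the convergence of Birkhoff averages
(`ae_tendsto_birkhoffSum`).

Under a uniform phase the mean of a lattice sum is an integral: a cycle has `νL` decisions on
average, with mean age sum `ν(TL + L²/2)`. As `E L = 1/λ`, the periodic system has average age
exactly `λ E[TL + L²/2]`.

In the approximation the number `N` of decisions is independent of the first delay `a`, and the term
`E[N] E[a]` cancels the linear term of the arithmetic sum. The mean age sum becomes `E[TN] +
E[N²]/(2ν)`. Given the queue, `N` still has mean `νL`, so only the excess `E[N²] - E[(νL)²]`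
separates the two averages. A count over a scaled length `y` takes the values `⌊y⌋` and `⌊y⌋ + 1`
and has variance `f(1 - f) ≤ 1/4`, with `f` the fractional part of `y`. A busy cycle (probability
`ρ`) has one such count, an idle one two independent counts; the excess lies between `0` and `(2 -
ρ)/4`, and its factor is `λ/(2ν²)`. That the approximate ratio is `F` (`formula_eq`) rests on
`P(busy) = ρ`, on the independence of the next service time, and on memorylessness, which makes the
idle period independent of `T`. -/

namespace MG1D

/-! ### A maximal ergodic inequality -/

section MaximalErgodic

variable {α : Type*} (f : α → α) (g : α → ℝ)

/-- The running maximum of the Birkhoff sums `0, S_1, …, S_n`, in recursive form. -/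
def birkhoffMax : ℕ → α → ℝ
  | 0 => fun _ => 0
  | n + 1 => fun x => max 0 (g x + birkhoffMax n (f x))

lemma birkhoffMax_nonneg (n : ℕ) (x : α) : 0 ≤ birkhoffMax f g n x := by
  cases n with
  | zero => exact le_rfl
  | succ n => exact le_max_left _ _

lemma birkhoffSum_le_birkhoffMax (n : ℕ) (x : α) : birkhoffSum f g n x ≤ birkhoffMax f g n x := by
  induction n generalizing x with
  | zero => simp [birkhoffMax]
  | succ n ih =>
    rw [birkhoffSum_succ']
    exact (add_le_add_right (ih (f x)) (g x)).trans (le_max_right _ _)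

lemma birkhoffMax_le_succ (n : ℕ) (x : α) : birkhoffMax f g n x ≤ birkhoffMax f g (n + 1) x := by
  induction n generalizing x with
  | zero => exact birkhoffMax_nonneg f g 1 x
  | succ n ih => exact max_le_max le_rfl (add_le_add_right (ih (f x)) (g x))

lemma monotone_birkhoffMax (x : α) : Monotone fun n => birkhoffMax f g n x :=
  monotone_nat_of_le_succ fun n => birkhoffMax_le_succ f g n x

variable {f g} [MeasurableSpace α] {μ : Measure α}

lemma integrable_birkhoffMax (hf : MeasurePreserving f μ μ) (hg : Integrable g μ) (n : ℕ) :
    Integrable (birkhoffMax f g n) μ := by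
  induction n with
  | zero => exact integrable_zero _ _ _
  | succ n ih =>
    exact (integrable_zero _ _ _).sup (hg.add (hf.integrable_comp_of_integrable ih))

/-- If the Birkhoff sums of `g` are almost everywhere unbounded above, then `∫ g ≥ 0`. -/
theorem integral_nonneg_of_not_bddAbove_birkhoffSum (hf : MeasurePreserving f μ μ)
    (hg : Integrable g μ)
    (h : ∀ᵐ x ∂μ, ¬ BddAbove (Set.range fun n => birkhoffSum f g n x)) : 0 ≤ ∫ x, g x ∂μ := by
  have hint := integrable_birkhoffMax hf hg
  have hintf : ∀ n, Integrable (fun x => birkhoffMax f g n (f x)) μ := fun n =>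
    hf.integrable_comp_of_integrable (hint n)
  -- In closed form `D n x = max (-M_n (f x)) (g x)` with `M_n` the running maximum. As `M_n ≥ 0`,
  -- this is dominated by `|g|`, and it equals `g x` once `M_n (f x) ≥ -g x`. Its integral is `∫
  -- M_{n+1} - ∫ M_n` because `f` preserves the measure.
  set D : ℕ → α → ℝ := fun n x => birkhoffMax f g (n + 1) x - birkhoffMax f g n (f x) with hD
  have hDpos : ∀ n, 0 ≤ ∫ x, D n x ∂μ := by
    intro n
    rw [hD, integral_sub (hint _) (hintf n)]
    have h1 : ∫ x, birkhoffMax f g n (f x) ∂μ = ∫ x, birkhoffMax f g n x ∂μ := by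
      have := integral_map (μ := μ) (φ := f) hf.measurable.aemeasurable
        (f := birkhoffMax f g n) (by rw [hf.map_eq]; exact (hint n).aestronglyMeasurable)
      rw [← this, hf.map_eq]
    rw [h1, sub_nonneg]
    exact integral_mono (hint n) (hint (n + 1)) (birkhoffMax_le_succ f g n)
  have hlim : Tendsto (fun n => ∫ x, D n x ∂μ) atTop (𝓝 (∫ x, g x ∂μ)) := by
    refine tendsto_integral_of_dominated_convergence (fun x => |g x|)
      (fun n => ((hint _).sub (hintf n)).aestronglyMeasurable) hg.abs ?_ ?_
    · intro n
      refine Eventually.of_forall fun x => ?_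
      have h0 := birkhoffMax_nonneg f g n (f x)
      simp only [hD, birkhoffMax, Real.norm_eq_abs]
      rcases le_total 0 (g x + birkhoffMax f g n (f x)) with h | h
      · rw [max_eq_right h]; simp
      · rw [max_eq_left h, abs_le]
        constructor <;> cases abs_cases (g x) <;> linarith
    -- The unboundedness is used at the point `f x`: the running maximum there eventually exceeds
    -- `-g x`, and from then on `D n x = g x`.
    · filter_upwards [hf.quasiMeasurePreserving.ae h] with x hx
      rw [not_bddAbove_iff] at hx
      obtain ⟨_, ⟨N, rfl⟩, hN⟩ := hx (-g x)
      refine tendsto_const_nhds.congr' ?_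
      filter_upwards [eventually_ge_atTop N] with n hn
      have h1 : -g x < birkhoffMax f g n (f x) :=
        hN.trans_le ((birkhoffSum_le_birkhoffMax f g N (f x)).trans
          (monotone_birkhoffMax f g (f x) hn))
      simp only [hD, birkhoffMax]
      rw [max_eq_right (by linarith)]
      ring
  exact ge_of_tendsto' hlim hDpos

end MaximalErgodic

/-! ### The exponential distribution -/

section Exponential

variable {r : ℝ}

lemma expMeasure_eq_withDensity :
    expMeasure r = (volume.restrict (Set.Ioi 0)).withDensity
      (fun x => ENNReal.ofReal (r * Real.exp (-(r * x)))) := by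
  have h : expMeasure r = volume.withDensity (exponentialPDF r) := rfl
  rw [h, restrict_Ioi_eq_restrict_Ici, ← withDensity_indicator measurableSet_Ici]
  congr 1
  ext x
  rw [exponentialPDF_eq, Set.indicator_apply]
  by_cases hx : 0 ≤ x <;> simp [hx]

lemma integral_expMeasure (hr : 0 < r) (φ : ℝ → ℝ) :
    ∫ x, φ x ∂(expMeasure r) = ∫ x in Set.Ioi 0, r * Real.exp (-(r * x)) * φ x := by
  rw [expMeasure_eq_withDensity, integral_withDensity_eq_integral_toReal_smul (by fun_prop)
    (by simp)]
  congr 1 with x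
  rw [ENNReal.toReal_ofReal (by positivity), smul_eq_mul]

lemma integrable_expMeasure_iff (hr : 0 < r) (φ : ℝ → ℝ) :
    Integrable φ (expMeasure r) ↔
      IntegrableOn (fun x => r * Real.exp (-(r * x)) * φ x) (Set.Ioi 0) := by
  rw [expMeasure_eq_withDensity, integrable_withDensity_iff_integrable_smul' (by fun_prop)
    (by simp), IntegrableOn]
  have : ∀ x : ℝ, (ENNReal.ofReal (r * Real.exp (-(r * x)))).toReal • φ x
      = r * Real.exp (-(r * x)) * φ x := fun x => by
    rw [ENNReal.toReal_ofReal (by positivity), smul_eq_mul]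
  simp_rw [this]

lemma ae_expMeasure_pos : ∀ᵐ x ∂(expMeasure r), 0 < x := by
  rw [expMeasure_eq_withDensity]
  exact (withDensity_absolutelyContinuous _ _).ae_le (ae_restrict_mem measurableSet_Ioi)

lemma setIntegral_Ioi_comp_add (φ : ℝ → ℝ) (t : ℝ) :
    ∫ x in Set.Ioi 0, φ (x + t) = ∫ x in Set.Ioi t, φ x := by
  have := (measurePreserving_add_right volume t).setIntegral_preimage_emb
    (MeasurableEquiv.addRight t).measurableEmbedding φ (Set.Ioi t)
  rw [← this]
  congr 2
  ext x; simp

lemma integral_expMeasure_id (hr : 0 < r) : ∫ x, x ∂(expMeasure r) = 1 / r := by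
  rw [integral_expMeasure hr]
  have h := Real.integral_rpow_mul_exp_neg_mul_Ioi (a := 2) (r := r) (by norm_num) hr
  have h2 : ∀ x : ℝ, r * Real.exp (-(r * x)) * x
      = r * (x ^ ((2 : ℝ) - 1) * Real.exp (-(r * x))) := fun x => by
    rw [show (2 : ℝ) - 1 = 1 by norm_num, Real.rpow_one]; ring
  simp_rw [h2]
  rw [integral_const_mul, h, Real.Gamma_two]
  norm_num
  field_simp

lemma integrable_sq_expMeasure (hr : 0 < r) : Integrable (fun x => x ^ 2) (expMeasure r) := by
  rw [integrable_expMeasure_iff hr]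
  have h := (integrableOn_rpow_mul_exp_neg_mul_rpow (p := 1) (s := 2) (b := r) (by norm_num)
    (by norm_num) hr).const_mul r
  refine IntegrableOn.congr_fun h (fun x _ => ?_) measurableSet_Ioi
  simp only [Real.rpow_one, Real.rpow_two, neg_mul]
  ring

lemma memLp_id_expMeasure (hr : 0 < r) : MemLp id 2 (expMeasure r) :=
  (memLp_two_iff_integrable_sq aestronglyMeasurable_id).2 (integrable_sq_expMeasure hr)

/-- The exponential distribution is memoryless. -/
lemma integral_expMeasure_indicator_sub (hr : 0 < r) {t : ℝ} (ht : 0 ≤ t) (φ : ℝ → ℝ) :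
    ∫ x, (Set.Ioi t).indicator (fun x => φ (x - t)) x ∂(expMeasure r)
      = Real.exp (-(r * t)) * ∫ x, φ x ∂(expMeasure r) := by
  rw [integral_expMeasure hr, integral_expMeasure hr, ← integral_const_mul]
  have h1 : ∀ x : ℝ, r * Real.exp (-(r * x)) * (Set.Ioi t).indicator (fun x => φ (x - t)) x
      = (Set.Ioi t).indicator (fun x => r * Real.exp (-(r * x)) * φ (x - t)) x := fun x => by
    by_cases hx : x ∈ Set.Ioi t <;> simp [hx]
  simp_rw [h1]
  rw [setIntegral_indicator measurableSet_Ioi, Set.Ioi_inter_Ioi, max_eq_right ht,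
    ← setIntegral_Ioi_comp_add]
  congr 1 with x
  rw [add_sub_cancel_right, mul_add, neg_add, Real.exp_add]
  ring

/-- Bounded harmonic functions of the random walk with exponential steps are constant. -/
theorem eq_of_integral_expMeasure_eq (hr : 0 < r) {φ : ℝ → ℝ} (hφ : Measurable φ) {C : ℝ}
    (hC : ∀ x, |φ x| ≤ C) (h : ∀ s, φ s = ∫ x, φ (s + x) ∂(expMeasure r)) (s t : ℝ) :
    φ s = φ t := by
  set k : ℝ → ℝ := fun u => Real.exp (-(r * u)) * φ u with hk
  have hkint : ∀ a, IntegrableOn k (Set.Ioi a) := by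
    intro a
    have h1 : IntegrableOn (fun x : ℝ => Real.exp (-(r * x))) (Set.Ioi a) := by
      simpa using exp_neg_integrableOn_Ioi a hr
    refine Integrable.mul_bdd (c := C) h1 hφ.aestronglyMeasurable ?_
    exact Eventually.of_forall fun x => hC x
  have hkii : ∀ a b, IntervalIntegrable k volume a b := fun a b =>
    ⟨(hkint a).mono_set Set.Ioc_subset_Ioi_self, (hkint b).mono_set Set.Ioc_subset_Ioi_self⟩
  -- The substitution `u = s + x` puts `s` into the limit of integration. The right side is
  -- continuous in `s` for merely measurable `φ`, and then differentiable, so regularity is gained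
  -- twice.
  have hrep : ∀ s, φ s = r * Real.exp (r * s) * ((∫ u in Set.Ioi 0, k u) - ∫ u in (0)..s, k u) := by
    intro s
    rw [sub_eq_iff_eq_add'.2
      (intervalIntegral.integral_interval_add_Ioi (hkint 0) (hkint s)).symm, h s,
      integral_expMeasure hr, ← setIntegral_Ioi_comp_add k s, ← integral_const_mul]
    congr 1 with x
    rw [hk]
    beta_reduce
    rw [mul_add, neg_add, Real.exp_add, Real.exp_neg (r * s), add_comm s x]
    field_simp
  have hkc : Continuous fun s => ∫ u in (0)..s, k u :=
    intervalIntegral.continuous_primitive hkii 0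
  have hφc : Continuous φ := by
    have : φ = fun s => r * Real.exp (r * s) * ((∫ u in Set.Ioi 0, k u) - ∫ u in (0)..s, k u) :=
      funext hrep
    rw [this]
    fun_prop
  have hkcont : Continuous k := by fun_prop
  -- Differentiating the exponential factor gives `r φ s`; differentiating the limit of integration
  -- gives `-r φ s`.
  have hder : ∀ s, HasDerivAt φ 0 s := by
    intro s
    have h1 : HasDerivAt (fun s => ∫ u in (0)..s, k u) (k s) s :=
      intervalIntegral.integral_hasDerivAt_right (hkii 0 s)
        hkcont.stronglyMeasurable.stronglyMeasurableAtFilter hkcont.continuousAt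
    have h2 : HasDerivAt (fun s => r * Real.exp (r * s)) (r * (Real.exp (r * s) * (r * 1))) s :=
      (((hasDerivAt_id s).const_mul r).exp).const_mul r
    have h3 := h2.mul (h1.const_sub (∫ u in Set.Ioi 0, k u))
    have h4 : (fun s => r * Real.exp (r * s) * ((∫ u in Set.Ioi 0, k u) - ∫ u in (0)..s, k u)) =
        φ :=
      (funext hrep).symm
    have h5 : HasDerivAt φ (r * (Real.exp (r * s) * (r * 1)) *
        ((∫ u in Set.Ioi 0, k u) - ∫ u in (0)..s, k u) + r * Real.exp (r * s) * -k s) s := by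
      rw [← h4]; exact h3
    convert h5 using 1
    have h6 : r * Real.exp (r * s) * k s = r * φ s := by
      simp only [hk]
      rw [Real.exp_neg]
      field_simp
    rw [mul_neg, h6]
    linear_combination r * hrep s
  exact is_const_of_deriv_eq_zero (fun x => (hder x).differentiableAt)
    (fun x => (hder x).deriv) s t

end Exponential

/-! ### The shifted system and the canonical space -/

section Shift

variable {Ω : Type*}

/-- The coordinate process on the canonical space. -/
def coord (s : Source) (z : Source → ℝ) : ℝ := z s

/-- The map to the canonical space given by a family of sources. -/
def joint (Z : Source → Ω → ℝ) (ω : Ω) : Source → ℝ := fun s => Z s ω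

/-- The relabelling of the sources when the update `1` takes the role of the update `0`. -/
def nextSource : Source → Source
  | .init => .init
  | .interArrival 0 => .interArrival 0
  | .interArrival (k + 1) => .interArrival (k + 2)
  | .service 0 => .service 0
  | .service (k + 1) => .service (k + 2)
  | .offset1 k => .offset1 (k + 1)
  | .offset2 k => .offset2 (k + 1)
  | .offset3 k => .offset3 (k + 1)
  | .ageOffset k => .ageOffset (k + 1)

/-- Injectivity ensures that the relabelled sources are still independent: no source is used twice.
-/
lemma nextSource_injective : Function.Injective nextSource := by
  intro s t h
  rcases s with _ | (_ | _) | (_ | _) | _ | _ | _ | _ <;>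
    rcases t with _ | (_ | _) | (_ | _) | _ | _ | _ | _ <;> simp_all [nextSource]

/-- The system seen from the update `1`. -/
noncomputable def shift (Z : Source → Ω → ℝ) : Source → Ω → ℝ
  | .init => sysTime Z 1
  | s => Z (nextSource s)

lemma shift_of_ne (Z : Source → Ω → ℝ) {s : Source} (hs : s ≠ .init) :
    shift Z s = Z (nextSource s) := by
  cases s <;> first | rfl | exact absurd rfl hs

/-- The shift on the canonical space. -/
noncomputable def shiftMap (z : Source → ℝ) : Source → ℝ := joint (shift coord) z

lemma interArrival_shift (Z : Source → Ω → ℝ) (k : ℕ) :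
    interArrival (shift Z) (k + 1) = interArrival Z (k + 2) := rfl

lemma sysTime_succ (Z : Source → Ω → ℝ) (k : ℕ) (ω : Ω) : sysTime Z (k + 1) ω =
    max (sysTime Z k ω - interArrival Z (k + 1) ω) 0 + service Z (k + 1) ω := rfl

lemma arrivalTime_succ (Z : Source → Ω → ℝ) (k : ℕ) (ω : Ω) :
    arrivalTime Z (k + 1) ω = arrivalTime Z k ω + interArrival Z (k + 1) ω := rfl

lemma mem_busy (Z : Source → Ω → ℝ) (k : ℕ) (ω : Ω) :
    ω ∈ busy Z k ↔ interArrival Z (k + 1) ω ≤ sysTime Z k ω := Iff.rfl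

lemma sysTime_shift (Z : Source → Ω → ℝ) (k : ℕ) :
    sysTime (shift Z) k = sysTime Z (k + 1) := by
  induction k with
  | zero => rfl
  | succ k ih => rw [sysTime, ih]; rfl

lemma arrivalTime_shift (Z : Source → Ω → ℝ) (k : ℕ) (ω : Ω) :
    arrivalTime (shift Z) k ω = arrivalTime Z (k + 1) ω - interArrival Z 1 ω := by
  induction k with
  | zero => simp [arrivalTime]
  | succ k ih => rw [arrivalTime_succ, ih, arrivalTime_succ _ (k + 1), interArrival_shift]; ring

lemma departureTime_shift (Z : Source → Ω → ℝ) (k : ℕ) (ω : Ω) :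
    departureTime (shift Z) k ω = departureTime Z (k + 1) ω - interArrival Z 1 ω := by
  rw [departureTime, arrivalTime_shift, sysTime_shift, departureTime]; ring

lemma busy_shift (Z : Source → Ω → ℝ) (k : ℕ) : busy (shift Z) k = busy Z (k + 1) := by
  rw [busy, sysTime_shift]; rfl

lemma count1_shift (Z : Source → Ω → ℝ) (nu : ℝ) (k : ℕ) :
    count1 (shift Z) nu k = count1 Z nu (k + 1) := by
  ext ω
  rw [count1, departureTime_shift, departureTime_shift, sub_sub_sub_cancel_right]; rfl

lemma count2_shift (Z : Source → Ω → ℝ) (nu : ℝ) (k : ℕ) :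
    count2 (shift Z) nu k = count2 Z nu (k + 1) := by
  ext ω
  rw [count2, departureTime_shift, arrivalTime_shift, sub_sub_sub_cancel_right]; rfl

lemma count3_shift (Z : Source → Ω → ℝ) (nu : ℝ) (k : ℕ) :
    count3 (shift Z) nu k = count3 Z nu (k + 1) := by
  ext ω
  rw [count3, departureTime_shift, arrivalTime_shift, sub_sub_sub_cancel_right]; rfl

lemma approxCount_shift (Z : Source → Ω → ℝ) (nu : ℝ) (k : ℕ) :
    approxCount (shift Z) nu k = approxCount Z nu (k + 1) := by
  ext ω
  rw [approxCount, busy_shift, count1_shift, count2_shift, count3_shift, approxCount]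

lemma approxAgeSum_shift (Z : Source → Ω → ℝ) (nu : ℝ) (k : ℕ) :
    approxAgeSum (shift Z) nu k = approxAgeSum Z nu (k + 1) := by
  ext ω
  rw [approxAgeSum, approxCount_shift, sysTime_shift, approxAgeSum]; rfl

lemma formula_shift [MeasurableSpace Ω] (P : Measure Ω) (Z : Source → Ω → ℝ)
    (lam mu nu : ℝ) (k : ℕ) : formula P (shift Z) lam mu nu k = formula P Z lam mu nu (k + 1) := by
  simp only [formula, busy_shift, sysTime_shift, count1_shift, count2_shift, count3_shift]

/-- The queue depends on `ω` only through the values of the sources. With `f = joint Z`, this and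
the similar lemmas below carry statements between `Ω` and the canonical space. -/
lemma sysTime_comp {Ω' : Type*} (Z : Source → Ω → ℝ) (f : Ω' → Ω) (k : ℕ) (ω : Ω') :
    sysTime (fun s ω => Z s (f ω)) k ω = sysTime Z k (f ω) := by
  induction k with
  | zero => rfl
  | succ k ih => rw [sysTime_succ, ih]; rfl

lemma arrivalTime_comp {Ω' : Type*} (Z : Source → Ω → ℝ) (f : Ω' → Ω) (k : ℕ) (ω : Ω') :
    arrivalTime (fun s ω => Z s (f ω)) k ω = arrivalTime Z k (f ω) := by
  induction k with
  | zero => rfl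
  | succ k ih => rw [arrivalTime_succ, ih]; rfl

lemma departureTime_comp {Ω' : Type*} (Z : Source → Ω → ℝ) (f : Ω' → Ω) (k : ℕ) (ω : Ω') :
    departureTime (fun s ω => Z s (f ω)) k ω = departureTime Z k (f ω) := by
  rw [departureTime, departureTime, sysTime_comp, arrivalTime_comp]

lemma approxCount_comp {Ω' : Type*} (Z : Source → Ω → ℝ) (f : Ω' → Ω) (nu : ℝ) (k : ℕ) (ω : Ω') :
    approxCount (fun s ω => Z s (f ω)) nu k ω = approxCount Z nu k (f ω) := by
  simp only [approxCount, count1, count2, count3, departureTime_comp, arrivalTime_comp, mem_busy,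
    sysTime_comp, interArrival]

lemma approxAgeSum_comp {Ω' : Type*} (Z : Source → Ω → ℝ) (f : Ω' → Ω) (nu : ℝ) (k : ℕ) (ω : Ω') :
    approxAgeSum (fun s ω => Z s (f ω)) nu k ω = approxAgeSum Z nu k (f ω) := by
  simp only [approxAgeSum, approxCount_comp, sysTime_comp]

lemma shiftMap_joint (Z : Source → Ω → ℝ) (ω : Ω) :
    shiftMap (joint Z ω) = joint (shift Z) ω := by
  ext s
  cases s
  case init => exact (sysTime_comp coord (joint Z) 1 ω).symm
  all_goals rfl

variable [MeasurableSpace Ω] {P : Measure Ω} {Z : Source → Ω → ℝ}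

@[fun_prop]
lemma measurable_coord (s : Source) : Measurable (coord s) := measurable_pi_apply s

lemma measurable_joint (hZ : ∀ s, Measurable (Z s)) : Measurable (joint Z) :=
  measurable_pi_iff.2 hZ

lemma measurable_sysTime (hZ : ∀ s, Measurable (Z s)) (k : ℕ) : Measurable (sysTime Z k) := by
  induction k with
  | zero => exact hZ _
  | succ k ih => exact ((ih.sub (hZ _)).max measurable_const).add (hZ _)

lemma measurable_arrivalTime (hZ : ∀ s, Measurable (Z s)) (k : ℕ) :
    Measurable (arrivalTime Z k) := by
  induction k with
  | zero => exact measurable_const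
  | succ k ih => exact ih.add (hZ _)

lemma measurable_departureTime (hZ : ∀ s, Measurable (Z s)) (k : ℕ) :
    Measurable (departureTime Z k) :=
  (measurable_arrivalTime hZ k).add (measurable_sysTime hZ k)

lemma measurable_shift (hZ : ∀ s, Measurable (Z s)) (s : Source) : Measurable (shift Z s) := by
  by_cases hs : s = .init
  · subst hs; exact measurable_sysTime hZ 1
  · rw [shift_of_ne Z hs]; exact hZ _

lemma measurable_shiftMap : Measurable shiftMap :=
  measurable_joint (measurable_shift measurable_coord)

lemma measurableSet_busy (hZ : ∀ s, Measurable (Z s)) (k : ℕ) : MeasurableSet (busy Z k) :=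
  measurableSet_le (hZ _) (measurable_sysTime hZ k)

open Classical in
/-- The coordinates outside `S` are set to zero. -/
noncomputable def mask (S : Set Source) (z : Source → ℝ) : Source → ℝ :=
  fun s => if s ∈ S then z s else 0

lemma mask_of_mem {S : Set Source} {s : Source} (hs : s ∈ S) (z : Source → ℝ) :
    mask S z s = z s := if_pos hs

lemma mask_of_notMem {S : Set Source} {s : Source} (hs : s ∉ S) (z : Source → ℝ) :
    mask S z s = 0 := if_neg hs

/-- The sources of the system seen from the update `1`, apart from the initial one. -/
noncomputable def restNext (z : Source → ℝ) : Source → ℝ := by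
  classical exact fun s => if s = .init then 0 else z (nextSource s)

lemma restNext_init (z : Source → ℝ) : restNext z .init = 0 := if_pos rfl

lemma restNext_of_ne (z : Source → ℝ) {s : Source} (hs : s ≠ .init) :
    restNext z s = z (nextSource s) := if_neg hs

lemma measurable_restNext : Measurable restNext := by
  refine measurable_pi_lambda _ fun s => ?_
  by_cases hs : s = .init
  · subst hs; simp only [restNext_init]; exact measurable_const
  · simp only [restNext_of_ne _ hs]; exact measurable_pi_apply _

omit [MeasurableSpace Ω] in
lemma measurable_comap_mask (S : Set Source) :
    Measurable[⨆ s ∈ S, (inferInstance : MeasurableSpace ℝ).comap (Z s)] fun ω =>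
      mask S (joint Z ω) := by
  refine @measurable_pi_lambda _ _ _ (⨆ s ∈ S, _) _ _ fun s => ?_
  by_cases hs : s ∈ S
  · simp only [mask_of_mem hs, joint]
    exact (comap_measurable (Z s)).mono
      (le_iSup₂ (f := fun s (_ : s ∈ S) => (inferInstance : MeasurableSpace ℝ).comap (Z s)) s hs)
      le_rfl
  · simp only [mask_of_notMem hs]
    exact @measurable_const _ _ _ (⨆ s ∈ S, _) _

/-- Functions of disjoint families of sources are independent. -/
lemma indepFun_of_mask (hZ : ∀ s, Measurable (Z s)) (hind : iIndepFun Z P)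
    {β γ : Type*} [MeasurableSpace β] [MeasurableSpace γ] (S T : Set Source) (hST : Disjoint S T)
    {f : (Source → ℝ) → β} {g : (Source → ℝ) → γ} (hf : Measurable f) (hg : Measurable g)
    (hfS : ∀ z, f (mask S z) = f z) (hgT : ∀ z, g (mask T z) = g z) :
    IndepFun (fun ω => f (joint Z ω)) (fun ω => g (joint Z ω)) P := by
  have h := indep_iSup_of_disjoint (fun s => (hZ s).comap_le) hind.iIndep hST
  have h1 : IndepFun (fun ω => mask S (joint Z ω)) (fun ω => mask T (joint Z ω)) P := by
    rw [IndepFun_iff_Indep]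
    exact indep_of_indep_of_le_left (indep_of_indep_of_le_right h
      (measurable_comap_mask T).comap_le) (measurable_comap_mask S).comap_le
  have h2 := h1.comp hf hg
  simpa only [Function.comp_def, hfS, hgT] using h2

/-- The new initial value is a function of `init`, `interArrival 1` and `service 1`, and none of
these is the relabelling of a source other than `init`. -/
lemma iIndepFun_shift (hZ : ∀ s, Measurable (Z s)) (hind : iIndepFun Z P) :
    iIndepFun (shift Z) P := by
  classical
  rw [iIndepFun_iff_measure_inter_preimage_eq_mul]
  intro S B hB
  have hnext : iIndepFun (fun s => Z (nextSource s)) P := hind.precomp nextSource_injective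
  rw [iIndepFun_iff_measure_inter_preimage_eq_mul] at hnext
  have hrest := hnext (S.erase .init) (sets := B)
    (fun i hi => hB i (Finset.mem_of_mem_erase hi))
  have heq : ∀ i ∈ S.erase .init, Z (nextSource i) ⁻¹' B i = shift Z i ⁻¹' B i := fun i hi => by
    rw [shift_of_ne Z (Finset.ne_of_mem_erase hi)]
  rw [Set.iInter₂_congr heq, Finset.prod_congr rfl fun i hi => by rw [heq i hi]] at hrest
  by_cases hS : .init ∈ S
  · have hind2 : IndepFun (fun ω => sysTime coord 1 (joint Z ω))
        (fun ω => restNext (joint Z ω)) P := by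
      refine indepFun_of_mask hZ hind
        {.init, .interArrival 1, .service 1} {.init, .interArrival 1, .service 1}ᶜ
        disjoint_compl_right (measurable_sysTime measurable_coord 1) measurable_restNext ?_ ?_
      · intro z
        simp [sysTime, interArrival, service, coord, mask]
      · intro z
        ext s
        by_cases hs : s = .init
        · subst hs; simp only [restNext_init]
        · rw [restNext_of_ne _ hs, restNext_of_ne _ hs, mask_of_mem]
          rcases s with _ | (_ | _) | (_ | _) | _ | _ | _ | _ <;> simp_all [nextSource]
    have hset : (⋂ i ∈ S.erase .init, shift Z i ⁻¹' B i) =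
        (fun ω => restNext (joint Z ω)) ⁻¹' (⋂ i ∈ S.erase .init, (fun z => z i) ⁻¹' B i) := by
      ext ω
      simp only [Set.mem_iInter, Set.mem_preimage]
      refine forall₂_congr fun i hi => ?_
      rw [restNext_of_ne _ (Finset.ne_of_mem_erase hi), shift_of_ne Z (Finset.ne_of_mem_erase hi)]
      rfl
    have hfun : (fun ω => sysTime coord 1 (joint Z ω)) = shift Z .init :=
      funext fun ω => (sysTime_comp coord (joint Z) 1 ω).symm
    rw [← Finset.insert_erase hS, Finset.prod_insert (Finset.notMem_erase _ _), ← hrest,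
      Finset.set_biInter_insert, hset, ← hfun]
    refine hind2.measure_inter_preimage_eq_mul _ _ (hB _ hS) ?_
    exact Finset.measurableSet_biInter _ fun i hi =>
      measurable_pi_apply i (hB i (Finset.mem_of_mem_erase hi))
  · rwa [Finset.erase_eq_of_notMem hS] at hrest

/-- By independence both joint laws are products of their marginals, so equality of the marginals
suffices. Stationarity is needed for the initial coordinate only. -/
lemma map_joint_shift (hZ : ∀ s, Measurable (Z s)) (hind : iIndepFun Z P)
    (h : ∀ s, P.map (shift Z s) = P.map (Z s)) : P.map (joint (shift Z)) = P.map (joint Z) := by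
  have h1 := hind.map_fun_eq_infinitePi_map hZ
  have h2 := (iIndepFun_shift hZ hind).map_fun_eq_infinitePi_map (measurable_shift hZ)
  simp_rw [h, ← h1] at h2
  exact h2

namespace IsStationaryMG1D

variable {lam mu nu : ℝ}

lemma map_shift (h : IsStationaryMG1D P Z lam mu nu) (s : Source) :
    P.map (shift Z s) = P.map (Z s) := by
  rcases s with _ | (_ | k) | (_ | k) | k | k | k | k
  · exact h.stationary
  · rfl
  · exact (h.interArrival_law (k + 2)).trans (h.interArrival_law (k + 1)).symm
  · rfl
  · exact (h.service_ident (k + 2)).map_eq.trans (h.service_ident (k + 1)).map_eq.symm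
  · exact (h.offset1_uniform (k + 1)).trans (h.offset1_uniform k).symm
  · exact (h.offset2_uniform (k + 1)).trans (h.offset2_uniform k).symm
  · exact (h.offset3_uniform (k + 1)).trans (h.offset3_uniform k).symm
  · exact (h.ageOffset_uniform (k + 1)).trans (h.ageOffset_uniform k).symm

lemma map_joint_shift (h : IsStationaryMG1D P Z lam mu nu) :
    P.map (joint (shift Z)) = P.map (joint Z) :=
  MG1D.map_joint_shift h.measurable h.indep h.map_shift

lemma map_sysTime_one_shift (h : IsStationaryMG1D P Z lam mu nu) :
    P.map (sysTime (shift Z) 1) = P.map (sysTime (shift Z) 0) := by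
  have key : ∀ Z' : Source → Ω → ℝ, (∀ s, Measurable (Z' s)) →
      P.map (sysTime Z' 1) = (P.map (joint Z')).map (sysTime coord 1) := fun Z' hZ' => by
    rw [Measure.map_map (measurable_sysTime measurable_coord 1) (measurable_joint hZ')]
    congr 1
  rw [key _ (measurable_shift h.measurable), h.map_joint_shift, ← key _ h.measurable]
  rfl

/-- The system seen from the update `1` is again a stationary M/G/1 queue. -/
lemma shift (h : IsStationaryMG1D P Z lam mu nu) : IsStationaryMG1D P (shift Z) lam mu nu where
  measurable := measurable_shift h.measurable
  indep := iIndepFun_shift h.measurable h.indep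
  interArrival_law k := by
    cases k with
    | zero => exact h.interArrival_law 0
    | succ k => exact h.interArrival_law (k + 2)
  service_ident k := by
    cases k with
    | zero => exact h.service_ident 0
    | succ k => exact h.service_ident (k + 2)
  service_nonneg k := by
    cases k with
    | zero => exact h.service_nonneg 0
    | succ k => exact h.service_nonneg (k + 2)
  service_memLp := h.service_memLp
  service_mean := h.service_mean
  offset1_uniform k := h.offset1_uniform (k + 1)
  offset2_uniform k := h.offset2_uniform (k + 1)
  offset3_uniform k := h.offset3_uniform (k + 1)
  ageOffset_uniform k := h.ageOffset_uniform (k + 1)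
  stationary := h.map_sysTime_one_shift

/-- The coordinate process under the joint law of the sources is a stationary M/G/1 queue. -/
lemma coord (h : IsStationaryMG1D P Z lam mu nu) :
    IsStationaryMG1D (P.map (joint Z)) coord lam mu nu := by
  have hJ := measurable_joint h.measurable
  have key : ∀ s, (P.map (joint Z)).map (MG1D.coord s) = P.map (Z s) := fun s =>
    Measure.map_map (measurable_coord s) hJ
  have hunif : ∀ s, pdf.IsUniform (Z s) (Set.Ioo 0 (1 / nu)) P →
      pdf.IsUniform (MG1D.coord s) (Set.Ioo 0 (1 / nu)) (P.map (joint Z)) := fun s hs =>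
    (key s).trans hs
  have : IsProbabilityMeasure P := h.indep.isProbabilityMeasure
  have : IsProbabilityMeasure (P.map (joint Z)) := Measure.isProbabilityMeasure_map hJ.aemeasurable
  refine ⟨measurable_coord, ?_, fun k => (key _).trans (h.interArrival_law k), fun k => ?_,
    fun k => ?_, ?_, ?_, fun k => hunif _ (h.offset1_uniform k),
    fun k => hunif _ (h.offset2_uniform k),
    fun k => hunif _ (h.offset3_uniform k), fun k => hunif _ (h.ageOffset_uniform k), ?_⟩
  · rw [iIndepFun_iff_map_fun_eq_infinitePi_map measurable_coord]
    simp_rw [key]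
    rw [← h.indep.map_fun_eq_infinitePi_map h.measurable]
    exact Measure.map_id
  · exact ⟨(measurable_coord _).aemeasurable, (measurable_coord _).aemeasurable,
      (key _).trans ((h.service_ident k).map_eq.trans (key _).symm)⟩
  · exact (ae_map_iff hJ.aemeasurable
      (measurableSet_le measurable_const (measurable_coord _))).2 (h.service_nonneg k)
  · exact (memLp_map_measure_iff (measurable_coord _).aestronglyMeasurable hJ.aemeasurable).2
      h.service_memLp
  · exact (integral_map hJ.aemeasurable (measurable_coord _).aestronglyMeasurable).trans
      h.service_mean
  · rw [Measure.map_map (measurable_sysTime measurable_coord _) hJ,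
      Measure.map_map (measurable_sysTime measurable_coord _) hJ]
    convert h.stationary using 2 <;>
      exact funext fun ω => (sysTime_comp MG1D.coord (joint Z) _ ω).symm

lemma measurePreserving_shiftMap (h : IsStationaryMG1D P Z lam mu nu) :
    MeasurePreserving shiftMap (P.map (joint Z)) (P.map (joint Z)) := by
  refine ⟨measurable_shiftMap, ?_⟩
  rw [Measure.map_map measurable_shiftMap (measurable_joint h.measurable)]
  have : shiftMap ∘ joint Z = joint (MG1D.shift Z) := funext fun ω => shiftMap_joint Z ω
  rw [this, h.map_joint_shift]

end IsStationaryMG1D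

end Shift

/-! ### Moments of the stationary queue -/

section Moments

variable {Ω : Type*} [MeasurableSpace Ω] {P : Measure Ω} {Z : Source → Ω → ℝ} {lam mu nu : ℝ}

/-- Integrating out one of two independent random variables. -/
lemma integral_comp_of_indepFun [IsProbabilityMeasure P] {β γ : Type*} [MeasurableSpace β]
    [MeasurableSpace γ] {Y : Ω → β} {A : Ω → γ} (hY : Measurable Y) (hA : Measurable A)
    (hYA : IndepFun Y A P) {F : β → γ → ℝ} (hF : Measurable (Function.uncurry F))
    (hint : Integrable (fun ω => F (Y ω) (A ω)) P) :
    ∫ ω, F (Y ω) (A ω) ∂P = ∫ ω, ∫ a, F (Y ω) a ∂(P.map A) ∂P := by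
  have hprod := hYA.map_prod_eq_prod_map_map hY.aemeasurable hA.aemeasurable
  have : IsProbabilityMeasure (P.map Y) := Measure.isProbabilityMeasure_map hY.aemeasurable
  have : IsProbabilityMeasure (P.map A) := Measure.isProbabilityMeasure_map hA.aemeasurable
  have hm := (hY.prodMk hA).aemeasurable (μ := P)
  have hi : Integrable (Function.uncurry F) ((P.map Y).prod (P.map A)) := by
    rw [← hprod, integrable_map_measure hF.aestronglyMeasurable hm]
    exact hint
  calc ∫ ω, F (Y ω) (A ω) ∂P = ∫ p, Function.uncurry F p ∂(P.map fun ω => (Y ω, A ω)) :=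
        (integral_map hm hF.aestronglyMeasurable).symm
    _ = ∫ y, ∫ a, F y a ∂(P.map A) ∂(P.map Y) := by
        rw [hprod, integral_prod _ hi]; rfl
    _ = ∫ ω, ∫ a, F (Y ω) a ∂(P.map A) ∂P :=
        integral_map hY.aemeasurable hi.integral_prod_left.aestronglyMeasurable

namespace IsStationaryMG1D

variable (h : IsStationaryMG1D P Z lam mu nu)
include h

lemma map_interArrival (k : ℕ) : P.map (Z (.interArrival k)) = expMeasure lam :=
  h.interArrival_law k

lemma map_service (k : ℕ) : P.map (Z (.service k)) = P.map (Z (.service 0)) :=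
  (h.service_ident k).map_eq

lemma ae_interArrival_pos : ∀ᵐ ω ∂P, ∀ k, 0 < interArrival Z k ω := by
  rw [ae_all_iff]
  intro k
  refine ae_of_ae_map (f := Z (.interArrival k)) (p := fun x => 0 < x)
    (h.measurable _).aemeasurable ?_
  rw [h.map_interArrival k]
  exact ae_expMeasure_pos

lemma ae_service_nonneg : ∀ᵐ ω ∂P, ∀ k, 0 ≤ service Z k ω := ae_all_iff.2 h.service_nonneg

/-- The sign of the initial system time is not part of the model. It follows from stationarity,
since `T_1` is nonnegative by the recursion and has the same law. -/
lemma ae_sysTime_zero_nonneg : ∀ᵐ ω ∂P, 0 ≤ sysTime Z 0 ω := by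
  refine ae_of_ae_map (f := sysTime Z 0) (p := fun x => 0 ≤ x)
    (measurable_sysTime h.measurable 0).aemeasurable ?_
  rw [← h.stationary, ae_map_iff (measurable_sysTime h.measurable 1).aemeasurable
    measurableSet_Ici]
  filter_upwards [h.ae_service_nonneg] with ω hω
  exact add_nonneg (le_max_right _ _) (hω 1)

lemma ae_sysTime_nonneg : ∀ᵐ ω ∂P, ∀ k, 0 ≤ sysTime Z k ω := by
  filter_upwards [h.ae_service_nonneg, h.ae_sysTime_zero_nonneg] with ω hω h0 k
  cases k with
  | zero => exact h0
  | succ k => exact add_nonneg (le_max_right _ _) (hω _)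

lemma memLp_interArrival (hlam : 0 < lam) (k : ℕ) : MemLp (interArrival Z k) 2 P := by
  have h1 := memLp_id_expMeasure hlam
  rw [← h.map_interArrival k] at h1
  exact (memLp_map_measure_iff aestronglyMeasurable_id (h.measurable _).aemeasurable).1 h1

lemma memLp_service (k : ℕ) : MemLp (service Z k) 2 P :=
  (h.service_ident k).symm.memLp_snd h.service_memLp

lemma integral_interArrival (hlam : 0 < lam) (k : ℕ) : ∫ ω, interArrival Z k ω ∂P = 1 / lam := by
  have h1 := integral_map (μ := P) (h.measurable (.interArrival k)).aemeasurable
    (f := id) aestronglyMeasurable_id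
  rw [h.map_interArrival k] at h1
  exact h1.symm.trans (integral_expMeasure_id hlam)

lemma integral_service (k : ℕ) : ∫ ω, service Z k ω ∂P = 1 / mu :=
  (h.service_ident k).integral_eq.trans h.service_mean

variable [IsProbabilityMeasure P]

lemma integrable_interArrival (hlam : 0 < lam) (k : ℕ) : Integrable (interArrival Z k) P :=
  (h.memLp_interArrival hlam k).integrable one_le_two

lemma integrable_service (k : ℕ) : Integrable (service Z k) P :=
  (h.memLp_service k).integrable one_le_two

/-- The strong law of large numbers for the inter-arrival times. -/
lemma ae_tendsto_sum_interArrival (hlam : 0 < lam) : ∀ᵐ ω ∂P,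
    Tendsto (fun n : ℕ => (∑ i ∈ Finset.range n, interArrival Z (i + 1) ω) / n) atTop
      (𝓝 (1 / lam)) := by
  rw [← h.integral_interArrival hlam 1]
  exact strong_law_ae_real (fun i => interArrival Z (i + 1))
    (h.integrable_interArrival hlam 1)
    (fun i j hij => h.indep.indepFun (by simpa using hij))
    (fun i => ⟨(h.measurable _).aemeasurable, (h.measurable _).aemeasurable,
      (h.map_interArrival _).trans (h.map_interArrival _).symm⟩)

/-- The strong law of large numbers for the service times. -/
lemma ae_tendsto_sum_service : ∀ᵐ ω ∂P,
    Tendsto (fun n : ℕ => (∑ i ∈ Finset.range n, service Z (i + 1) ω) / n) atTop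
      (𝓝 (1 / mu)) := by
  rw [← h.integral_service 1]
  exact strong_law_ae_real (fun i => service Z (i + 1)) (h.integrable_service 1)
    (fun i j hij => h.indep.indepFun (by simpa using hij))
    (fun i => ⟨(h.measurable _).aemeasurable, (h.measurable _).aemeasurable,
      (h.map_service _).trans (h.map_service _).symm⟩)

/-- A queue that is never idle satisfies `T_n = T_0 + ∑ S - ∑ X`, so by the strong law `T_n / n`
tends to `1/μ - 1/λ < 0`, which is impossible for nonnegative `T_n`. -/
lemma ae_exists_idle (hlam : 0 < lam) (hlt : lam < mu) :
    ∀ᵐ ω ∂P, ∃ n, sysTime Z n ω < interArrival Z (n + 1) ω := by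
  filter_upwards [h.ae_tendsto_sum_interArrival hlam, h.ae_tendsto_sum_service,
    h.ae_interArrival_pos] with ω hX hS hpos
  by_contra! hbusy
  have hT : ∀ n, sysTime Z n ω = sysTime Z 0 ω + ∑ i ∈ Finset.range n, service Z (i + 1) ω -
      ∑ i ∈ Finset.range n, interArrival Z (i + 1) ω := by
    intro n
    induction n with
    | zero => simp
    | succ n ih =>
      rw [sysTime_succ, max_eq_left (sub_nonneg.2 (hbusy n)), Finset.sum_range_succ,
        Finset.sum_range_succ, ih]
      ring
  have hlim : Tendsto (fun n : ℕ => sysTime Z n ω / n) atTop (𝓝 (0 + 1 / mu - 1 / lam)) := by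
    have h0 : Tendsto (fun n : ℕ => sysTime Z 0 ω / n) atTop (𝓝 0) :=
      tendsto_const_div_atTop_nhds_zero_nat _
    refine ((h0.add hS).sub hX).congr fun n => ?_
    rw [hT n]
    ring
  have hge : (0 : ℝ) ≤ 0 + 1 / mu - 1 / lam :=
    ge_of_tendsto' hlim fun n => div_nonneg ((hpos _).le.trans (hbusy n)) n.cast_nonneg
  have : 1 / mu < 1 / lam := one_div_lt_one_div_of_lt hlam hlt
  linarith

omit [IsProbabilityMeasure P] in
lemma indepFun_sysTime_interArrival : IndepFun (sysTime Z 0) (interArrival Z 1) P :=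
  h.indep.indepFun (by simp)

omit [IsProbabilityMeasure P] in
lemma indepFun_sysTime_service : IndepFun (sysTime Z 0) (service Z 1) P :=
  h.indep.indepFun (by simp)

/-- The stationary system time has a finite mean. -/
theorem integrable_sysTime_zero (hlam : 0 < lam) (hlt : lam < mu) :
    Integrable (sysTime Z 0) P := by
  set T := sysTime Z 0 with hTdef
  set X := interArrival Z 1 with hXdef
  set S := service Z 1 with hSdef
  have hTm : Measurable T := measurable_sysTime h.measurable 0
  have hXm : Measurable X := h.measurable _
  have hSm : Measurable S := h.measurable _
  have hX2 : Integrable (fun ω => X ω ^ 2) P :=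
    (memLp_two_iff_integrable_sq hXm.aestronglyMeasurable).1 (h.memLp_interArrival hlam 1)
  have hS2 : Integrable (fun ω => S ω ^ 2) P :=
    (memLp_two_iff_integrable_sq hSm.aestronglyMeasurable).1 (h.memLp_service 1)
  have hXi := h.integrable_interArrival hlam 1
  have hSi := h.integrable_service 1
  set C := ∫ ω, X ω ^ 2 + S ω ^ 2 ∂P with hC
  have hδ : 0 < 1 / lam - 1 / mu := sub_pos.2 (one_div_lt_one_div_of_lt hlam hlt)
  have hcover : AECover P atTop fun n : ℕ => {ω | T ω ≤ n} :=
    { ae_eventually_mem := Eventually.of_forall fun ω => by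
        obtain ⟨N, hN⟩ := exists_nat_ge (T ω)
        filter_upwards [eventually_ge_atTop N] with n hn
        exact hN.trans (by exact_mod_cast hn)
      measurableSet := fun n => measurableSet_le hTm measurable_const }
  have hbddint : ∀ n : ℕ, Integrable ({ω | T ω ≤ n}.indicator T) P := by
    intro n
    refine Integrable.of_bound
      ((hTm.indicator (measurableSet_le hTm measurable_const)).aestronglyMeasurable) n ?_
    filter_upwards [h.ae_sysTime_zero_nonneg] with ω hω
    by_cases hn : T ω ≤ n
    · rw [Set.indicator_of_mem (by exact hn), Real.norm_of_nonneg hω]; exact hn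
    · rw [Set.indicator_of_notMem (by exact hn)]; simp
  refine hcover.integrable_of_integral_bounded_of_nonneg_ae (C / (2 * (1 / lam - 1 / mu)))
    (fun n => (integrable_indicator_iff (measurableSet_le hTm measurable_const)).1 (hbddint n))
    h.ae_sysTime_zero_nonneg (Eventually.of_forall fun n => ?_)
  rw [← integral_indicator (measurableSet_le hTm measurable_const)]
  -- The argument is a quadratic drift estimate. No moment of `T` is known yet, so `T²` is replaced
  -- by `min T n ^ 2`, whose increment over one step has mean zero by stationarity; `φ T` is the
  -- factor that survives the truncation.
  set φ : ℝ → ℝ := (Set.Iic (n : ℝ)).indicator id with hφ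
  have hφm : Measurable φ := measurable_id.indicator measurableSet_Iic
  have hφT : {ω | T ω ≤ n}.indicator T = fun ω => φ (T ω) := by
    ext ω
    by_cases hn : T ω ≤ n <;> simp [hφ, hn, Set.indicator]
  have hφi : Integrable (fun ω => φ (T ω)) P := hφT ▸ hbddint n
  rw [hφT]
  have hTX : IndepFun (fun ω => φ (T ω)) X P :=
    h.indepFun_sysTime_interArrival.comp hφm measurable_id
  have hTS : IndepFun (fun ω => φ (T ω)) S P :=
    h.indepFun_sysTime_service.comp hφm measurable_id
  have hTXi : Integrable (fun ω => φ (T ω) * X ω) P := hTX.integrable_mul hφi hXi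
  have hTSi : Integrable (fun ω => φ (T ω) * S ω) P := hTS.integrable_mul hφi hSi
  have eTX : ∫ ω, φ (T ω) * X ω ∂P = (∫ ω, φ (T ω) ∂P) * (1 / lam) := by
    rw [hTX.integral_fun_mul_eq_mul_integral hφi.aestronglyMeasurable hXi.aestronglyMeasurable,
      h.integral_interArrival hlam]
  have eTS : ∫ ω, φ (T ω) * S ω ∂P = (∫ ω, φ (T ω) ∂P) * (1 / mu) := by
    rw [hTS.integral_fun_mul_eq_mul_integral hφi.aestronglyMeasurable hSi.aestronglyMeasurable,
      h.integral_service]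
  have hmin : ∀ T' : Ω → ℝ, Measurable T' → (∀ᵐ ω ∂P, 0 ≤ T' ω) →
      Integrable (fun ω => min (T' ω) n ^ 2) P := by
    intro T' hT' hpos
    refine Integrable.of_bound ((hT'.min measurable_const).pow_const 2).aestronglyMeasurable
      ((n : ℝ) ^ 2) ?_
    filter_upwards [hpos] with ω hω
    rw [Real.norm_of_nonneg (sq_nonneg _)]
    exact pow_le_pow_left₀ (le_min hω n.cast_nonneg) (min_le_right _ _) 2
  have hT1m : Measurable (sysTime Z 1) := measurable_sysTime h.measurable 1
  have hi1 := hmin _ hT1m (h.ae_sysTime_nonneg.mono fun ω hω => hω 1)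
  have hi0 := hmin _ hTm h.ae_sysTime_zero_nonneg
  have hstat : ∫ ω, min (sysTime Z 1 ω) n ^ 2 ∂P = ∫ ω, min (T ω) n ^ 2 ∂P := by
    have hm : Measurable fun x : ℝ => min x (n : ℝ) ^ 2 := by fun_prop
    rw [← integral_map hT1m.aemeasurable (f := fun x => min x (n : ℝ) ^ 2)
      hm.aestronglyMeasurable, h.stationary, integral_map hTm.aemeasurable hm.aestronglyMeasurable]
  -- Pathwise drift: `T_1² ≤ (T - X)² + 2TS + S²` where `T ≤ n`; where `T > n` the truncated square
  -- cannot increase. Taking means yields `2 (1/λ - 1/μ) E[T; T ≤ n] ≤ E[X² + S²]`, uniformly in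
  -- `n`.
  have hle : ∫ ω, (min (sysTime Z 1 ω) n ^ 2 - min (T ω) n ^ 2) ∂P ≤
      ∫ ω, (-2 * (φ (T ω) * X ω) + 2 * (φ (T ω) * S ω) + (X ω ^ 2 + S ω ^ 2)) ∂P := by
    refine integral_mono_ae (hi1.sub hi0)
      (((hTXi.const_mul _).add (hTSi.const_mul _)).add (hX2.add hS2)) ?_
    filter_upwards [h.ae_sysTime_nonneg, h.ae_interArrival_pos, h.ae_service_nonneg]
      with ω hT hX hS
    have hT0 : 0 ≤ T ω := hT 0
    have hX0 : 0 < X ω := hX 1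
    have hS0 : 0 ≤ S ω := hS 1
    have h1 : sysTime Z 1 ω = max (T ω - X ω) 0 + S ω := rfl
    have h1pos : 0 ≤ sysTime Z 1 ω := hT 1
    by_cases hn : T ω ≤ n
    · have hφn : φ (T ω) = T ω := Set.indicator_of_mem (by exact hn) _
      rw [hφn, min_eq_left hn]
      have h2 : min (sysTime Z 1 ω) n ^ 2 ≤ sysTime Z 1 ω ^ 2 :=
        pow_le_pow_left₀ (le_min h1pos n.cast_nonneg) (min_le_left _ _) 2
      have h3 : sysTime Z 1 ω ^ 2 ≤ (T ω - X ω) ^ 2 + 2 * (T ω * S ω) + S ω ^ 2 := by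
        rw [h1]
        rcases le_total (T ω - X ω) 0 with hc | hc
        · rw [max_eq_right hc]
          nlinarith [mul_nonneg hT0 hS0, sq_nonneg (T ω - X ω)]
        · rw [max_eq_left hc]
          nlinarith [mul_nonneg hX0.le hS0]
      nlinarith
    · have hφn : φ (T ω) = 0 := Set.indicator_of_notMem (by exact hn) _
      rw [hφn, min_eq_right (not_le.1 hn).le]
      have h2 : min (sysTime Z 1 ω) n ^ 2 ≤ (n : ℝ) ^ 2 :=
        pow_le_pow_left₀ (le_min h1pos n.cast_nonneg) (min_le_right _ _) 2
      nlinarith [sq_nonneg (X ω), sq_nonneg (S ω)]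
  have hTXS : Integrable (fun ω => -2 * (φ (T ω) * X ω) + 2 * (φ (T ω) * S ω)) P :=
    (hTXi.const_mul _).add (hTSi.const_mul _)
  have hXS : Integrable (fun ω => X ω ^ 2 + S ω ^ 2) P := hX2.add hS2
  rw [integral_sub hi1 hi0, hstat, sub_self, integral_add hTXS hXS,
    integral_add (hTXi.const_mul _) (hTSi.const_mul _), integral_const_mul, integral_const_mul,
    eTX, eTS] at hle
  rw [le_div_iff₀ (by positivity)]
  linarith

lemma integrable_sysTime (hlam : 0 < lam) (hlt : lam < mu) (k : ℕ) :
    Integrable (sysTime Z k) P := by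
  induction k generalizing Z with
  | zero => exact h.integrable_sysTime_zero hlam hlt
  | succ k ih => exact sysTime_shift Z k ▸ ih h.shift

omit [IsProbabilityMeasure P] in
lemma integral_sysTime_one : ∫ ω, sysTime Z 1 ω ∂P = ∫ ω, sysTime Z 0 ω ∂P :=
  IdentDistrib.integral_eq ⟨(measurable_sysTime h.measurable 1).aemeasurable,
    (measurable_sysTime h.measurable 0).aemeasurable, h.stationary⟩

/-- The mean idle time between two updates. -/
lemma integral_max_interArrival_sub (hlam : 0 < lam) (hlt : lam < mu) :
    ∫ ω, max (interArrival Z 1 ω - sysTime Z 0 ω) 0 ∂P = 1 / lam - 1 / mu := by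
  have hT := h.integrable_sysTime hlam hlt 0
  have hT1 := h.integrable_sysTime hlam hlt 1
  have hX := h.integrable_interArrival hlam 1
  have hS := h.integrable_service 1
  -- The recursion solved for the idle time; by stationarity the increment `T_1 - T_0` has mean
  -- zero.
  have key : ∀ ω, max (interArrival Z 1 ω - sysTime Z 0 ω) 0 =
      sysTime Z 1 ω - sysTime Z 0 ω + (interArrival Z 1 ω - service Z 1 ω) := by
    intro ω
    rw [sysTime_succ]
    rcases le_total (interArrival Z 1 ω) (sysTime Z 0 ω) with hc | hc
    · rw [max_eq_right (by linarith), max_eq_left (by linarith)]; ring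
    · rw [max_eq_left (by linarith), max_eq_right (by linarith)]; ring
  simp_rw [key]
  have hTT : Integrable (fun ω => sysTime Z 1 ω - sysTime Z 0 ω) P := hT1.sub hT
  have hXS : Integrable (fun ω => interArrival Z 1 ω - service Z 1 ω) P := hX.sub hS
  rw [integral_add hTT hXS, integral_sub hT1 hT, integral_sub hX hS,
    h.integral_sysTime_one, h.integral_interArrival hlam, h.integral_service]
  ring

/-- Given that the update `1` finds the system empty, the idle time is exponential and independent
of the system time of the update `0`. -/
lemma integral_indicator_busy_compl (hlam : 0 < lam) {φ ψ : ℝ → ℝ} (hφ : Measurable φ)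
    (hψ : Measurable ψ)
    (hint : Integrable ((busy Z 0)ᶜ.indicator fun ω =>
      ψ (sysTime Z 0 ω) * φ (interArrival Z 1 ω - sysTime Z 0 ω)) P) :
    ∫ ω in (busy Z 0)ᶜ, ψ (sysTime Z 0 ω) * φ (interArrival Z 1 ω - sysTime Z 0 ω) ∂P =
      (∫ ω, ψ (sysTime Z 0 ω) * Real.exp (-(lam * sysTime Z 0 ω)) ∂P) *
        ∫ x, φ x ∂(expMeasure lam) := by
  rw [← integral_indicator (measurableSet_busy h.measurable 0).compl]
  set F : ℝ → ℝ → ℝ := fun t x => ψ t * (Set.Ioi t).indicator (fun x => φ (x - t)) x with hF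
  have hFm : Measurable (Function.uncurry F) := by
    have : Function.uncurry F = {p : ℝ × ℝ | p.1 < p.2}.indicator
        fun p => ψ p.1 * φ (p.2 - p.1) := by
      ext ⟨t, x⟩
      by_cases hx : t < x <;> simp [hF, hx, Set.indicator]
    rw [this]
    exact ((hψ.comp measurable_fst).mul (hφ.comp (measurable_snd.sub measurable_fst))).indicator
      (measurableSet_lt measurable_fst measurable_snd)
  have heq : ((busy Z 0)ᶜ.indicator fun ω =>
      ψ (sysTime Z 0 ω) * φ (interArrival Z 1 ω - sysTime Z 0 ω)) =
      fun ω => F (sysTime Z 0 ω) (interArrival Z 1 ω) := by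
    ext ω
    by_cases hx : interArrival Z 1 ω ≤ sysTime Z 0 ω
    · rw [Set.indicator_of_notMem (by simpa [mem_busy] using hx)]
      simp [hF, hx]
    · rw [Set.indicator_of_mem (by simpa [mem_busy] using hx)]
      simp [hF, not_le.1 hx]
  rw [heq] at hint ⊢
  have hXm : Measurable (interArrival Z 1) := h.measurable _
  beta_reduce
  rw [integral_comp_of_indepFun (measurable_sysTime h.measurable 0) hXm
    h.indepFun_sysTime_interArrival hFm hint, interArrival, h.map_interArrival 1,
      ← integral_mul_const]
  refine integral_congr_ae ?_
  filter_upwards [h.ae_sysTime_zero_nonneg] with ω hω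
  simp only [hF]
  rw [integral_const_mul, integral_expMeasure_indicator_sub hlam hω]
  ring

/-- By memorylessness `P(idle) = E[exp (-λT)]`, and the mean idle time is this number times `1/λ`.
The mean idle time is already known to be `1/λ - 1/μ`, so no transform of `T` has to be computed. -/
lemma measureReal_busy_compl (hlam : 0 < lam) (hlt : lam < mu) :
    P.real (busy Z 0)ᶜ = 1 - lam / mu := by
  have hprob := isProbabilityMeasure_expMeasure hlam
  have hmeas := (measurableSet_busy h.measurable 0).compl
  have h1 := h.integral_indicator_busy_compl hlam (φ := fun _ => 1) (ψ := fun _ => 1)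
    measurable_const measurable_const ((integrable_const _).indicator hmeas)
  have h2 := h.integral_indicator_busy_compl hlam (φ := id) (ψ := fun _ => 1)
    measurable_id measurable_const (by
      simp only [one_mul, id]
      exact ((h.integrable_interArrival hlam 1).sub
        (h.integrable_sysTime hlam hlt 0)).indicator hmeas)
  have h3 : ∫ ω in (busy Z 0)ᶜ, 1 * id (interArrival Z 1 ω - sysTime Z 0 ω) ∂P =
      1 / lam - 1 / mu := by
    rw [← h.integral_max_interArrival_sub hlam hlt, ← integral_indicator hmeas]
    congr 1 with ω
    by_cases hx : interArrival Z 1 ω ≤ sysTime Z 0 ω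
    · rw [Set.indicator_of_notMem (by simpa [mem_busy] using hx), max_eq_right (by linarith)]
    · rw [Set.indicator_of_mem (by simpa [mem_busy] using hx), max_eq_left (by linarith)]
      simp
  rw [h3] at h2
  simp only [id, integral_expMeasure_id hlam] at h2
  simp only [mul_one, integral_const, smul_eq_mul, probReal_univ, measureReal_restrict_apply_univ]
    at h1
  have hmu : 0 < mu := hlam.trans hlt
  rw [h1]
  field_simp at h2 ⊢
  linarith

lemma measureReal_busy (hlam : 0 < lam) (hlt : lam < mu) : P.real (busy Z 0) = lam / mu := by
  have h1 := h.measureReal_busy_compl hlam hlt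
  rw [probReal_compl_eq_one_sub (measurableSet_busy h.measurable 0)] at h1
  linarith

end IsStationaryMG1D
end Moments

/-! ### The ergodic theorem for the queue with a phase -/

section Ergodic

instance isProbabilityMeasure_unitAddCircle :
    IsProbabilityMeasure (volume : Measure UnitAddCircle) := ⟨UnitAddCircle.measure_univ⟩

/-- The number of shifts after which a source has been used up; it is `0` for the initial system
time and for the two sources that drive nothing. -/
def rank : Source → ℕ
  | .init => 0
  | .interArrival k => k
  | .service k => k
  | .offset1 k => k + 1
  | .offset2 k => k + 1
  | .offset3 k => k + 1
  | .ageOffset k => k + 1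

lemma rank_nextSource {s : Source} (hs : 0 < rank s) : rank (nextSource s) = rank s + 1 := by
  rcases s with _ | (_ | _) | (_ | _) | _ | _ | _ | _ <;> simp_all [nextSource, rank]

lemma rank_iterate_nextSource {s : Source} (hs : 0 < rank s) (n : ℕ) :
    rank (nextSource^[n] s) = rank s + n := by
  induction n with
  | zero => rfl
  | succ n ih =>
    rw [Function.iterate_succ_apply', rank_nextSource (by omega), ih]; omega

lemma ne_init_of_rank_pos {s : Source} (hs : 0 < rank s) : s ≠ .init := by
  rintro rfl; exact lt_irrefl _ hs

/-- Two points of the canonical space drive the same system. -/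
def Agree (z z' : Source → ℝ) : Prop := z .init = z' .init ∧ ∀ s, 0 < rank s → z s = z' s

/-- The point of the canonical space with the same inputs and with initial system time `0`. -/
noncomputable def clear (z : Source → ℝ) : Source → ℝ := mask {s | 0 < rank s} z

lemma measurable_mask (S : Set Source) : Measurable (mask S) := by
  refine measurable_pi_lambda _ fun s => ?_
  by_cases hs : s ∈ S
  · simp only [mask_of_mem hs]; exact measurable_pi_apply s
  · simp only [mask_of_notMem hs]; exact measurable_const

lemma mask_mask (S : Set Source) (z : Source → ℝ) : mask S (mask S z) = mask S z := by
  ext s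
  by_cases hs : s ∈ S
  · rw [mask_of_mem hs]
  · rw [mask_of_notMem hs, mask_of_notMem hs]

lemma iterate_shiftMap_init (n : ℕ) (z : Source → ℝ) :
    (shiftMap^[n] z) .init = sysTime coord n z := by
  induction n generalizing z with
  | zero => rfl
  | succ n ih =>
    rw [Function.iterate_succ_apply, ih, ← congrFun (sysTime_shift coord n) z]
    exact (sysTime_comp coord (joint (shift coord)) n z).symm

lemma iterate_shiftMap_of_rank_pos (n : ℕ) (z : Source → ℝ) {s : Source} (hs : 0 < rank s) :
    (shiftMap^[n] z) s = z (nextSource^[n] s) := by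
  induction n generalizing z with
  | zero => rfl
  | succ n ih =>
    rw [Function.iterate_succ_apply, ih, Function.iterate_succ_apply']
    have h1 : 0 < rank (nextSource^[n] s) := by rw [rank_iterate_nextSource hs]; omega
    change shift coord _ z = _
    rw [shift_of_ne _ (ne_init_of_rank_pos h1)]
    rfl

lemma Agree.shiftMap {z z' : Source → ℝ} (h : Agree z z') : Agree (shiftMap z) (shiftMap z') := by
  refine ⟨?_, fun s hs => ?_⟩
  · rw [← Function.iterate_one MG1D.shiftMap, iterate_shiftMap_init, iterate_shiftMap_init]
    have hX : z (.interArrival 1) = z' (.interArrival 1) := h.2 _ Nat.one_pos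
    have hS : z (.service 1) = z' (.service 1) := h.2 _ Nat.one_pos
    simp only [sysTime, interArrival, service, coord, h.1, hX, hS, zero_add]
  · rw [← Function.iterate_one MG1D.shiftMap, iterate_shiftMap_of_rank_pos _ _ hs,
      iterate_shiftMap_of_rank_pos _ _ hs]
    exact h.2 _ (by rw [rank_iterate_nextSource hs]; omega)

/-- The recursion is monotone in the initial value, so the queue started empty stays below and is
idle whenever the original one is. -/
lemma sysTime_clear_le {z : Source → ℝ} (hz : 0 ≤ z .init) (n : ℕ) :
    sysTime coord n (clear z) ≤ sysTime coord n z := by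
  induction n with
  | zero => exact (mask_of_notMem (by simp [rank]) z).trans_le hz
  | succ n ih =>
    have hX : clear z (.interArrival (n + 1)) = z (.interArrival (n + 1)) :=
      mask_of_mem (by simp [rank]) z
    have hS : clear z (.service (n + 1)) = z (.service (n + 1)) :=
      mask_of_mem (by simp [rank]) z
    simp only [sysTime, interArrival, service, coord, hX, hS]
    gcongr

/-- Coupling: when the update `n + 1` finds both queues empty, both system times restart from the
same service time, and the initial value is forgotten. -/
lemma agree_iterate_clear {z : Source → ℝ} (hz : 0 ≤ z .init) {n : ℕ}
    (hn : sysTime coord n z < interArrival coord (n + 1) z) :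
    Agree (shiftMap^[n + 1] z) (shiftMap^[n + 1] (clear z)) := by
  refine ⟨?_, fun s hs => ?_⟩
  · have hX : interArrival coord (n + 1) (clear z) = interArrival coord (n + 1) z :=
      mask_of_mem (by simp [rank]) z
    have hS : service coord (n + 1) (clear z) = service coord (n + 1) z :=
      mask_of_mem (by simp [rank]) z
    have hle := sysTime_clear_le hz n
    rw [iterate_shiftMap_init, iterate_shiftMap_init, sysTime_succ, sysTime_succ, hX, hS,
      max_eq_right (by linarith), max_eq_right (by linarith)]
  · rw [iterate_shiftMap_of_rank_pos _ _ hs, iterate_shiftMap_of_rank_pos _ _ hs]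
    refine (mask_of_mem ?_ z).symm
    have := rank_iterate_nextSource hs (n + 1)
    exact (by omega : 0 < rank (nextSource^[n + 1] s))

variable (c : ℝ)

/-- The shift of the queue, together with the phase of a clock of rate `c` that is read at the
arrivals. -/
noncomputable def phaseShift (p : (Source → ℝ) × UnitAddCircle) : (Source → ℝ) × UnitAddCircle :=
  (shiftMap p.1, p.2 - ((c * interArrival coord 1 p.1 : ℝ) : UnitAddCircle))

lemma arrivalTime_shiftMap (k : ℕ) (z : Source → ℝ) :
    arrivalTime coord k (shiftMap z) = arrivalTime coord (k + 1) z - interArrival coord 1 z := by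
  rw [← arrivalTime_shift]
  exact (arrivalTime_comp coord (joint (shift coord)) k z).symm

lemma iterate_phaseShift (n : ℕ) (z : Source → ℝ) (ψ : UnitAddCircle) :
    (phaseShift c)^[n] (z, ψ) =
      (shiftMap^[n] z, ψ - ((c * arrivalTime coord n z : ℝ) : UnitAddCircle)) := by
  induction n generalizing z ψ with
  | zero => simp [arrivalTime]
  | succ n ih =>
    rw [Function.iterate_succ_apply, phaseShift, ih, arrivalTime_shiftMap,
      Function.iterate_succ_apply]
    congr 1
    rw [sub_sub, ← AddCircle.coe_add]
    congr 2
    ring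

lemma measurable_phaseShift : Measurable (phaseShift c) := by
  have h1 : Measurable fun p : (Source → ℝ) × UnitAddCircle =>
      ((c * interArrival coord 1 p.1 : ℝ) : UnitAddCircle) :=
    AddCircle.measurable_mk'.comp
      (((measurable_coord (.interArrival 1)).comp measurable_fst).const_mul c)
  exact (measurable_shiftMap.comp measurable_fst).prodMk (measurable_snd.sub h1)

lemma arrivalTime_eq_of_rank {n : ℕ} {z z' : Source → ℝ}
    (h : ∀ s, 0 < rank s → rank s ≤ n → z s = z' s) :
    arrivalTime coord n z = arrivalTime coord n z' := by
  induction n with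
  | zero => rfl
  | succ n ih =>
    rw [arrivalTime_succ, arrivalTime_succ, ih fun s h1 h2 => h s h1 (h2.trans n.le_succ)]
    congr 1
    exact h (.interArrival (n + 1)) n.succ_pos le_rfl

namespace IsStationaryMG1D

variable {m : Measure (Source → ℝ)} [IsProbabilityMeasure m] {lam mu nu : ℝ}
  (h : IsStationaryMG1D m MG1D.coord lam mu nu)
include h

omit [IsProbabilityMeasure m] in
lemma measurePreserving_shiftMap_coord : MeasurePreserving shiftMap m m := by
  have := h.measurePreserving_shiftMap
  rwa [show joint MG1D.coord = id from rfl, Measure.map_id] at this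

/-- Over each fixed `z` the circle is rotated, and rotations preserve Haar measure. -/
lemma measurePreserving_phaseShift :
    MeasurePreserving (phaseShift c) (m.prod volume) (m.prod volume) := by
  refine h.measurePreserving_shiftMap_coord.skew_product
    (g := fun z ψ => ψ - ((c * interArrival MG1D.coord 1 z : ℝ) : UnitAddCircle))
    (measurable_phaseShift c).snd (Eventually.of_forall fun z => ?_)
  exact (measurePreserving_sub_right volume _).map_eq

lemma ae_exists_agree (hlam : 0 < lam) (hlt : lam < mu) :
    ∀ᵐ z ∂m, ∃ n, Agree (shiftMap^[n] z) (shiftMap^[n] (clear z)) := by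
  filter_upwards [h.ae_exists_idle hlam hlt, h.ae_sysTime_zero_nonneg] with z ⟨n, hn⟩ hz
  exact ⟨n + 1, agree_iterate_clear hz hn⟩

variable {c} {A : Set ((Source → ℝ) × UnitAddCircle)}

/-- An invariant event may be tested after the coupling time, when the queue and its cleared copy
agree. The phases are equal as well, since arrival times ignore the initial system time. -/
lemma ae_mem_iff_clear (hlam : 0 < lam) (hlt : lam < mu)
    (hinv : ∀ p, phaseShift c p ∈ A ↔ p ∈ A)
    (hagree : ∀ z z' ψ, Agree z z' → ((z, ψ) ∈ A ↔ (z', ψ) ∈ A)) :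
    ∀ᵐ z ∂m, ∀ ψ, (clear z, ψ) ∈ A ↔ (z, ψ) ∈ A := by
  have hinvn : ∀ n p, (phaseShift c)^[n] p ∈ A ↔ p ∈ A := by
    intro n p
    induction n generalizing p with
    | zero => rfl
    | succ n ih => rw [Function.iterate_succ_apply, ih, hinv]
  filter_upwards [h.ae_exists_agree hlam hlt] with z ⟨n, hn⟩ ψ
  rw [← hinvn n (z, ψ), ← hinvn n (clear z, ψ), iterate_phaseShift, iterate_phaseShift,
    arrivalTime_eq_of_rank (z := clear z) (z' := z) fun s hs _ => mask_of_mem hs z]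
  exact (hagree _ _ _ hn).symm

/-- The conditional probability of an invariant event given the first sources. -/
lemma measureReal_inter_eq_setIntegral (hlam : 0 < lam) (hlt : lam < mu) (hA : MeasurableSet A)
    (hinv : ∀ p, phaseShift c p ∈ A ↔ p ∈ A)
    (hagree : ∀ z z' ψ, Agree z z' → ((z, ψ) ∈ A ↔ (z', ψ) ∈ A)) (ψ : UnitAddCircle) (n : ℕ)
    {B : Set (Source → ℝ)} (hB : MeasurableSet B)
    (hBmask : ∀ z, mask {s | rank s ≤ n} z ∈ B ↔ z ∈ B) :
    m.real ({z | (z, ψ) ∈ A} ∩ B) =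
      ∫ z in B, m.real {z' | (z', ψ - ((c * arrivalTime MG1D.coord n z : ℝ) : UnitAddCircle)) ∈ A}
        ∂m := by
  classical
  have hclear := h.ae_mem_iff_clear hlam hlt hinv hagree
  have hinvn : ∀ n p, (phaseShift c)^[n] p ∈ A ↔ p ∈ A := by
    intro n p
    induction n generalizing p with
    | zero => rfl
    | succ n ih => rw [Function.iterate_succ_apply, ih, hinv]
  have hMP := h.measurePreserving_shiftMap_coord.iterate n
  have hAψ : ∀ ψ, MeasurableSet {z | (z, ψ) ∈ A} := fun ψ => measurable_prodMk_right hA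
  -- `Y` reads only sources of rank at most `n`. `R` reads only sources of rank above `n`: shifting
  -- raises ranks by `n`, and clearing removes the system time, the only other trace of the past.
  set Y : (Source → ℝ) → ℝ × ℝ := fun z => (B.indicator 1 z, arrivalTime MG1D.coord n z) with hY
  set R : (Source → ℝ) → (Source → ℝ) := fun z => clear (shiftMap^[n] z) with hR
  have hYm : Measurable Y :=
    (measurable_one.indicator hB).prodMk (measurable_arrivalTime measurable_coord n)
  have hRm : Measurable R := (measurable_mask _).comp hMP.measurable
  have hYR : IndepFun Y R m := by
    refine indepFun_of_mask (Z := MG1D.coord) measurable_coord h.indep {s | rank s ≤ n}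
      {s | n < rank s} ?_ hYm hRm ?_ ?_
    · rw [Set.disjoint_left]
      intro s h1 h2
      exact not_lt.2 (show rank s ≤ n from h1) h2
    · intro z
      simp only [hY, Set.indicator_apply, hBmask, Pi.one_apply]
      rw [arrivalTime_eq_of_rank fun s _ hs => mask_of_mem (S := {s | rank s ≤ n}) hs z]
    · intro z
      ext s
      simp only [hR, clear]
      by_cases hs : 0 < rank s
      · rw [mask_of_mem hs, mask_of_mem hs, iterate_shiftMap_of_rank_pos _ _ hs,
          iterate_shiftMap_of_rank_pos _ _ hs, mask_of_mem]
        simp only [Set.mem_ofPred_eq, rank_iterate_nextSource hs]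
        omega
      · rw [mask_of_notMem hs, mask_of_notMem hs]
  set F : ℝ × ℝ → (Source → ℝ) → ℝ := fun y r =>
    y.1 * A.indicator 1 (r, ψ - ((c * y.2 : ℝ) : UnitAddCircle)) with hF
  have hFm : Measurable (Function.uncurry F) := by
    refine measurable_fst.fst.mul ((measurable_one.indicator hA).comp ?_)
    refine measurable_snd.prodMk (measurable_const.sub (AddCircle.measurable_mk'.comp ?_))
    exact measurable_fst.snd.const_mul c
  have hFint : Integrable (fun z => F (Y z) (R z)) m := by
    refine Integrable.of_bound (hFm.comp (hYm.prodMk hRm)).aestronglyMeasurable 1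
      (Eventually.of_forall fun z => ?_)
    simp only [hF, hY, Set.indicator_apply, Pi.one_apply]
    split_ifs <;> simp
  have hlhs : m.real ({z | (z, ψ) ∈ A} ∩ B) = ∫ z, F (Y z) (R z) ∂m := by
    rw [← integral_indicator_one ((hAψ ψ).inter hB)]
    refine integral_congr_ae ?_
    filter_upwards [hMP.quasiMeasurePreserving.ae hclear] with z hz
    -- Clearing is harmless at the shifted point, where the almost sure statement holds because the
    -- shift preserves `m`; invariance then leads back to `(z, ψ)`.
    have h1 : (R z, ψ - ((c * arrivalTime MG1D.coord n z : ℝ) : UnitAddCircle)) ∈ A ↔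
        (z, ψ) ∈ A := by
      rw [hz, ← iterate_phaseShift, hinvn]
    simp only [hF, hY, Set.indicator_apply, h1, Set.mem_inter_iff, Set.mem_ofPred_eq, Pi.one_apply]
    by_cases h2 : (z, ψ) ∈ A <;> by_cases h3 : z ∈ B <;> simp [h2, h3]
  have hmapR : ∀ ψ', ∫ r, A.indicator 1 (r, ψ') ∂(m.map R) = m.real {z | (z, ψ') ∈ A} := by
    intro ψ'
    have h1 : (fun r => A.indicator (1 : (Source → ℝ) × UnitAddCircle → ℝ) (r, ψ')) =
        {z | (z, ψ') ∈ A}.indicator 1 := rfl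
    rw [h1, integral_indicator_one (hAψ ψ'), map_measureReal_apply hRm (hAψ ψ'),
      ← hMP.measureReal_preimage (hAψ ψ').nullMeasurableSet]
    refine measureReal_congr ?_
    filter_upwards [hMP.quasiMeasurePreserving.ae hclear] with z hz
    exact propext (hz ψ')
  rw [hlhs, integral_comp_of_indepFun hYm hRm hYR hFm hFint, ← integral_indicator hB]
  congr 1 with z
  simp only [hF]
  rw [integral_const_mul, hmapR]
  by_cases hz : z ∈ B <;> simp [hY, hz]

/-- Invariant events have probability zero or one, irrespective of the phase. -/
theorem measure_eq_zero_or_one_of_invariant (hlam : 0 < lam) (hlt : lam < mu) (hc : c ≠ 0)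
    (hA : MeasurableSet A) (hinv : ∀ p, phaseShift c p ∈ A ↔ p ∈ A)
    (hagree : ∀ z z' ψ, Agree z z' → ((z, ψ) ∈ A ↔ (z', ψ) ∈ A)) :
    (∀ ψ, m {z | (z, ψ) ∈ A} = 0) ∨ ∀ ψ, m {z | (z, ψ) ∈ A} = 1 := by
  have hkey := h.measureReal_inter_eq_setIntegral hlam hlt hA hinv hagree
  set φ : ℝ → ℝ := fun r => m.real {z | (z, ((-(c * r) : ℝ) : UnitAddCircle)) ∈ A} with hφ
  have hφm : Measurable φ := by
    have h1 : Measurable fun ψ : UnitAddCircle => m {z | (z, ψ) ∈ A} :=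
      measurable_measure_prodMk_right hA
    exact h1.ennreal_toReal.comp (AddCircle.measurable_mk'.comp (measurable_id.const_mul c).neg)
  -- One step without conditioning: the phase moves by `-c X_1` with `X_1` exponential. Lifted to
  -- the line, this is harmonicity for the walk with exponential steps.
  have hφharm : ∀ s, φ s = ∫ x, φ (s + x) ∂(expMeasure lam) := by
    intro s
    have h1 := hkey ((-(c * s) : ℝ) : UnitAddCircle) 1 MeasurableSet.univ (by simp)
    rw [Set.inter_univ, setIntegral_univ] at h1
    have h2 : Measurable fun x => φ (s + x) := hφm.comp (measurable_const_add s)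
    rw [← h.map_interArrival 1, integral_map (measurable_coord _).aemeasurable
      h2.aestronglyMeasurable]
    simp only [hφ]
    rw [h1]
    congr 1 with z
    have : arrivalTime MG1D.coord 1 z = MG1D.coord (.interArrival 1) z := zero_add _
    rw [this, ← AddCircle.coe_sub, mul_add, neg_add, sub_eq_add_neg]
  have hφconst : ∀ s, φ s = φ 0 := fun s =>
    eq_of_integral_expMeasure_eq hlam hφm (C := 1)
      (fun x => by rw [abs_of_nonneg measureReal_nonneg]; exact measureReal_le_one) hφharm s 0
  -- As `c ≠ 0`, every phase has the form `-(c r)`, so constancy on the line gives constancy on the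
  -- circle.
  have hconst : ∀ ψ : UnitAddCircle, m.real {z | (z, ψ) ∈ A} = φ 0 := by
    intro ψ
    obtain ⟨s, rfl⟩ := QuotientAddGroup.mk_surjective ψ
    rw [← hφconst (-s / c)]
    simp only [hφ]
    have : -(c * (-s / c)) = s := by field_simp
    rw [this]
  have h01 : ∀ ψ, m {z | (z, ψ) ∈ A} = 0 ∨ m {z | (z, ψ) ∈ A} = 1 := by
    intro ψ
    set Aψ := {z | (z, ψ) ∈ A} with hAψ
    have hAψm : MeasurableSet Aψ := measurable_prodMk_right hA
    -- The filtration of the sources of rank at most `n`. With a constant conditional probability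
    -- the section `Aψ` is independent of each `Fm n`; these generate everything, because each
    -- coordinate has a finite rank.
    set Fm : ℕ → MeasurableSpace (Source → ℝ) := fun n =>
      MeasurableSpace.comap (mask {s | rank s ≤ n}) inferInstance with hFm
    have hFle : ∀ n, Fm n ≤ MeasurableSpace.pi := fun n => (measurable_mask _).comap_le
    have hAgen : MeasurableSpace.generateFrom {Aψ} ≤ MeasurableSpace.pi :=
      MeasurableSpace.generateFrom_le (by simpa using hAψm)
    have hind : ∀ n, Indep (Fm n) (MeasurableSpace.generateFrom {Aψ}) m := by
      intro n
      refine IndepSets.indep (hFle n) hAgen (@MeasurableSpace.isPiSystem_measurableSet _ (Fm n))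
        (IsPiSystem.singleton Aψ) (@MeasurableSpace.generateFrom_measurableSet _ (Fm n)).symm rfl ?_
      rw [IndepSets_iff]
      rintro B _ ⟨B', hB', rfl⟩ rfl
      have h1 := hkey ψ n (B := mask {s | rank s ≤ n} ⁻¹' B') (measurable_mask _ hB')
        (fun z => by simp only [Set.mem_preimage, mask_mask])
      simp only [hconst, integral_const, smul_eq_mul, measureReal_restrict_apply_univ] at h1
      rw [Set.inter_comm, ← ENNReal.toReal_eq_toReal_iff' (measure_ne_top _ _)
        (ENNReal.mul_ne_top (measure_ne_top _ _) (measure_ne_top _ _)), ENNReal.toReal_mul]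
      have h2 : (m Aψ).toReal = φ 0 := hconst ψ
      rw [h2]
      exact h1
    have hmono : Monotone Fm := by
      intro a b hab
      rw [← measurable_iff_comap_le]
      have hcm : Measurable[Fm b] (mask {s | rank s ≤ b}) := comap_measurable _
      have heq : mask {s | rank s ≤ a} = mask {s | rank s ≤ a} ∘ mask {s | rank s ≤ b} := by
        ext z s
        by_cases hs : rank s ≤ a
        · have h2 : rank s ≤ b := hs.trans hab
          rw [Function.comp, mask_of_mem (by exact hs), mask_of_mem (by exact hs),
            mask_of_mem (by exact h2)]
        · rw [Function.comp, mask_of_notMem (by exact hs), mask_of_notMem (by exact hs)]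
      rw [heq]
      exact (measurable_mask _).comp hcm
    have hsup : MeasurableSpace.pi ≤ ⨆ n, Fm n := by
      refine iSup_le fun s => ?_
      refine le_trans ?_ (le_iSup Fm (rank s))
      rw [← measurable_iff_comap_le]
      have hcm : Measurable[Fm (rank s)] (mask {s' | rank s' ≤ rank s}) := comap_measurable _
      have heq : (fun z : Source → ℝ => z s) = (fun z => z s) ∘ mask {s' | rank s' ≤ rank s} := by
        ext z
        rw [Function.comp, mask_of_mem (by simp)]
      rw [heq]
      exact (measurable_pi_apply s).comp hcm
    have hI := indep_iSup_of_directed_le hind hFle hAgen hmono.directed_le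
    have hself : IndepSet Aψ Aψ m := by
      rw [indepSet_iff_measure_inter_eq_mul hAψm hAψm m]
      exact (Indep_iff _ _ _).1 hI Aψ Aψ (hsup _ hAψm)
        (MeasurableSpace.measurableSet_generateFrom rfl)
    exact measure_eq_zero_or_one_of_indepSet_self hself
  have heq : ∀ ψ ψ', m {z | (z, ψ) ∈ A} = m {z | (z, ψ') ∈ A} := fun ψ ψ' => by
    rw [← ENNReal.toReal_eq_toReal_iff' (measure_ne_top _ _) (measure_ne_top _ _)]
    exact (hconst ψ).trans (hconst ψ').symm
  rcases h01 0 with h0 | h0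
  · exact Or.inl fun ψ => (heq ψ 0).trans h0
  · exact Or.inr fun ψ => (heq ψ 0).trans h0

variable {g : (Source → ℝ) × UnitAddCircle → ℝ}

/-- Unboundedness of the Birkhoff sums is invariant, since dropping the first term changes them by a
bounded amount. By the zero-one law it has probability zero for every phase or one for every phase.
-/
lemma ae_bddAbove_birkhoffSum (hlam : 0 < lam) (hlt : lam < mu) (hc : c ≠ 0)
    (hg : Measurable g) (hgi : Integrable g (m.prod volume))
    (hagree : ∀ z z' ψ, Agree z z' → g (z, ψ) = g (z', ψ))
    (hneg : ∫ p, g p ∂(m.prod volume) < 0) (ψ : UnitAddCircle) :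
    ∀ᵐ z ∂m, BddAbove (Set.range fun n => birkhoffSum (phaseShift c) g n (z, ψ)) := by
  set A : Set ((Source → ℝ) × UnitAddCircle) :=
    {p | ¬ BddAbove (Set.range fun n => birkhoffSum (phaseShift c) g n p)} with hAdef
  have hSm : ∀ n, Measurable (birkhoffSum (phaseShift c) g n) := fun n =>
    Finset.measurable_sum _ fun k _ => hg.comp ((measurable_phaseShift c).iterate k)
  have hA : MeasurableSet A := by
    have : A = ⋂ N : ℕ, ⋃ n : ℕ, {p | (N : ℝ) < birkhoffSum (phaseShift c) g n p} := by
      ext p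
      simp only [hAdef, Set.mem_ofPred_eq, not_bddAbove_iff, Set.mem_range, exists_exists_eq_and,
        Set.mem_iInter, Set.mem_iUnion]
      refine ⟨fun H N => H N, fun H x => ?_⟩
      obtain ⟨N, hN⟩ := exists_nat_ge x
      obtain ⟨n, hn⟩ := H N
      exact ⟨n, hN.trans_lt hn⟩
    rw [this]
    exact MeasurableSet.iInter fun N => MeasurableSet.iUnion fun n =>
      measurableSet_lt measurable_const (hSm n)
  have hinv : ∀ p, phaseShift c p ∈ A ↔ p ∈ A := by
    intro p
    refine not_congr ⟨?_, ?_⟩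
    · rintro ⟨C, hC⟩
      refine ⟨max 0 (g p + C), ?_⟩
      rintro _ ⟨n, rfl⟩
      cases n with
      | zero => simp
      | succ n =>
        beta_reduce
        rw [birkhoffSum_succ']
        exact (add_le_add_right (hC ⟨n, rfl⟩) _).trans (le_max_right _ _)
    · rintro ⟨C, hC⟩
      refine ⟨C - g p, ?_⟩
      rintro _ ⟨n, rfl⟩
      have h1 := hC ⟨n + 1, rfl⟩
      beta_reduce at h1 ⊢
      rw [birkhoffSum_succ'] at h1
      linarith
  have hsum : ∀ z z' ψ n, Agree z z' → birkhoffSum (phaseShift c) g n (z, ψ) =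
      birkhoffSum (phaseShift c) g n (z', ψ) := by
    intro z z' ψ n hz
    induction n generalizing z z' ψ with
    | zero => simp
    | succ n ih =>
      rw [birkhoffSum_succ', birkhoffSum_succ', hagree _ _ _ hz]
      congr 1
      have hX : interArrival MG1D.coord 1 z = interArrival MG1D.coord 1 z' :=
        hz.2 (.interArrival 1) Nat.one_pos
      simp only [phaseShift, hX]
      exact ih _ _ _ hz.shiftMap
  have hAagree : ∀ z z' ψ, Agree z z' → ((z, ψ) ∈ A ↔ (z', ψ) ∈ A) := by
    intro z z' ψ hz
    simp only [hAdef, Set.mem_ofPred_eq, hsum z z' ψ _ hz]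
  rcases h.measure_eq_zero_or_one_of_invariant hlam hlt hc hA hinv hAagree with h0 | h1
  · rw [ae_iff]
    exact h0 ψ
  -- Probability one for every phase gives, by Fubini, unboundedness almost everywhere for the
  -- product measure, and the maximal inequality contradicts the negative mean.
  · refine absurd (integral_nonneg_of_not_bddAbove_birkhoffSum
      (h.measurePreserving_phaseShift c) hgi ?_) (not_le.2 hneg)
    change ∀ᵐ p ∂(m.prod volume), p ∈ A
    rw [ae_iff]
    change (m.prod volume) Aᶜ = 0
    rw [Measure.prod_apply_symm hA.compl]
    refine (lintegral_congr fun ψ => ?_).trans lintegral_zero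
    have hAψm : MeasurableSet {z | (z, ψ) ∈ A} := measurable_prodMk_right hA
    exact (prob_compl_eq_zero_iff hAψm).2 (h1 ψ)

/-- The ergodic theorem for the stationary queue with a clock phase, for every initial phase. -/
theorem ae_tendsto_birkhoffSum (hlam : 0 < lam) (hlt : lam < mu) (hc : c ≠ 0)
    (hg : Measurable g) (hgi : Integrable g (m.prod volume))
    (hagree : ∀ z z' ψ, Agree z z' → g (z, ψ) = g (z', ψ)) (ψ : UnitAddCircle) :
    ∀ᵐ z ∂m, Tendsto (fun n : ℕ => birkhoffSum (phaseShift c) g n (z, ψ) / n) atTop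
      (𝓝 (∫ p, g p ∂(m.prod volume))) := by
  -- After subtracting slightly more than its mean, the function has negative integral and Birkhoff
  -- sums bounded above. Applied to `g` and `-g`, this bounds the averages from both sides.
  have hupper : ∀ g : (Source → ℝ) × UnitAddCircle → ℝ, Measurable g →
      Integrable g (m.prod volume) → (∀ z z' ψ, Agree z z' → g (z, ψ) = g (z', ψ)) →
      ∀ᵐ z ∂m, ∀ j : ℕ, ∃ C, ∀ n : ℕ, birkhoffSum (phaseShift c) g n (z, ψ) ≤
        n * (∫ p, g p ∂(m.prod volume) + 1 / (j + 1 : ℝ)) + C := by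
    intro g hg hgi hagree
    rw [ae_all_iff]
    intro j
    set I := ∫ p, g p ∂(m.prod volume) + 1 / (j + 1 : ℝ) with hI
    have hj : (0 : ℝ) < 1 / (j + 1) := by positivity
    have hneg : ∫ p, (g p - I) ∂(m.prod volume) < 0 := by
      rw [integral_sub hgi (integrable_const _)]
      rw [hI, integral_const, probReal_univ, one_smul]
      linarith
    filter_upwards [h.ae_bddAbove_birkhoffSum hlam hlt hc (hg.sub_const I)
      (hgi.sub (integrable_const I)) (fun z z' ψ hz => by rw [hagree z z' ψ hz]) hneg ψ]
      with z ⟨C, hC⟩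
    refine ⟨C, fun n => ?_⟩
    have h1 := hC ⟨n, rfl⟩
    simp only [birkhoffSum, Finset.sum_sub_distrib, Finset.sum_const, Finset.card_range,
      nsmul_eq_mul] at h1 ⊢
    linarith
  have hlower := hupper (fun p => -g p) hg.neg hgi.neg
    (fun z z' ψ hz => by rw [hagree z z' ψ hz])
  filter_upwards [hupper g hg hgi hagree, hlower] with z hu hl
  set I := ∫ p, g p ∂(m.prod volume) with hI
  rw [Metric.tendsto_atTop]
  intro ε hε
  obtain ⟨j, hj⟩ := exists_nat_one_div_lt (half_pos hε)
  obtain ⟨C, hC⟩ := hu j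
  obtain ⟨C', hC'⟩ := hl j
  -- One half of `ε` absorbs the slack `1 / (j + 1)`, the other half the constants `C` and `C'`
  -- divided by `n > N`.
  obtain ⟨N, hN⟩ := exists_nat_gt (2 * (|C| + |C'|) / ε)
  refine ⟨N + 1, fun n hn => ?_⟩
  have hnN : (N : ℝ) < n := by exact_mod_cast hn
  have hNpos : (0 : ℝ) ≤ N := N.cast_nonneg
  have hnpos : (0 : ℝ) < n := by linarith
  have h1 := hC n
  have h2 := hC' n
  rw [integral_neg] at h2
  have h3 : birkhoffSum (phaseShift c) (fun p => -g p) n (z, ψ) =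
      -birkhoffSum (phaseShift c) g n (z, ψ) := by
    simp [birkhoffSum]
  rw [h3] at h2
  have h4 : |C| + |C'| < n * (ε / 2) := by
    rw [div_lt_iff₀ hε] at hN
    nlinarith
  rw [Real.dist_eq, abs_lt, lt_sub_iff_add_lt, sub_lt_iff_lt_add, lt_div_iff₀ hnpos,
    div_lt_iff₀ hnpos]
  have h5 := le_abs_self C
  have h6 := le_abs_self C'
  have h7 := abs_nonneg C
  have h8 := abs_nonneg C'
  have h9 : (n : ℝ) * (1 / (j + 1)) < n * (ε / 2) := mul_lt_mul_of_pos_left hj hnpos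
  constructor <;> nlinarith

end IsStationaryMG1D
end Ergodic

/-! ### Counting lattice points with a uniform phase -/

section Counting

lemma countDecisions_eq_ceil {nu : ℝ} (hnu : 0 < nu) (a L : ℝ) :
    countDecisions nu a L = ⌈nu * L - nu * a⌉₊ := by
  have : {i : ℕ | a + i / nu < L} = ↑(Finset.range ⌈nu * L - nu * a⌉₊) := by
    ext i
    rw [Finset.coe_range, Set.mem_Iio, Nat.lt_ceil, Set.mem_ofPred_eq, ← lt_sub_iff_add_lt',
      div_lt_iff₀ hnu, sub_mul, mul_comm L, mul_comm a]
  rw [countDecisions, this, Set.ncard_coe_finset, Finset.card_range]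

lemma natCeil_sub_of_lt {y x : ℝ} (hx0 : 0 < x) (hx : x < y - ⌊y⌋₊) :
    ⌈y - x⌉₊ = ⌊y⌋₊ + 1 := by
  have h1 := Nat.lt_floor_add_one y
  rw [Nat.ceil_eq_iff (Nat.succ_ne_zero _)]
  push_cast [Nat.add_sub_cancel]
  constructor <;> linarith

lemma natCeil_sub_of_gt {y x : ℝ} (hx : y - ⌊y⌋₊ < x) (hx1 : x < 1) (hy : 0 ≤ y) :
    ⌈y - x⌉₊ = ⌊y⌋₊ := by
  have h1 := Nat.floor_le hy
  refine le_antisymm (Nat.ceil_le.2 (by linarith)) ?_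
  by_contra! hlt
  have h2 : ((⌈y - x⌉₊ + 1 : ℕ) : ℝ) ≤ ⌊y⌋₊ := by exact_mod_cast hlt
  have h3 := Nat.le_ceil (y - x)
  push_cast at h2
  linarith

/-- A function of a phase and of the number of lattice points with this phase in an interval of
length `y`, integrated over the phase. -/
lemma intervalIntegral_natCeil {y : ℝ} (hy : 0 ≤ y) {Φ : ℕ → ℝ → ℝ} (hΦ : ∀ n, Continuous (Φ n)) :
    ∫ x in (0)..1, Φ ⌈y - x⌉₊ x =
      (∫ x in (0)..(y - ⌊y⌋₊), Φ (⌊y⌋₊ + 1) x) + ∫ x in (y - ⌊y⌋₊)..1, Φ ⌊y⌋₊ x := by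
  set f := y - ⌊y⌋₊ with hf
  have hf0 : 0 ≤ f := sub_nonneg.2 (Nat.floor_le hy)
  have hf1 : f ≤ 1 := by linarith [Nat.lt_floor_add_one y]
  have h1 : Set.EqOn (fun x => Φ ⌈y - x⌉₊ x) (fun x => Φ (⌊y⌋₊ + 1) x) (Set.Ioo 0 f) :=
      fun x hx => by
    simp only [natCeil_sub_of_lt hx.1 hx.2]
  have h2 : Set.EqOn (fun x => Φ ⌈y - x⌉₊ x) (fun x => Φ ⌊y⌋₊ x) (Set.Ioo f 1) := fun x hx => by
    simp only [natCeil_sub_of_gt hx.1 hx.2 hy]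
  have i1 : IntervalIntegrable (fun x => Φ ⌈y - x⌉₊ x) volume 0 f :=
    ((hΦ _).intervalIntegrable 0 f).congr_uIoo (by rw [Set.uIoo_of_le hf0]; exact h1.symm)
  have i2 : IntervalIntegrable (fun x => Φ ⌈y - x⌉₊ x) volume f 1 :=
    ((hΦ _).intervalIntegrable f 1).congr_uIoo (by rw [Set.uIoo_of_le hf1]; exact h2.symm)
  rw [← Set.uIoo_of_le hf0] at h1
  rw [← Set.uIoo_of_le hf1] at h2
  rw [← intervalIntegral.integral_add_adjacent_intervals i1 i2,
    intervalIntegral.integral_congr_uIoo h1, intervalIntegral.integral_congr_uIoo h2]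

lemma intervalIntegral_natCeil_id {y : ℝ} (hy : 0 ≤ y) :
    ∫ x in (0)..1, (⌈y - x⌉₊ : ℝ) = y := by
  rw [intervalIntegral_natCeil hy (Φ := fun n _ => (n : ℝ)) fun n => continuous_const]
  simp only [intervalIntegral.integral_const, smul_eq_mul]
  push_cast
  ring

/-- The excess of the mean square of the count over the square of its mean. -/
noncomputable def fractVar (y : ℝ) : ℝ := (y - ⌊y⌋₊) * (1 - (y - ⌊y⌋₊))

lemma fractVar_nonneg {y : ℝ} (hy : 0 ≤ y) : 0 ≤ fractVar y :=
  mul_nonneg (sub_nonneg.2 (Nat.floor_le hy)) (by linarith [Nat.lt_floor_add_one y])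

lemma fractVar_le (y : ℝ) : fractVar y ≤ 1 / 4 := by
  rw [fractVar]; nlinarith [sq_nonneg (y - ⌊y⌋₊ - 1 / 2)]

lemma measurable_fractVar : Measurable fractVar := by
  have : Measurable fun y : ℝ => (⌊y⌋₊ : ℝ) := measurable_from_nat.comp Nat.measurable_floor
  exact (measurable_id.sub this).mul (measurable_const.sub (measurable_id.sub this))

/-- With `f` the fractional part of `y`, the count is `⌊y⌋ + 1` with probability `f` and `⌊y⌋`
otherwise, so its variance is `f (1 - f)`. -/
lemma intervalIntegral_natCeil_sq {y : ℝ} (hy : 0 ≤ y) :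
    ∫ x in (0)..1, (⌈y - x⌉₊ : ℝ) ^ 2 = y ^ 2 + fractVar y := by
  rw [intervalIntegral_natCeil hy (Φ := fun n _ => (n : ℝ) ^ 2) fun n => continuous_const]
  simp only [intervalIntegral.integral_const, smul_eq_mul, fractVar]
  push_cast
  ring

lemma sum_range_affine (n : ℕ) (a b : ℝ) :
    ∑ i ∈ Finset.range n, (a + i * b) = n * a + n * (n - 1) / 2 * b := by
  induction n with
  | zero => simp
  | succ n ih => rw [Finset.sum_range_succ, ih]; push_cast; ring

/-- As `x` runs through `(0, 1)`, the points `x + i` below `y` sweep `(0, y)` once, so the mean is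
`∫ (T + u / ν) du` over `(0, y)`. No fractional correction appears, in contrast to the mean square
of the count. -/
lemma intervalIntegral_sum_natCeil {y nu : ℝ} (hy : 0 ≤ y) (T : ℝ) :
    ∫ x in (0)..1, ∑ i ∈ Finset.range ⌈y - x⌉₊, (T + (x + i) / nu) =
      T * y + y ^ 2 / (2 * nu) := by
  have h1 : ∀ (n : ℕ) (x : ℝ), ∑ i ∈ Finset.range n, (T + (x + i) / nu) =
      (n * T + n * (n - 1) / 2 * nu⁻¹) + n * nu⁻¹ * x := fun n x => by
    have h2 : ∀ i ∈ Finset.range n, T + (x + i) / nu = (T + x * nu⁻¹) + i * nu⁻¹ :=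
      fun i _ => by ring
    rw [Finset.sum_congr rfl h2, sum_range_affine]
    ring
  simp_rw [h1]
  rw [intervalIntegral_natCeil hy
    (Φ := fun n x => (n * T + n * (n - 1) / 2 * nu⁻¹) + n * nu⁻¹ * x) fun n => by fun_prop]
  have h2 : ∀ a b p q : ℝ, ∫ x in a..b, (p + q * x) = p * (b - a) + q * ((b ^ 2 - a ^ 2) / 2) := by
    intro a b p q
    rw [intervalIntegral.integral_add (by simp) (Continuous.intervalIntegrable (by fun_prop) _ _),
      intervalIntegral.integral_const_mul, integral_id, intervalIntegral.integral_const,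
      smul_eq_mul]
    ring
  rw [h2, h2]
  push_cast
  rw [div_eq_mul_inv _ (2 * nu), mul_inv]
  ring

lemma natCeil_sub_le {y x : ℝ} (hx : 0 ≤ x) (hy : 0 ≤ y) : (⌈y - x⌉₊ : ℝ) ≤ y + 1 := by
  have h1 : ⌈y - x⌉₊ ≤ ⌈y⌉₊ := Nat.ceil_mono (by linarith)
  have h2 : (⌈y - x⌉₊ : ℝ) ≤ ⌈y⌉₊ := by exact_mod_cast h1
  linarith [Nat.ceil_lt_add_one hy]

/-- The representative in `[0, 1)` of a phase. -/
noncomputable def delay (θ : UnitAddCircle) : ℝ := (AddCircle.equivIco 1 0 θ : ℝ)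

lemma delay_coe (x : ℝ) : delay (x : UnitAddCircle) = Int.fract x := by
  rw [delay, AddCircle.coe_equivIco_mk_apply]; simp

lemma delay_nonneg (θ : UnitAddCircle) : 0 ≤ delay θ := (AddCircle.equivIco 1 0 θ).2.1

lemma delay_lt_one (θ : UnitAddCircle) : delay θ < 1 :=
  (AddCircle.equivIco 1 0 θ).2.2.trans_eq (zero_add 1)

lemma measurable_delay : Measurable delay :=
  measurable_subtype_coe.comp (AddCircle.measurableEquivIco 1 0).measurable

/-- By translation invariance the phase at the departure is as uniform as the phase at the arrival,
whatever the system time between them. -/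
lemma integral_comp_delay_sub (φ : ℝ → ℝ) (a : UnitAddCircle) :
    ∫ θ : UnitAddCircle, φ (delay (θ - a)) = ∫ x in (0)..1, φ x := by
  rw [integral_sub_right_eq_self (fun θ => φ (delay θ)) a,
    ← UnitAddCircle.intervalIntegral_preimage 0, zero_add]
  refine intervalIntegral.integral_congr_uIoo ?_
  rw [Set.uIoo_of_le zero_le_one]
  intro x hx
  beta_reduce
  rw [delay_coe, Int.fract_eq_self.2 ⟨hx.1.le, hx.2⟩]

end Counting

/-! ### Averages along a subsequence -/

section Averages

lemma tendsto_div_of_eventually_add {x y : ℕ → ℝ} {l : ℝ} {K₀ : ℕ}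
    (hxy : ∀ K, K₀ ≤ K → x (K + 1) = x K + y K)
    (hy : Tendsto (fun K : ℕ => (∑ k ∈ Finset.range K, y k) / K) atTop (𝓝 l)) :
    Tendsto (fun K : ℕ => x K / K) atTop (𝓝 l) := by
  set D := x K₀ - ∑ k ∈ Finset.range K₀, y k with hD
  have hx : ∀ K, K₀ ≤ K → x K = ∑ k ∈ Finset.range K, y k + D := by
    intro K hK
    induction K, hK using Nat.le_induction with
    | base => rw [hD]; ring
    | succ K hK ih => rw [hxy K hK, ih, Finset.sum_range_succ]; ring
  have h1 := hy.add (tendsto_const_div_atTop_nhds_zero_nat D)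
  rw [add_zero] at h1
  refine h1.congr' ?_
  filter_upwards [eventually_ge_atTop K₀] with K hK
  rw [hx K hK, add_div]

/-- Converts averages per cycle into averages per decision. Nonnegative terms make the partial sums
monotone, and since `N (K + 1) / N K → 1`, convergence along `N` forces convergence along all
integers. -/
lemma tendsto_sum_div_of_subseq {a : ℕ → ℝ} {N : ℕ → ℕ} {α β : ℝ} {n₀ : ℕ}
    (ha : ∀ j, n₀ ≤ j → 0 ≤ a j) (hβ : 0 < β)
    (hN : Tendsto (fun K : ℕ => (N K : ℝ) / K) atTop (𝓝 β))
    (hs : Tendsto (fun K : ℕ => (∑ j ∈ Finset.range (N K), a j) / K) atTop (𝓝 α)) :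
    Tendsto (fun n : ℕ => (∑ j ∈ Finset.range n, a j) / n) atTop (𝓝 (α / β)) := by
  -- Absolute values make the partial sums monotone from the start; only the terms before `n₀`
  -- change, at the cost of the constant `D`.
  set u : ℕ → ℝ := fun n => ∑ j ∈ Finset.range n, |a j| with hu
  set D := ∑ j ∈ Finset.range n₀, a j - u n₀ with hD
  have hua : ∀ n, n₀ ≤ n → ∑ j ∈ Finset.range n, a j = u n + D := by
    intro n hn
    induction n, hn using Nat.le_induction with
    | base => rw [hD]; ring
    | succ n hn ih =>
      rw [Finset.sum_range_succ, ih, hu]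
      beta_reduce
      rw [Finset.sum_range_succ, abs_of_nonneg (ha n hn)]
      ring
  have hNtop : Tendsto N atTop atTop := by
    rw [← tendsto_natCast_atTop_iff (R := ℝ)]
    have h1 := hN.pos_mul_atTop hβ (tendsto_natCast_atTop_atTop (R := ℝ))
    refine h1.congr' ?_
    filter_upwards [eventually_gt_atTop 0] with K hK
    have : (K : ℝ) ≠ 0 := by exact_mod_cast hK.ne'
    field_simp
  have hDK : Tendsto (fun K : ℕ => D / K) atTop (𝓝 0) := tendsto_const_div_atTop_nhds_zero_nat D
  have hlim : Tendsto (fun n : ℕ => u n / n) atTop (𝓝 (α / β)) := by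
    refine tendsto_div_of_monotone_of_exists_subseq_tendsto_div u (α / β) ?_ fun q hq => ?_
    · exact monotone_nat_of_le_succ fun n => by
        rw [hu]; beta_reduce; rw [Finset.sum_range_succ]; linarith [abs_nonneg (a n)]
    · refine ⟨N, ?_, hNtop, ?_⟩
      · have h1 : Tendsto (fun K : ℕ => ((N (K + 1) : ℝ) / (K + 1 : ℕ)) / ((N K : ℝ) / K) *
            ((K + 1 : ℕ) / (K : ℝ))) atTop (𝓝 (β / β * 1)) := by
          refine (((tendsto_add_atTop_iff_nat 1).2 hN).div hN hβ.ne').mul ?_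
          have h2 : Tendsto (fun K : ℕ => 1 + 1 / (K : ℝ)) atTop (𝓝 (1 + 0)) :=
            tendsto_const_nhds.add (tendsto_const_div_atTop_nhds_zero_nat 1)
          rw [add_zero] at h2
          refine h2.congr' ?_
          filter_upwards [eventually_gt_atTop 0] with K hK
          have : (K : ℝ) ≠ 0 := by exact_mod_cast hK.ne'
          push_cast
          field_simp
        rw [div_self hβ.ne', mul_one] at h1
        filter_upwards [h1.eventually (gt_mem_nhds hq), eventually_gt_atTop 0,
          hNtop.eventually_gt_atTop 0] with K hK hK0 hN0
        have hK' : (0 : ℝ) < K := by exact_mod_cast hK0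
        have hN' : (0 : ℝ) < N K := by exact_mod_cast hN0
        have h3 : ((N (K + 1) : ℝ) / (K + 1 : ℕ)) / ((N K : ℝ) / K) * ((K + 1 : ℕ) / (K : ℝ)) =
            N (K + 1) / N K := by
          push_cast
          field_simp
        rw [h3, div_lt_iff₀ hN'] at hK
        exact hK.le
      · have h1 := (hs.sub hDK).div hN hβ.ne'
        rw [sub_zero] at h1
        refine h1.congr' ?_
        filter_upwards [eventually_gt_atTop 0, hNtop.eventually_ge_atTop n₀] with K hK0 hKn
        have hK' : (K : ℝ) ≠ 0 := by exact_mod_cast hK0.ne'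
        simp only [Pi.div_apply]
        rw [hua _ hKn, ← sub_div, add_sub_cancel_right, div_div_div_cancel_right₀ hK']
  have h1 := hlim.add (tendsto_const_div_atTop_nhds_zero_nat D)
  rw [add_zero] at h1
  refine h1.congr' ?_
  filter_upwards [eventually_ge_atTop n₀] with n hn
  rw [hua n hn, add_div]

end Averages

/-! ### The periodic decisions -/

section Periodic

variable {Ω : Type*}

/-- The length of the inter-departure interval between the updates `0` and `1`. -/
noncomputable def cycleLength (Z : Source → Ω → ℝ) (ω : Ω) : ℝ :=
  departureTime Z 1 ω - departureTime Z 0 ω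

lemma cycleLength_eq (Z : Source → Ω → ℝ) (ω : Ω) : cycleLength Z ω =
    interArrival Z 1 ω - sysTime Z 0 ω + max (sysTime Z 0 ω - interArrival Z 1 ω) 0 +
      service Z 1 ω := by
  simp only [cycleLength, departureTime, arrivalTime, sysTime, zero_add]
  ring

lemma cycleLength_nonneg {Z : Source → Ω → ℝ} {ω : Ω} (hS : 0 ≤ service Z 1 ω) :
    0 ≤ cycleLength Z ω := by
  rw [cycleLength_eq]
  linarith [le_max_left (sysTime Z 0 ω - interArrival Z 1 ω) 0]

/-- This gives `L` a second moment, although only a first moment of `T` is available. -/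
lemma cycleLength_le {Z : Source → Ω → ℝ} {ω : Ω} (hT : 0 ≤ sysTime Z 0 ω)
    (hX : 0 ≤ interArrival Z 1 ω) :
    cycleLength Z ω ≤ interArrival Z 1 ω + service Z 1 ω := by
  rw [cycleLength_eq]
  have : max (sysTime Z 0 ω - interArrival Z 1 ω) 0 ≤ sysTime Z 0 ω := max_le (by linarith) hT
  linarith

lemma departureTime_le_succ {Z : Source → Ω → ℝ} {ω : Ω} {k : ℕ} (hS : 0 ≤ service Z (k + 1) ω) :
    departureTime Z k ω ≤ departureTime Z (k + 1) ω := by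
  simp only [departureTime, arrivalTime, sysTime]
  linarith [le_max_left (sysTime Z k ω - interArrival Z (k + 1) ω) 0]

lemma lastReceived_eq {Z : Source → Ω → ℝ} {ω : Ω} (hmono : Monotone fun k => departureTime Z k ω)
    {τ : ℝ} {K : ℕ} (h1 : departureTime Z K ω ≤ τ) (h2 : τ < departureTime Z (K + 1) ω) :
    lastReceived Z τ ω = K := by
  have : {k : ℕ | departureTime Z k ω ≤ τ} = Set.Iic K := by
    ext k
    refine ⟨fun hk => ?_, fun hk => (hmono hk).trans h1⟩
    by_contra hlt
    exact absurd ((hmono (Nat.succ_le_of_lt (not_le.1 hlt))).trans hk) (not_le.2 h2)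
  rw [lastReceived, this, csSup_Iic]

/-- The number of decision epochs before the departure of the update `K`. -/
noncomputable def epochsBefore (Z : Source → Ω → ℝ) (nu τ₀ : ℝ) (K : ℕ) (ω : Ω) : ℕ :=
  ⌈nu * (departureTime Z K ω - τ₀)⌉₊

lemma decisionEpoch_lt_iff {Z : Source → Ω → ℝ} {nu τ₀ : ℝ} (hnu : 0 < nu) {K j : ℕ} {ω : Ω} :
    decisionEpoch nu τ₀ j < departureTime Z K ω ↔ j < epochsBefore Z nu τ₀ K ω := by
  rw [epochsBefore, Nat.lt_ceil, decisionEpoch, ← lt_sub_iff_add_lt', div_lt_iff₀' hnu]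

lemma aud_eq {Z : Source → Ω → ℝ} {nu τ₀ : ℝ} (hnu : 0 < nu) {ω : Ω}
    (hmono : Monotone fun k => departureTime Z k ω) {K j : ℕ}
    (h1 : epochsBefore Z nu τ₀ K ω ≤ j) (h2 : j < epochsBefore Z nu τ₀ (K + 1) ω) :
    aud Z (decisionEpoch nu τ₀ j) ω = decisionEpoch nu τ₀ j - arrivalTime Z K ω := by
  rw [aud, lastReceived_eq hmono _ ((decisionEpoch_lt_iff hnu).2 h2)]
  rw [← not_lt, decisionEpoch_lt_iff hnu]
  exact not_lt.2 h1

lemma monotone_epochsBefore {Z : Source → Ω → ℝ} {nu τ₀ : ℝ} (hnu : 0 < nu) {ω : Ω}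
    (hmono : Monotone fun k => departureTime Z k ω) :
    Monotone fun K => epochsBefore Z nu τ₀ K ω := fun a b hab => by
  have := hmono hab
  refine Nat.ceil_mono ?_
  beta_reduce at this
  gcongr

variable (nu : ℝ)

/-- The phase of the clock at the departure of the update `0`, if `p.2` is the phase at its
arrival. -/
noncomputable def departurePhase (p : (Source → ℝ) × UnitAddCircle) : UnitAddCircle :=
  p.2 - ((nu * sysTime coord 0 p.1 : ℝ) : UnitAddCircle)

/-- The number of decisions between the departures of the updates `0` and `1`. -/
noncomputable def cycleCount (p : (Source → ℝ) × UnitAddCircle) : ℕ :=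
  ⌈nu * cycleLength coord p.1 - delay (departurePhase nu p)⌉₊

/-- The sum of the ages of the decisions between the departures of the updates `0` and `1`. -/
noncomputable def cycleAge (p : (Source → ℝ) × UnitAddCircle) : ℝ :=
  ∑ i ∈ Finset.range (cycleCount nu p),
    (sysTime coord 0 p.1 + (delay (departurePhase nu p) + i) / nu)

lemma departureTime_shiftMap (k : ℕ) (z : Source → ℝ) :
    departureTime coord k (shiftMap z) =
      departureTime coord (k + 1) z - interArrival coord 1 z := by
  rw [← departureTime_shift]
  exact (departureTime_comp coord (joint (shift coord)) k z).symm

lemma cycleLength_iterate (k : ℕ) (z : Source → ℝ) : cycleLength coord (shiftMap^[k] z) =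
    departureTime coord (k + 1) z - departureTime coord k z := by
  induction k generalizing z with
  | zero => rfl
  | succ k ih =>
    rw [Function.iterate_succ_apply, ih, departureTime_shiftMap, departureTime_shiftMap]
    ring

/-- Started from the phase `ν τ₀`, the representative in `[0, 1)` of this phase is `ν` times the
delay from `t'_k` to the next point of the lattice `τ₀ + ℤ/ν`. -/
lemma departurePhase_iterate (k : ℕ) (z : Source → ℝ) (τ₀ : ℝ) :
    departurePhase nu ((phaseShift nu)^[k] (z, ((nu * τ₀ : ℝ) : UnitAddCircle))) =
      ((-(nu * (departureTime coord k z - τ₀)) : ℝ) : UnitAddCircle) := by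
  have h1 : sysTime coord 0 (shiftMap^[k] z) = sysTime coord k z := iterate_shiftMap_init k z
  rw [iterate_phaseShift, departurePhase]
  rw [h1, ← AddCircle.coe_sub, ← AddCircle.coe_sub, departureTime]
  congr 1
  ring

lemma natCeil_eq_add_fract {x : ℝ} (hx : 0 ≤ x) : (⌈x⌉₊ : ℝ) = x + Int.fract (-x) := by
  rw [natCast_ceil_eq_intCast_ceil hx, Int.fract, Int.floor_neg]
  push_cast
  ring

variable {nu}

/-- The condition `τ₀ ≤ t'_K` keeps the truncated ceiling equal to the integer one; earlier cycles
do not obey the recursion. -/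
lemma epochsBefore_succ (hnu : 0 < nu) {z : Source → ℝ} {τ₀ : ℝ}
    (hmono : Monotone fun k => departureTime coord k z) {K : ℕ}
    (hK : τ₀ ≤ departureTime coord K z) :
    epochsBefore coord nu τ₀ (K + 1) z = epochsBefore coord nu τ₀ K z +
      cycleCount nu ((phaseShift nu)^[K] (z, ((nu * τ₀ : ℝ) : UnitAddCircle))) := by
  have hx : 0 ≤ nu * (departureTime coord K z - τ₀) := mul_nonneg hnu.le (sub_nonneg.2 hK)
  have h1 := natCeil_eq_add_fract hx
  have h2 : nu * cycleLength coord ((phaseShift nu)^[K] (z, ((nu * τ₀ : ℝ) : UnitAddCircle))).1 -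
      delay (departurePhase nu ((phaseShift nu)^[K] (z, ((nu * τ₀ : ℝ) : UnitAddCircle)))) =
      nu * (departureTime coord (K + 1) z - τ₀) - (epochsBefore coord nu τ₀ K z : ℝ) := by
    rw [departurePhase_iterate, delay_coe, iterate_phaseShift, cycleLength_iterate, epochsBefore,
      h1]
    ring
  rw [cycleCount, h2, Nat.ceil_sub_natCast, ← epochsBefore]
  have := monotone_epochsBefore (τ₀ := τ₀) hnu hmono (show K ≤ K + 1 from K.le_succ)
  beta_reduce at this
  omega

lemma sum_aud_succ (hnu : 0 < nu) {z : Source → ℝ} {τ₀ : ℝ}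
    (hmono : Monotone fun k => departureTime coord k z) {K : ℕ}
    (hK : τ₀ ≤ departureTime coord K z) :
    ∑ j ∈ Finset.range (epochsBefore coord nu τ₀ (K + 1) z), aud coord (decisionEpoch nu τ₀ j) z =
      ∑ j ∈ Finset.range (epochsBefore coord nu τ₀ K z), aud coord (decisionEpoch nu τ₀ j) z +
        cycleAge nu ((phaseShift nu)^[K] (z, ((nu * τ₀ : ℝ) : UnitAddCircle))) := by
  have hx : 0 ≤ nu * (departureTime coord K z - τ₀) := mul_nonneg hnu.le (sub_nonneg.2 hK)
  have h1 : (epochsBefore coord nu τ₀ K z : ℝ) = _ := natCeil_eq_add_fract hx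
  have hsucc := epochsBefore_succ hnu hmono hK
  rw [hsucc, Finset.sum_range_add, cycleAge]
  congr 1
  refine Finset.sum_congr rfl fun i hi => ?_
  have hT : sysTime coord 0 ((phaseShift nu)^[K] (z, ((nu * τ₀ : ℝ) : UnitAddCircle))).1 =
      sysTime coord K z := by
    rw [iterate_phaseShift]; exact iterate_shiftMap_init K z
  rw [aud_eq hnu hmono (Nat.le_add_right _ _) (by rw [hsucc]; simpa using hi),
    departurePhase_iterate, delay_coe, hT, decisionEpoch]
  push_cast
  rw [h1]
  simp only [departureTime]
  field_simp
  ring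

/-- Between `t'_K` and `t'_{K+1}` the age is at least `T_K`. Decisions before `t'_0` are excluded:
their received index is a convention and their age may be negative. -/
lemma aud_nonneg (hnu : 0 < nu) {z : Source → ℝ} {τ₀ : ℝ}
    (hmono : Monotone fun k => departureTime coord k z) (hT : ∀ k, 0 ≤ sysTime coord k z)
    (htop : Tendsto (fun k => departureTime coord k z) atTop atTop) {j : ℕ}
    (hj : epochsBefore coord nu τ₀ 0 z ≤ j) : 0 ≤ aud coord (decisionEpoch nu τ₀ j) z := by
  classical
  have hex : ∃ K, decisionEpoch nu τ₀ j < departureTime coord K z :=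
    (htop.eventually_gt_atTop _).exists
  obtain ⟨K, hK⟩ : ∃ K, Nat.find hex = K + 1 := by
    refine Nat.exists_eq_succ_of_ne_zero fun h0 => ?_
    have := Nat.find_spec hex
    rw [h0, decisionEpoch_lt_iff hnu] at this
    omega
  have h2 := Nat.find_spec hex
  have h1 := Nat.find_min hex (m := K) (by omega)
  rw [hK] at h2
  rw [aud, lastReceived_eq hmono (not_lt.1 h1) h2]
  have h3 := not_lt.1 h1
  rw [departureTime] at h3
  linarith [hT K]

namespace IsStationaryMG1D

variable {m : Measure (Source → ℝ)} [IsProbabilityMeasure m] {lam mu : ℝ}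

/-! ### Moments of the cycle length -/

section Moments

variable [MeasurableSpace Ω] {P : Measure Ω} [IsProbabilityMeasure P] {Z : Source → Ω → ℝ}
  (h : IsStationaryMG1D P Z lam mu nu)
include h

omit [IsProbabilityMeasure P] in
lemma measurable_cycleLength : Measurable (cycleLength Z) :=
  (measurable_departureTime h.measurable 1).sub (measurable_departureTime h.measurable 0)

omit [IsProbabilityMeasure P] in
lemma ae_cycleLength_nonneg : ∀ᵐ ω ∂P, 0 ≤ cycleLength Z ω := by
  filter_upwards [h.ae_service_nonneg] with ω hS using cycleLength_nonneg (hS 1)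

omit [IsProbabilityMeasure P] in
lemma ae_cycleLength_le :
    ∀ᵐ ω ∂P, cycleLength Z ω ≤ interArrival Z 1 ω + service Z 1 ω := by
  filter_upwards [h.ae_sysTime_nonneg, h.ae_interArrival_pos] with ω hT hX
  exact cycleLength_le (hT 0) (hX 1).le

omit [IsProbabilityMeasure P] in
lemma memLp_cycleLength (hlam : 0 < lam) : MemLp (cycleLength Z) 2 P := by
  refine ((h.memLp_interArrival hlam 1).add (h.memLp_service 1)).mono
    h.measurable_cycleLength.aestronglyMeasurable ?_
  filter_upwards [h.ae_cycleLength_nonneg, h.ae_cycleLength_le] with ω h1 h2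
  rw [Real.norm_of_nonneg h1]
  exact h2.trans (le_abs_self _)

lemma integrable_cycleLength (hlam : 0 < lam) : Integrable (cycleLength Z) P :=
  (h.memLp_cycleLength hlam).integrable one_le_two

omit [IsProbabilityMeasure P] in
lemma integrable_cycleLength_sq (hlam : 0 < lam) : Integrable (fun ω => cycleLength Z ω ^ 2) P :=
  (memLp_two_iff_integrable_sq h.measurable_cycleLength.aestronglyMeasurable).1
    (h.memLp_cycleLength hlam)

lemma integrable_sysTime_mul_interArrival (hlam : 0 < lam) (hlt : lam < mu) :
    Integrable (fun ω => sysTime Z 0 ω * interArrival Z 1 ω) P :=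
  h.indepFun_sysTime_interArrival.integrable_mul (h.integrable_sysTime hlam hlt 0)
    (h.integrable_interArrival hlam 1)

lemma integrable_sysTime_mul_service (hlam : 0 < lam) (hlt : lam < mu) :
    Integrable (fun ω => sysTime Z 0 ω * service Z 1 ω) P :=
  h.indepFun_sysTime_service.integrable_mul (h.integrable_sysTime hlam hlt 0)
    (h.integrable_service 1)

/-- `L` depends on `T`, but its majorant `X + S` does not, so a first moment of `T` is enough. -/
lemma integrable_sysTime_mul_cycleLength (hlam : 0 < lam) (hlt : lam < mu) :
    Integrable (fun ω => sysTime Z 0 ω * cycleLength Z ω) P := by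
  refine ((h.integrable_sysTime_mul_interArrival hlam hlt).add
    (h.integrable_sysTime_mul_service hlam hlt)).mono'
    ((measurable_sysTime h.measurable 0).mul h.measurable_cycleLength).aestronglyMeasurable ?_
  filter_upwards [h.ae_sysTime_zero_nonneg, h.ae_cycleLength_nonneg, h.ae_cycleLength_le]
    with ω h0 h1 h2
  rw [Real.norm_of_nonneg (mul_nonneg h0 h1), Pi.add_apply, ← mul_add]
  gcongr

lemma integral_cycleLength (hlam : 0 < lam) (hlt : lam < mu) :
    ∫ ω, cycleLength Z ω ∂P = 1 / lam := by
  have h1 : ∀ ω, cycleLength Z ω = interArrival Z 1 ω + (sysTime Z 1 ω - sysTime Z 0 ω) := by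
    intro ω
    rw [cycleLength_eq, sysTime_succ]
    ring
  simp_rw [h1]
  have hi : Integrable (fun ω => sysTime Z 1 ω - sysTime Z 0 ω) P :=
    (h.integrable_sysTime hlam hlt 1).sub (h.integrable_sysTime hlam hlt 0)
  rw [integral_add (h.integrable_interArrival hlam 1) hi,
    integral_sub (h.integrable_sysTime hlam hlt 1) (h.integrable_sysTime hlam hlt 0),
    h.integral_sysTime_one, h.integral_interArrival hlam, sub_self, add_zero]

end Moments

variable (h : IsStationaryMG1D m MG1D.coord lam mu nu)
include h

lemma ae_tendsto_departureTime (hlam : 0 < lam) :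
    ∀ᵐ z ∂m, Tendsto (fun k => departureTime MG1D.coord k z) atTop atTop := by
  filter_upwards [h.ae_tendsto_sum_interArrival hlam, h.ae_sysTime_nonneg] with z hz hT
  have h1 := hz.pos_mul_atTop (by positivity) (tendsto_natCast_atTop_atTop (R := ℝ))
  refine tendsto_atTop_mono' atTop ?_ h1
  filter_upwards [eventually_gt_atTop 0] with n hn
  have hn' : (n : ℝ) ≠ 0 := by exact_mod_cast hn.ne'
  have harr : arrivalTime MG1D.coord n z =
      ∑ i ∈ Finset.range n, interArrival MG1D.coord (i + 1) z := by
    clear hn hn'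
    induction n with
    | zero => rfl
    | succ n ih => rw [arrivalTime_succ, ih, Finset.sum_range_succ]
  rw [div_mul_cancel₀ _ hn', departureTime, harr]
  linarith [hT n]

omit [IsProbabilityMeasure m] h in
lemma measurable_departurePhase : Measurable (departurePhase nu) :=
  measurable_snd.sub (AddCircle.measurable_mk'.comp
    (((measurable_sysTime measurable_coord 0).comp measurable_fst).const_mul nu))

omit [IsProbabilityMeasure m] in
lemma measurable_cycleCount : Measurable (cycleCount nu) :=
  Nat.measurable_ceil.comp (((h.measurable_cycleLength.comp measurable_fst).const_mul nu).sub
    (measurable_delay.comp measurable_departurePhase))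

omit [IsProbabilityMeasure m] in
lemma measurable_cycleAge : Measurable (cycleAge nu) := by
  have h1 : ∀ p, cycleAge nu p = cycleCount nu p *
      (sysTime MG1D.coord 0 p.1 + delay (departurePhase nu p) / nu) +
      cycleCount nu p * (cycleCount nu p - 1) / 2 * (1 / nu) := by
    intro p
    rw [cycleAge, ← sum_range_affine]
    refine Finset.sum_congr rfl fun i _ => by ring
  have h2 : Measurable fun p => (cycleCount nu p : ℝ) :=
    measurable_from_nat.comp h.measurable_cycleCount
  have h3 : Measurable fun p : (Source → ℝ) × UnitAddCircle => sysTime MG1D.coord 0 p.1 :=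
    (measurable_sysTime measurable_coord 0).comp measurable_fst
  have h4 : Measurable fun p => delay (departurePhase nu p) :=
    measurable_delay.comp measurable_departurePhase
  rw [funext h1]
  fun_prop

omit [IsProbabilityMeasure m] h in
lemma ae_prod_of_ae {p : (Source → ℝ) → Prop} (hp : ∀ᵐ z ∂m, p z) :
    ∀ᵐ q ∂(m.prod (volume : Measure UnitAddCircle)), p q.1 :=
  Measure.quasiMeasurePreserving_fst.ae hp

omit [IsProbabilityMeasure m] in
lemma ae_cycleCount_le (hnu : 0 < nu) : ∀ᵐ q ∂(m.prod (volume : Measure UnitAddCircle)),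
    (cycleCount nu q : ℝ) ≤ nu * cycleLength MG1D.coord q.1 + 1 := by
  filter_upwards [ae_prod_of_ae h.ae_cycleLength_nonneg] with q hq
  exact natCeil_sub_le (delay_nonneg _) (mul_nonneg hnu.le hq)

lemma integrable_cycleCount (hlam : 0 < lam) (hnu : 0 < nu) :
    Integrable (fun q => (cycleCount nu q : ℝ)) (m.prod (volume : Measure UnitAddCircle)) := by
  have h1 : Integrable (fun z => nu * cycleLength MG1D.coord z + 1) m :=
    ((h.integrable_cycleLength hlam).const_mul nu).add (integrable_const 1)
  refine (h1.comp_fst volume).mono'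
    (measurable_from_nat.comp h.measurable_cycleCount).aestronglyMeasurable ?_
  filter_upwards [h.ae_cycleCount_le hnu] with q hq
  rwa [Real.norm_of_nonneg (Nat.cast_nonneg _)]

lemma integrable_cycleAge (hlam : 0 < lam) (hlt : lam < mu) (hnu : 0 < nu) :
    Integrable (cycleAge nu) (m.prod (volume : Measure UnitAddCircle)) := by
  set T := sysTime MG1D.coord 0
  set L := cycleLength MG1D.coord
  have h1 : Integrable (fun z => nu * (T z * L z) + T z + nu * L z ^ 2 + 2 * L z + 1 / nu) m :=
    (((((h.integrable_sysTime_mul_cycleLength hlam hlt).const_mul nu).add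
      (h.integrable_sysTime hlam hlt 0)).add ((h.integrable_cycleLength_sq hlam).const_mul nu)).add
      ((h.integrable_cycleLength hlam).const_mul 2)).add (integrable_const _)
  refine (h1.comp_fst volume).mono' h.measurable_cycleAge.aestronglyMeasurable ?_
  filter_upwards [h.ae_cycleCount_le hnu, ae_prod_of_ae h.ae_sysTime_zero_nonneg,
    ae_prod_of_ae h.ae_cycleLength_nonneg] with q hq hT hL
  -- The last decision comes before the cycle ends, up to rounding; each age is at most `T + L +
  -- 1/ν` and there are at most `νL + 1` of them.
  have hterm : ∀ i ∈ Finset.range (cycleCount nu q),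
      T q.1 + (delay (departurePhase nu q) + i) / nu ≤ T q.1 + (nu * L q.1 + 1) / nu := by
    intro i hi
    have h2 : ((i + 1 : ℕ) : ℝ) ≤ cycleCount nu q := by exact_mod_cast Finset.mem_range.1 hi
    push_cast at h2
    have h3 := (delay_lt_one (departurePhase nu q)).le
    exact add_le_add_right (div_le_div_of_nonneg_right (by linarith) hnu.le) _
  have hsum := Finset.sum_le_sum hterm
  rw [Finset.sum_const, Finset.card_range, nsmul_eq_mul] at hsum
  have hnonneg : 0 ≤ cycleAge nu q := Finset.sum_nonneg fun i _ => by
    have := delay_nonneg (departurePhase nu q)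
    positivity
  rw [Real.norm_of_nonneg hnonneg]
  refine hsum.trans ((mul_le_mul_of_nonneg_right hq (by positivity)).trans_eq ?_)
  field_simp
  ring

lemma integral_cycleCount (hlam : 0 < lam) (hlt : lam < mu) (hnu : 0 < nu) :
    ∫ q, (cycleCount nu q : ℝ) ∂(m.prod (volume : Measure UnitAddCircle)) = nu / lam := by
  rw [integral_prod _ (h.integrable_cycleCount hlam hnu)]
  have h1 : ∀ᵐ z ∂m, ∫ ψ : UnitAddCircle, (cycleCount nu (z, ψ) : ℝ) =
      nu * cycleLength MG1D.coord z := by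
    filter_upwards [h.ae_cycleLength_nonneg] with z hz
    have h2 := integral_comp_delay_sub (fun x => (⌈nu * cycleLength MG1D.coord z - x⌉₊ : ℝ))
      ((nu * sysTime MG1D.coord 0 z : ℝ) : UnitAddCircle)
    rw [intervalIntegral_natCeil_id (mul_nonneg hnu.le hz)] at h2
    exact h2
  rw [integral_congr_ae h1, integral_const_mul, h.integral_cycleLength hlam hlt, mul_one_div]

lemma integral_cycleAge (hlam : 0 < lam) (hlt : lam < mu) (hnu : 0 < nu) :
    ∫ q, cycleAge nu q ∂(m.prod (volume : Measure UnitAddCircle)) =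
      nu * ∫ z, (sysTime MG1D.coord 0 z * cycleLength MG1D.coord z +
        cycleLength MG1D.coord z ^ 2 / 2) ∂m := by
  rw [integral_prod _ (h.integrable_cycleAge hlam hlt hnu), ← integral_const_mul]
  refine integral_congr_ae ?_
  filter_upwards [h.ae_cycleLength_nonneg] with z hz
  have h2 := integral_comp_delay_sub
    (fun x => ∑ i ∈ Finset.range ⌈nu * cycleLength MG1D.coord z - x⌉₊,
      (sysTime MG1D.coord 0 z + (x + i) / nu))
    ((nu * sysTime MG1D.coord 0 z : ℝ) : UnitAddCircle)
  rw [intervalIntegral_sum_natCeil (mul_nonneg hnu.le hz)] at h2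
  refine h2.trans ?_
  field_simp

omit h [IsProbabilityMeasure m] in
lemma _root_.MG1D.Agree.cycle {z z' : Source → ℝ} (hz : Agree z z') :
    sysTime MG1D.coord 0 z = sysTime MG1D.coord 0 z' ∧
      cycleLength MG1D.coord z = cycleLength MG1D.coord z' := by
  have hT : sysTime MG1D.coord 0 z = sysTime MG1D.coord 0 z' := hz.1
  have hX : interArrival MG1D.coord 1 z = interArrival MG1D.coord 1 z' :=
    hz.2 (.interArrival 1) Nat.one_pos
  have hS : service MG1D.coord 1 z = service MG1D.coord 1 z' := hz.2 (.service 1) Nat.one_pos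
  exact ⟨hT, by rw [cycleLength_eq, cycleLength_eq, hT, hX, hS]⟩

/-- The average age upon decision of the system with periodic decisions. -/
theorem ae_tendsto_meanAuD_coord (hlam : 0 < lam) (hlt : lam < mu) (hnu : 0 < nu) (τ₀ : ℝ) :
    ∀ᵐ z ∂m, Tendsto (fun n => meanAuD MG1D.coord nu τ₀ n z) atTop
      (𝓝 (lam * ∫ z, (sysTime MG1D.coord 0 z * cycleLength MG1D.coord z +
        cycleLength MG1D.coord z ^ 2 / 2) ∂m)) := by
  have hcount : ∀ z z' ψ, Agree z z' → cycleCount nu (z, ψ) = cycleCount nu (z', ψ) := by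
    intro z z' ψ hz
    simp only [cycleCount, departurePhase, hz.cycle.1, hz.cycle.2]
  have hage : ∀ z z' ψ, Agree z z' → cycleAge nu (z, ψ) = cycleAge nu (z', ψ) := by
    intro z z' ψ hz
    simp only [cycleAge, hcount z z' ψ hz, departurePhase, hz.cycle.1]
  have hC := h.ae_tendsto_birkhoffSum (g := fun q => (cycleCount nu q : ℝ)) hlam hlt hnu.ne'
    (measurable_from_nat.comp h.measurable_cycleCount) (h.integrable_cycleCount hlam hnu)
    (fun z z' ψ hz => by rw [hcount z z' ψ hz]) ((nu * τ₀ : ℝ) : UnitAddCircle)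
  have hG := h.ae_tendsto_birkhoffSum (g := cycleAge nu) hlam hlt hnu.ne'
    h.measurable_cycleAge (h.integrable_cycleAge hlam hlt hnu) hage
    ((nu * τ₀ : ℝ) : UnitAddCircle)
  rw [h.integral_cycleCount hlam hlt hnu] at hC
  rw [h.integral_cycleAge hlam hlt hnu] at hG
  filter_upwards [hC, hG, h.ae_tendsto_departureTime hlam, h.ae_sysTime_nonneg,
    h.ae_service_nonneg] with z hC hG htop hT hS
  have hmono : Monotone fun k => departureTime MG1D.coord k z :=
    monotone_nat_of_le_succ fun k => departureTime_le_succ (hS (k + 1))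
  -- From `K₀` on, counts and age sums grow exactly by the Birkhoff terms; the earlier cycles do not
  -- affect the limits.
  obtain ⟨K₀, hK₀⟩ := (htop.eventually_ge_atTop τ₀).exists
  have hge : ∀ K, K₀ ≤ K → τ₀ ≤ departureTime MG1D.coord K z := fun K hK => hK₀.trans (hmono hK)
  have hN : Tendsto (fun K : ℕ => (epochsBefore MG1D.coord nu τ₀ K z : ℝ) / K) atTop
      (𝓝 (nu / lam)) :=
    tendsto_div_of_eventually_add
      (fun K hK => by rw [epochsBefore_succ hnu hmono (hge K hK), Nat.cast_add]) hC
  have hs := tendsto_div_of_eventually_add (x := fun K =>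
      ∑ j ∈ Finset.range (epochsBefore MG1D.coord nu τ₀ K z),
        aud MG1D.coord (decisionEpoch nu τ₀ j) z)
    (fun K hK => sum_aud_succ hnu hmono (hge K hK)) hG
  have hfin := tendsto_sum_div_of_subseq (fun j hj => aud_nonneg hnu hmono hT htop hj)
    (div_pos hnu hlam) hN hs
  have heq : ∀ x : ℝ, nu * x / (nu / lam) = lam * x := fun x => by field_simp
  rw [heq] at hfin
  exact hfin

end IsStationaryMG1D
end Periodic

/-! ### The closed expression -/

section Formula

variable {Ω : Type*}

/-- The count `N¹` on the event that it is relevant. -/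
noncomputable def busyCount (Z : Source → Ω → ℝ) (nu : ℝ) : Ω → ℝ :=
  (busy Z 0).indicator fun ω => (count1 Z nu 0 ω : ℝ)

/-- The count `N²` on the event that it is relevant. -/
noncomputable def idleCount (Z : Source → Ω → ℝ) (nu : ℝ) : Ω → ℝ :=
  (busy Z 0)ᶜ.indicator fun ω => (count2 Z nu 0 ω : ℝ)

/-- The count `N³` on the event that it is relevant. -/
noncomputable def serviceCount (Z : Source → Ω → ℝ) (nu : ℝ) : Ω → ℝ :=
  (busy Z 0)ᶜ.indicator fun ω => (count3 Z nu 0 ω : ℝ)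

lemma approxCount_eq (Z : Source → Ω → ℝ) (nu : ℝ) (ω : Ω) :
    (approxCount Z nu 0 ω : ℝ) = busyCount Z nu ω + idleCount Z nu ω + serviceCount Z nu ω := by
  by_cases hω : ω ∈ busy Z 0 <;> simp [approxCount, busyCount, idleCount, serviceCount, hω]

/-- The busy count lives on the complement of the event carrying the other two, so only one cross
term survives. -/
lemma approxCount_sq_eq (Z : Source → Ω → ℝ) (nu : ℝ) (ω : Ω) :
    (approxCount Z nu 0 ω : ℝ) ^ 2 = busyCount Z nu ω ^ 2 + idleCount Z nu ω ^ 2 +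
      serviceCount Z nu ω ^ 2 + 2 * (idleCount Z nu ω * serviceCount Z nu ω) := by
  rw [approxCount_eq]
  by_cases hω : ω ∈ busy Z 0 <;> simp [busyCount, idleCount, serviceCount, hω]
  ring

lemma approxAgeSum_eq (Z : Source → Ω → ℝ) (nu : ℝ) (ω : Ω) : approxAgeSum Z nu 0 ω =
    sysTime Z 0 ω * approxCount Z nu 0 ω + approxCount Z nu 0 ω * Z (.ageOffset 0) ω +
      (approxCount Z nu 0 ω ^ 2 - approxCount Z nu 0 ω) / (2 * nu) := by
  rw [approxAgeSum, Finset.sum_congr rfl fun i _ => by rw [div_eq_mul_inv (i : ℝ) nu],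
    sum_range_affine, div_eq_mul_inv _ (2 * nu), mul_inv]
  ring

lemma count1_eq (Z : Source → Ω → ℝ) (nu : ℝ) (ω : Ω) :
    count1 Z nu 0 ω = countDecisions nu (Z (.offset1 0) ω) (cycleLength Z ω) := rfl

lemma count2_eq (Z : Source → Ω → ℝ) (nu : ℝ) (ω : Ω) : count2 Z nu 0 ω =
    countDecisions nu (Z (.offset2 0) ω) (interArrival Z 1 ω - sysTime Z 0 ω) := by
  simp [count2, departureTime, arrivalTime]

lemma count3_eq (Z : Source → Ω → ℝ) (nu : ℝ) (ω : Ω) : count3 Z nu 0 ω =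
    countDecisions nu (Z (.offset3 0) ω) (sysTime Z 1 ω) := by
  simp [count3, departureTime]

lemma cycleLength_of_busy {Z : Source → Ω → ℝ} {ω : Ω} (hω : ω ∈ busy Z 0) :
    cycleLength Z ω = service Z 1 ω := by
  rw [mem_busy] at hω
  rw [cycleLength_eq, max_eq_left (sub_nonneg.2 hω)]
  ring

lemma sysTime_one_of_idle {Z : Source → Ω → ℝ} {ω : Ω} (hω : ω ∉ busy Z 0) :
    sysTime Z 1 ω = service Z 1 ω := by
  rw [mem_busy, not_le] at hω
  rw [sysTime_succ, max_eq_right (sub_nonpos.2 hω.le), zero_add]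

lemma cycleLength_of_idle {Z : Source → Ω → ℝ} {ω : Ω} (hω : ω ∉ busy Z 0) :
    cycleLength Z ω = interArrival Z 1 ω - sysTime Z 0 ω + service Z 1 ω := by
  rw [mem_busy, not_le] at hω
  rw [cycleLength_eq, max_eq_right (sub_nonpos.2 hω.le), add_zero]

variable [MeasurableSpace Ω] {P : Measure Ω} {Z : Source → Ω → ℝ} {lam mu nu : ℝ}

lemma integral_map_of_isUniform (hnu : 0 < nu) {o : Ω → ℝ}
    (hunif : pdf.IsUniform o (Set.Ioo 0 (1 / nu)) P) (f : ℝ → ℝ) :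
    ∫ u, f u ∂(P.map o) = ∫ x in (0)..1, f (x / nu) := by
  have hpos : 0 < 1 / nu := one_div_pos.2 hnu
  rw [hunif, ProbabilityTheory.cond, integral_smul_measure, Real.volume_Ioo, sub_zero,
    ENNReal.toReal_inv, ENNReal.toReal_ofReal hpos.le, ← integral_Ioc_eq_integral_Ioo,
    ← intervalIntegral.integral_of_le hpos.le, intervalIntegral.integral_comp_div f hnu.ne',
    zero_div, one_div, inv_inv]

lemma ae_pos_of_isUniform {o : Ω → ℝ} (ho : Measurable o)
    (hunif : pdf.IsUniform o (Set.Ioo 0 (1 / nu)) P) : ∀ᵐ ω ∂P, 0 < o ω ∧ o ω < 1 / nu := by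
  refine ae_of_ae_map (f := o) (p := fun x => 0 < x ∧ x < 1 / nu) ho.aemeasurable ?_
  rw [hunif]
  exact ProbabilityTheory.ae_cond_mem measurableSet_Ioo

lemma condMean_eq (A : Set Ω) (f : Ω → ℝ) :
    condMean P A f = (P.real A)⁻¹ * ∫ ω in A, f ω ∂P := by
  rw [condMean, ProbabilityTheory.cond, integral_smul_measure, ENNReal.toReal_inv, smul_eq_mul]
  rfl

lemma measurable_countDecisions (hnu : 0 < nu) {a L : Ω → ℝ} (ha : Measurable a)
    (hL : Measurable L) : Measurable fun ω => countDecisions nu (a ω) (L ω) := by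
  simp only [countDecisions_eq_ceil hnu]
  exact Nat.measurable_ceil.comp ((hL.const_mul nu).sub (ha.const_mul nu))

lemma measurable_count1 (hnu : 0 < nu) (hZ : ∀ s, Measurable (Z s)) (k : ℕ) :
    Measurable (count1 Z nu k) :=
  measurable_countDecisions hnu (hZ _)
    ((measurable_departureTime hZ _).sub (measurable_departureTime hZ _))

lemma measurable_count2 (hnu : 0 < nu) (hZ : ∀ s, Measurable (Z s)) (k : ℕ) :
    Measurable (count2 Z nu k) :=
  measurable_countDecisions hnu (hZ _)
    ((measurable_arrivalTime hZ _).sub (measurable_departureTime hZ _))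

lemma measurable_count3 (hnu : 0 < nu) (hZ : ∀ s, Measurable (Z s)) (k : ℕ) :
    Measurable (count3 Z nu k) :=
  measurable_countDecisions hnu (hZ _)
    ((measurable_departureTime hZ _).sub (measurable_arrivalTime hZ _))

lemma measurable_busyCount (hnu : 0 < nu) (hZ : ∀ s, Measurable (Z s)) :
    Measurable (busyCount Z nu) :=
  (measurable_from_nat.comp (measurable_count1 hnu hZ 0)).indicator (measurableSet_busy hZ 0)

lemma measurable_idleCount (hnu : 0 < nu) (hZ : ∀ s, Measurable (Z s)) :
    Measurable (idleCount Z nu) :=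
  (measurable_from_nat.comp (measurable_count2 hnu hZ 0)).indicator (measurableSet_busy hZ 0).compl

lemma measurable_serviceCount (hnu : 0 < nu) (hZ : ∀ s, Measurable (Z s)) :
    Measurable (serviceCount Z nu) :=
  (measurable_from_nat.comp (measurable_count3 hnu hZ 0)).indicator (measurableSet_busy hZ 0).compl

lemma measurable_approxCount (hnu : 0 < nu) (hZ : ∀ s, Measurable (Z s)) :
    Measurable fun ω => (approxCount Z nu 0 ω : ℝ) := by
  simp only [approxCount_eq]
  exact ((measurable_busyCount hnu hZ).add (measurable_idleCount hnu hZ)).add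
    (measurable_serviceCount hnu hZ)

lemma measurable_approxAgeSum (hnu : 0 < nu) (hZ : ∀ s, Measurable (Z s)) :
    Measurable (approxAgeSum Z nu 0) := by
  have h1 := measurable_approxCount hnu hZ
  have h2 := measurable_sysTime hZ 0
  have h3 := hZ (.ageOffset 0)
  rw [funext (approxAgeSum_eq Z nu)]
  fun_prop

lemma condMean_map {Ω' : Type*} [MeasurableSpace Ω'] {J : Ω → Ω'} (hJ : Measurable J) {A : Set Ω'}
    (hA : MeasurableSet A) {f : Ω' → ℝ} (hf : Measurable f) :
    condMean (P.map J) A f = condMean P (J ⁻¹' A) fun ω => f (J ω) := by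
  rw [condMean_eq, condMean_eq, map_measureReal_apply hJ hA, Measure.restrict_map hJ hA,
    integral_map hJ.aemeasurable hf.aestronglyMeasurable]

lemma formula_map_joint (hnu : 0 < nu) (hZ : ∀ s, Measurable (Z s)) :
    formula (P.map (joint Z)) coord lam mu nu 0 = formula P Z lam mu nu 0 := by
  have hJ := measurable_joint hZ
  have hb : joint Z ⁻¹' busy coord 0 = busy Z 0 := rfl
  have hbc : joint Z ⁻¹' (busy coord 0)ᶜ = (busy Z 0)ᶜ := rfl
  have hm := measurableSet_busy measurable_coord 0
  have hT := measurable_sysTime measurable_coord 0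
  have h1 : Measurable fun z => (count1 coord nu 0 z : ℝ) :=
    measurable_from_nat.comp (measurable_count1 hnu measurable_coord 0)
  have h2 : Measurable fun z => (count2 coord nu 0 z : ℝ) :=
    measurable_from_nat.comp (measurable_count2 hnu measurable_coord 0)
  have h3 : Measurable fun z => (count3 coord nu 0 z : ℝ) :=
    measurable_from_nat.comp (measurable_count3 hnu measurable_coord 0)
  simp only [formula]
  rw [condMean_map hJ hm hT, condMean_map hJ hm.compl hT, condMean_map hJ hm h1,
    condMean_map hJ hm (h1.pow_const 2), condMean_map hJ hm.compl h2,
    condMean_map hJ hm.compl (h2.pow_const 2), condMean_map hJ hm.compl h3,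
    condMean_map hJ hm.compl (h3.pow_const 2), hb, hbc]
  rfl

namespace IsStationaryMG1D

section Bounds

variable (h : IsStationaryMG1D P Z lam mu nu)
include h

/-- All counts of an inter-departure interval are bounded by its length, up to scaling. -/
lemma ae_count_le (hnu : 0 < nu) : ∀ᵐ ω ∂P,
    (count1 Z nu 0 ω : ℝ) ≤ nu * cycleLength Z ω + 1 ∧
    (ω ∉ busy Z 0 → (count2 Z nu 0 ω : ℝ) ≤ nu * cycleLength Z ω + 1) ∧
    (ω ∉ busy Z 0 → (count3 Z nu 0 ω : ℝ) ≤ nu * cycleLength Z ω + 1) := by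
  filter_upwards [h.ae_service_nonneg, ae_pos_of_isUniform (h.measurable _) (h.offset1_uniform 0),
    ae_pos_of_isUniform (h.measurable _) (h.offset2_uniform 0),
    ae_pos_of_isUniform (h.measurable _) (h.offset3_uniform 0)] with ω hS h1 h2 h3
  have hS1 := hS 1
  simp only [count1_eq, count2_eq, count3_eq, countDecisions_eq_ceil hnu]
  refine ⟨natCeil_sub_le (mul_pos hnu h1.1).le (mul_nonneg hnu.le (cycleLength_nonneg hS1)),
    fun hω => ?_, fun hω => ?_⟩
  · have hI : 0 ≤ interArrival Z 1 ω - sysTime Z 0 ω := sub_nonneg.2 (not_le.1 hω).le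
    refine (natCeil_sub_le (mul_pos hnu h2.1).le (mul_nonneg hnu.le hI)).trans ?_
    rw [cycleLength_of_idle hω]
    nlinarith
  · have hI : 0 ≤ interArrival Z 1 ω - sysTime Z 0 ω := sub_nonneg.2 (not_le.1 hω).le
    rw [sysTime_one_of_idle hω]
    refine (natCeil_sub_le (mul_pos hnu h3.1).le (mul_nonneg hnu.le hS1)).trans ?_
    rw [cycleLength_of_idle hω]
    nlinarith

lemma ae_busyCount_le (hnu : 0 < nu) : ∀ᵐ ω ∂P,
    0 ≤ busyCount Z nu ω ∧ busyCount Z nu ω ≤ nu * cycleLength Z ω + 1 := by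
  filter_upwards [h.ae_count_le hnu, h.ae_cycleLength_nonneg] with ω hω hL
  refine ⟨Set.indicator_nonneg (fun _ _ => Nat.cast_nonneg _) _, ?_⟩
  by_cases hb : ω ∈ busy Z 0
  · rw [busyCount, Set.indicator_of_mem hb]; exact hω.1
  · rw [busyCount, Set.indicator_of_notMem hb]; positivity

lemma ae_idleCount_le (hnu : 0 < nu) : ∀ᵐ ω ∂P,
    0 ≤ idleCount Z nu ω ∧ idleCount Z nu ω ≤ nu * cycleLength Z ω + 1 := by
  filter_upwards [h.ae_count_le hnu, h.ae_cycleLength_nonneg] with ω hω hL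
  refine ⟨Set.indicator_nonneg (fun _ _ => Nat.cast_nonneg _) _, ?_⟩
  by_cases hb : ω ∈ busy Z 0
  · rw [idleCount, Set.indicator_of_notMem (by simpa using hb)]; positivity
  · rw [idleCount, Set.indicator_of_mem hb]; exact hω.2.1 hb

lemma ae_serviceCount_le (hnu : 0 < nu) : ∀ᵐ ω ∂P,
    0 ≤ serviceCount Z nu ω ∧ serviceCount Z nu ω ≤ nu * cycleLength Z ω + 1 := by
  filter_upwards [h.ae_count_le hnu, h.ae_cycleLength_nonneg] with ω hω hL
  refine ⟨Set.indicator_nonneg (fun _ _ => Nat.cast_nonneg _) _, ?_⟩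
  by_cases hb : ω ∈ busy Z 0
  · rw [serviceCount, Set.indicator_of_notMem (by simpa using hb)]; positivity
  · rw [serviceCount, Set.indicator_of_mem hb]; exact hω.2.2 hb

variable [IsProbabilityMeasure P]

lemma integrable_of_le_cycleLength (hlam : 0 < lam) {f : Ω → ℝ} (hf : Measurable f)
    (hle : ∀ᵐ ω ∂P, 0 ≤ f ω ∧ f ω ≤ nu * cycleLength Z ω + 1) : Integrable f P := by
  have h1 : Integrable (fun ω => nu * cycleLength Z ω + 1) P :=
    ((h.integrable_cycleLength hlam).const_mul nu).add (integrable_const 1)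
  refine h1.mono' hf.aestronglyMeasurable ?_
  filter_upwards [hle] with ω hω
  rw [Real.norm_of_nonneg hω.1]
  exact hω.2

lemma integrable_mul_of_le_cycleLength (hlam : 0 < lam) {f g : Ω → ℝ} (hf : Measurable f)
    (hg : Measurable g) (hfle : ∀ᵐ ω ∂P, 0 ≤ f ω ∧ f ω ≤ nu * cycleLength Z ω + 1)
    (hgle : ∀ᵐ ω ∂P, 0 ≤ g ω ∧ g ω ≤ nu * cycleLength Z ω + 1) :
    Integrable (fun ω => f ω * g ω) P := by
  have h1 : Integrable
      (fun ω => nu ^ 2 * cycleLength Z ω ^ 2 + 2 * nu * cycleLength Z ω + 1) P :=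
    (((h.integrable_cycleLength_sq hlam).const_mul (nu ^ 2)).add
      ((h.integrable_cycleLength hlam).const_mul (2 * nu))).add (integrable_const 1)
  refine h1.mono' (hf.mul hg).aestronglyMeasurable ?_
  filter_upwards [hfle, hgle] with ω hf hg
  rw [Real.norm_of_nonneg (mul_nonneg hf.1 hg.1)]
  refine (mul_le_mul hf.2 hg.2 hg.1 (hf.1.trans hf.2)).trans_eq ?_
  ring

lemma integrable_sysTime_mul_of_le_cycleLength (hlam : 0 < lam) (hlt : lam < mu) {f : Ω → ℝ}
    (hf : Measurable f) (hle : ∀ᵐ ω ∂P, 0 ≤ f ω ∧ f ω ≤ nu * cycleLength Z ω + 1) :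
    Integrable (fun ω => sysTime Z 0 ω * f ω) P := by
  have h1 : Integrable (fun ω => nu * (sysTime Z 0 ω * cycleLength Z ω) + sysTime Z 0 ω) P :=
    ((h.integrable_sysTime_mul_cycleLength hlam hlt).const_mul nu).add
      (h.integrable_sysTime hlam hlt 0)
  refine h1.mono' ((measurable_sysTime h.measurable 0).mul hf).aestronglyMeasurable ?_
  filter_upwards [hle, h.ae_sysTime_zero_nonneg] with ω hω hT
  rw [Real.norm_of_nonneg (mul_nonneg hT hω.1)]
  refine (mul_le_mul_of_nonneg_left hω.2 hT).trans_eq ?_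
  ring

end Bounds

/-- Integrating out a uniform offset. -/
lemma integral_mul_countDecisions {m : Measure (Source → ℝ)} [IsProbabilityMeasure m]
    (h : IsStationaryMG1D m MG1D.coord lam mu nu) (hnu : 0 < nu) {s : Source}
    (hs : pdf.IsUniform (MG1D.coord s) (Set.Ioo 0 (1 / nu)) m) {w y : (Source → ℝ) → ℝ}
    (hw : Measurable w) (hy : Measurable y) (hwmask : ∀ z, w (mask {s}ᶜ z) = w z)
    (hymask : ∀ z, y (mask {s}ᶜ z) = y z) (hpos : ∀ᵐ z ∂m, w z ≠ 0 → 0 ≤ y z) {Φ : ℕ → ℝ}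
    {Ψ : ℝ → ℝ} (hΦ : ∀ y, 0 ≤ y → ∫ x in (0)..1, Φ ⌈y - x⌉₊ = Ψ y)
    (hint : Integrable (fun z => w z * Φ (countDecisions nu (z s) (y z))) m) :
    ∫ z, w z * Φ (countDecisions nu (z s) (y z)) ∂m = ∫ z, w z * Ψ (nu * y z) ∂m := by
  set F : ℝ × ℝ → ℝ → ℝ := fun v u => v.1 * Φ ⌈nu * v.2 - nu * u⌉₊ with hF
  have hFm : Measurable (Function.uncurry F) := by
    refine measurable_fst.fst.mul (measurable_from_nat.comp (Nat.measurable_ceil.comp ?_))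
    exact (measurable_fst.snd.const_mul nu).sub (measurable_snd.const_mul nu)
  have hind : IndepFun (fun z => (w z, y z)) (MG1D.coord s) m :=
    indepFun_of_mask (Z := MG1D.coord) (f := fun z => (w z, y z)) (g := MG1D.coord s)
      measurable_coord h.indep {s}ᶜ {s} disjoint_compl_left (hw.prodMk hy) (measurable_coord s)
      (fun z => by rw [hwmask, hymask]) (fun z => mask_of_mem (Set.mem_singleton s) z)
  have hFeq : ∀ z, w z * Φ (countDecisions nu (z s) (y z)) = F (w z, y z) (MG1D.coord s z) :=
    fun z => by simp only [hF, countDecisions_eq_ceil hnu, MG1D.coord]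
  simp_rw [hFeq] at hint ⊢
  rw [integral_comp_of_indepFun (hw.prodMk hy) (measurable_coord s) hind hFm hint]
  refine integral_congr_ae ?_
  filter_upwards [hpos] with z hz
  rw [integral_map_of_isUniform hnu hs]
  simp only [hF]
  -- The length is known to be nonnegative only where the weight, typically an indicator, does not
  -- vanish.
  by_cases hw0 : w z = 0
  · simp [hw0]
  · rw [intervalIntegral.integral_const_mul, ← hΦ _ (mul_nonneg hnu.le (hz hw0))]
    congr 2 with x
    rw [mul_div_cancel₀ x hnu.ne']

end IsStationaryMG1D
end Formula

/-! ### Evaluation of the closed expression -/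

section Evaluation

/-- The queue up to the departure of the update `1` does not depend on the other sources. -/
lemma queue_mask {s : Source} (h0 : s ≠ .init) (h1 : s ≠ .interArrival 1) (h2 : s ≠ .service 1)
    (z : Source → ℝ) :
    sysTime coord 0 (mask {s}ᶜ z) = sysTime coord 0 z ∧
      interArrival coord 1 (mask {s}ᶜ z) = interArrival coord 1 z ∧
        service coord 1 (mask {s}ᶜ z) = service coord 1 z :=
  ⟨mask_of_mem (Ne.symm h0) z, mask_of_mem (Ne.symm h1) z, mask_of_mem (Ne.symm h2) z⟩

lemma busy_mask {s : Source} (h0 : s ≠ .init) (h1 : s ≠ .interArrival 1)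
    (z : Source → ℝ) : mask {s}ᶜ z ∈ busy coord 0 ↔ z ∈ busy coord 0 := by
  have e0 : sysTime coord 0 (mask {s}ᶜ z) = sysTime coord 0 z := mask_of_mem (Ne.symm h0) z
  have e1 : interArrival coord 1 (mask {s}ᶜ z) = interArrival coord 1 z :=
    mask_of_mem (Ne.symm h1) z
  rw [mem_busy, mem_busy, e0, e1]

lemma cycleLength_mask {s : Source} (h0 : s ≠ .init) (h1 : s ≠ .interArrival 1)
    (h2 : s ≠ .service 1) (z : Source → ℝ) :
    cycleLength coord (mask {s}ᶜ z) = cycleLength coord z := by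
  obtain ⟨e0, e1, e2⟩ := queue_mask h0 h1 h2 z
  rw [cycleLength_eq, cycleLength_eq, e0, e1, e2]

lemma sysTime_one_mask {s : Source} (h0 : s ≠ .init) (h1 : s ≠ .interArrival 1)
    (h2 : s ≠ .service 1) (z : Source → ℝ) :
    sysTime coord 1 (mask {s}ᶜ z) = sysTime coord 1 z := by
  obtain ⟨e0, e1, e2⟩ := queue_mask h0 h1 h2 z
  rw [sysTime_succ, sysTime_succ, e0, e1, e2]

lemma indicator_mask {A : Set (Source → ℝ)} {S : Set Source} {f : (Source → ℝ) → ℝ}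
    (hA : ∀ z, mask S z ∈ A ↔ z ∈ A) (hf : ∀ z, f (mask S z) = f z) (z : Source → ℝ) :
    A.indicator f (mask S z) = A.indicator f z := by
  classical
  simp only [Set.indicator_apply, hA, hf]

variable {m : Measure (Source → ℝ)} [IsProbabilityMeasure m] {lam mu nu : ℝ}

/-- The scaled length of the inter-departure interval, if the server is busy. -/
noncomputable def busyLength (nu : ℝ) : (Source → ℝ) → ℝ :=
  (busy coord 0).indicator fun z => nu * cycleLength coord z

/-- The scaled length of the idle period. -/
noncomputable def idleLength (nu : ℝ) : (Source → ℝ) → ℝ :=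
  (busy coord 0)ᶜ.indicator fun z => nu * (interArrival coord 1 z - sysTime coord 0 z)

/-- The scaled length of the service after an idle period. -/
noncomputable def serviceLength (nu : ℝ) : (Source → ℝ) → ℝ :=
  (busy coord 0)ᶜ.indicator fun z => nu * sysTime coord 1 z

lemma sum_lengths (nu : ℝ) (z : Source → ℝ) :
    busyLength nu z + idleLength nu z + serviceLength nu z = nu * cycleLength coord z := by
  by_cases hz : z ∈ busy coord 0
  · simp [busyLength, idleLength, serviceLength, hz]
  · simp [busyLength, idleLength, serviceLength, hz, cycleLength_of_idle hz,
      sysTime_one_of_idle hz]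
    ring

lemma sum_lengths_sq (nu : ℝ) (z : Source → ℝ) :
    busyLength nu z ^ 2 + idleLength nu z ^ 2 + serviceLength nu z ^ 2 +
      2 * (idleLength nu z * serviceLength nu z) = (nu * cycleLength coord z) ^ 2 := by
  rw [← sum_lengths]
  by_cases hz : z ∈ busy coord 0
  · simp [busyLength, idleLength, serviceLength, hz]
  · simp [busyLength, idleLength, serviceLength, hz]
    ring

lemma measurable_busyLength : Measurable (busyLength nu) :=
  (((measurable_departureTime measurable_coord 1).sub
    (measurable_departureTime measurable_coord 0)).const_mul nu).indicator
      (measurableSet_busy measurable_coord 0)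

lemma measurable_idleLength : Measurable (idleLength nu) :=
  (((measurable_coord (.interArrival 1)).sub
    (measurable_sysTime measurable_coord 0)).const_mul nu).indicator
      (measurableSet_busy measurable_coord 0).compl

lemma measurable_serviceLength : Measurable (serviceLength nu) :=
  ((measurable_sysTime measurable_coord 1).const_mul nu).indicator
      (measurableSet_busy measurable_coord 0).compl

lemma integral_div_interval (nu : ℝ) : ∫ x in (0 : ℝ)..1, x / nu = 1 / (2 * nu) := by
  rw [intervalIntegral.integral_div, integral_id]
  rw [one_div, mul_inv]
  norm_num [div_eq_mul_inv]

namespace IsStationaryMG1D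

variable (h : IsStationaryMG1D m MG1D.coord lam mu nu)
include h

lemma integral_mul_indicator_count (hnu : 0 < nu) {s : Source}
    (hs : pdf.IsUniform (MG1D.coord s) (Set.Ioo 0 (1 / nu)) m) {A : Set (Source → ℝ)}
    {ψ y : (Source → ℝ) → ℝ} (hA : MeasurableSet A) (hψ : Measurable ψ) (hy : Measurable y)
    (hAmask : ∀ z, mask {s}ᶜ z ∈ A ↔ z ∈ A) (hψmask : ∀ z, ψ (mask {s}ᶜ z) = ψ z)
    (hymask : ∀ z, y (mask {s}ᶜ z) = y z) (hpos : ∀ᵐ z ∂m, z ∈ A → 0 ≤ y z)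
    (hint : Integrable (fun z => ψ z * A.indicator (fun z =>
      (countDecisions nu (z s) (y z) : ℝ)) z) m) :
    ∫ z, ψ z * A.indicator (fun z => (countDecisions nu (z s) (y z) : ℝ)) z ∂m =
      ∫ z, ψ z * A.indicator (fun z => nu * y z) z ∂m := by
  have e1 : ∀ f : (Source → ℝ) → ℝ, (fun z => ψ z * A.indicator f z) =
      fun z => A.indicator ψ z * f z := fun f => by
    ext z; by_cases hz : z ∈ A <;> simp [hz]
  rw [e1] at hint ⊢
  rw [e1]
  refine h.integral_mul_countDecisions hnu hs (Φ := fun n => (n : ℝ)) (Ψ := id)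
    (hψ.indicator hA) hy
    (indicator_mask hAmask hψmask) hymask ?_ (fun y hy => intervalIntegral_natCeil_id hy) hint
  filter_upwards [hpos] with z hz hne
  exact hz (Set.mem_of_indicator_ne_zero hne)

lemma integral_indicator_count_sq (hnu : 0 < nu) {s : Source}
    (hs : pdf.IsUniform (MG1D.coord s) (Set.Ioo 0 (1 / nu)) m) {A : Set (Source → ℝ)}
    {y : (Source → ℝ) → ℝ} (hA : MeasurableSet A) (hy : Measurable y)
    (hAmask : ∀ z, mask {s}ᶜ z ∈ A ↔ z ∈ A)
    (hymask : ∀ z, y (mask {s}ᶜ z) = y z) (hpos : ∀ᵐ z ∂m, z ∈ A → 0 ≤ y z)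
    (hint : Integrable (fun z => A.indicator (fun z =>
      (countDecisions nu (z s) (y z) : ℝ)) z ^ 2) m) :
    ∫ z, A.indicator (fun z => (countDecisions nu (z s) (y z) : ℝ)) z ^ 2 ∂m =
      ∫ z, (A.indicator (fun z => nu * y z) z ^ 2 +
        A.indicator (fun z => fractVar (nu * y z)) z) ∂m := by
  have e1 : (fun z => A.indicator (fun z => (countDecisions nu (z s) (y z) : ℝ)) z ^ 2) =
      fun z => A.indicator (fun _ => (1 : ℝ)) z * (countDecisions nu (z s) (y z) : ℝ) ^ 2 := by
    ext z; by_cases hz : z ∈ A <;> simp [hz]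
  have e2 : (fun z => A.indicator (fun z => nu * y z) z ^ 2 +
        A.indicator (fun z => fractVar (nu * y z)) z) =
      fun z => A.indicator (fun _ => (1 : ℝ)) z * ((nu * y z) ^ 2 + fractVar (nu * y z)) := by
    ext z; by_cases hz : z ∈ A <;> simp [hz]
  rw [e1] at hint ⊢
  rw [e2]
  refine h.integral_mul_countDecisions hnu hs (Φ := fun n => (n : ℝ) ^ 2)
    (Ψ := fun y => y ^ 2 + fractVar y) (measurable_const.indicator hA) hy
    (indicator_mask hAmask fun _ => rfl) hymask ?_
    (fun y hy => intervalIntegral_natCeil_sq hy) hint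
  filter_upwards [hpos] with z hz hne
  exact hz (Set.mem_of_indicator_ne_zero hne)

omit h [IsProbabilityMeasure m] in
lemma countFunctions_eq :
    busyCount MG1D.coord nu = (busy MG1D.coord 0).indicator (fun z =>
      (countDecisions nu (z (.offset1 0)) (cycleLength MG1D.coord z) : ℝ)) ∧
    idleCount MG1D.coord nu = (busy MG1D.coord 0)ᶜ.indicator (fun z =>
      (countDecisions nu (z (.offset2 0))
        (interArrival MG1D.coord 1 z - sysTime MG1D.coord 0 z) : ℝ)) ∧
    serviceCount MG1D.coord nu = (busy MG1D.coord 0)ᶜ.indicator (fun z =>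
      (countDecisions nu (z (.offset3 0)) (sysTime MG1D.coord 1 z) : ℝ)) := by
  simp only [busyCount, idleCount, serviceCount, count1_eq, count2_eq, count3_eq]
  exact ⟨rfl, rfl, rfl⟩

omit h [IsProbabilityMeasure m] in
lemma compl_mask {A : Set (Source → ℝ)} {S : Set Source} (hA : ∀ z, mask S z ∈ A ↔ z ∈ A)
    (z : Source → ℝ) : mask S z ∈ Aᶜ ↔ z ∈ Aᶜ := not_congr (hA z)

lemma integral_mul_busyCount (hnu : 0 < nu) {ψ : (Source → ℝ) → ℝ} (hψ : Measurable ψ)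
    (hψmask : ∀ z, ψ (mask {.offset1 0}ᶜ z) = ψ z)
    (hint : Integrable (fun z => ψ z * busyCount MG1D.coord nu z) m) :
    ∫ z, ψ z * busyCount MG1D.coord nu z ∂m = ∫ z, ψ z * busyLength nu z ∂m := by
  rw [countFunctions_eq.1] at hint ⊢
  refine h.integral_mul_indicator_count hnu (h.offset1_uniform 0)
    (measurableSet_busy measurable_coord 0) hψ h.measurable_cycleLength
    (busy_mask (by simp) (by simp)) hψmask
    (cycleLength_mask (by simp) (by simp) (by simp)) ?_ hint
  filter_upwards [h.ae_cycleLength_nonneg] with z hz _ using hz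

lemma integral_mul_idleCount (hnu : 0 < nu) {ψ : (Source → ℝ) → ℝ} (hψ : Measurable ψ)
    (hψmask : ∀ z, ψ (mask {.offset2 0}ᶜ z) = ψ z)
    (hint : Integrable (fun z => ψ z * idleCount MG1D.coord nu z) m) :
    ∫ z, ψ z * idleCount MG1D.coord nu z ∂m = ∫ z, ψ z * idleLength nu z ∂m := by
  rw [countFunctions_eq.2.1] at hint ⊢
  refine h.integral_mul_indicator_count hnu (h.offset2_uniform 0)
    (measurableSet_busy measurable_coord 0).compl hψ
    ((measurable_coord (.interArrival 1)).sub (measurable_sysTime measurable_coord 0))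
    (compl_mask (busy_mask (by simp) (by simp))) hψmask (fun z => ?_)
    (Eventually.of_forall fun z hz => sub_nonneg.2 (not_le.1 (show ¬ interArrival MG1D.coord 1 z ≤
      sysTime MG1D.coord 0 z from hz)).le) hint
  obtain ⟨e0, e1, -⟩ := queue_mask (s := .offset2 0) (by simp) (by simp) (by simp) z
  rw [e0, e1]

lemma integral_mul_serviceCount (hnu : 0 < nu) {ψ : (Source → ℝ) → ℝ} (hψ : Measurable ψ)
    (hψmask : ∀ z, ψ (mask {.offset3 0}ᶜ z) = ψ z)
    (hint : Integrable (fun z => ψ z * serviceCount MG1D.coord nu z) m) :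
    ∫ z, ψ z * serviceCount MG1D.coord nu z ∂m = ∫ z, ψ z * serviceLength nu z ∂m := by
  rw [countFunctions_eq.2.2] at hint ⊢
  refine h.integral_mul_indicator_count hnu (h.offset3_uniform 0)
    (measurableSet_busy measurable_coord 0).compl hψ (measurable_sysTime measurable_coord 1)
    (compl_mask (busy_mask (by simp) (by simp))) hψmask
    (sysTime_one_mask (by simp) (by simp) (by simp)) ?_ hint
  filter_upwards [h.ae_sysTime_nonneg] with z hz _ using hz 1

omit [IsProbabilityMeasure m] in
lemma measurable_counts (hnu : 0 < nu) : Measurable (busyCount MG1D.coord nu) ∧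
    Measurable (idleCount MG1D.coord nu) ∧ Measurable (serviceCount MG1D.coord nu) :=
  ⟨measurable_busyCount hnu h.measurable, measurable_idleCount hnu h.measurable,
    measurable_serviceCount hnu h.measurable⟩

omit [IsProbabilityMeasure m] in
lemma ae_busyLength_le (hnu : 0 < nu) : ∀ᵐ z ∂m,
    0 ≤ busyLength nu z ∧ busyLength nu z ≤ nu * cycleLength MG1D.coord z + 1 := by
  filter_upwards [h.ae_cycleLength_nonneg] with z hz
  by_cases hb : z ∈ busy MG1D.coord 0
  · rw [busyLength, Set.indicator_of_mem hb]
    exact ⟨by positivity, by linarith⟩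
  · rw [busyLength, Set.indicator_of_notMem hb]
    exact ⟨le_rfl, by positivity⟩

omit [IsProbabilityMeasure m] in
lemma ae_idleLength_le (hnu : 0 < nu) : ∀ᵐ z ∂m,
    0 ≤ idleLength nu z ∧ idleLength nu z ≤ nu * cycleLength MG1D.coord z + 1 := by
  filter_upwards [h.ae_cycleLength_nonneg, h.ae_service_nonneg] with z hz hS
  by_cases hb : z ∈ busy MG1D.coord 0
  · rw [idleLength, Set.indicator_of_notMem (by simpa using hb)]
    exact ⟨le_rfl, by positivity⟩
  · have h1 : 0 ≤ interArrival MG1D.coord 1 z - sysTime MG1D.coord 0 z :=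
      sub_nonneg.2 (not_le.1 hb).le
    rw [idleLength, Set.indicator_of_mem hb, cycleLength_of_idle hb]
    exact ⟨by positivity, by nlinarith [hS 1]⟩

omit [IsProbabilityMeasure m] in
lemma ae_serviceLength_le (hnu : 0 < nu) : ∀ᵐ z ∂m,
    0 ≤ serviceLength nu z ∧ serviceLength nu z ≤ nu * cycleLength MG1D.coord z + 1 := by
  filter_upwards [h.ae_cycleLength_nonneg, h.ae_service_nonneg] with z hz hS
  by_cases hb : z ∈ busy MG1D.coord 0
  · rw [serviceLength, Set.indicator_of_notMem (by simpa using hb)]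
    exact ⟨le_rfl, by positivity⟩
  · have h1 : 0 ≤ interArrival MG1D.coord 1 z - sysTime MG1D.coord 0 z :=
      sub_nonneg.2 (not_le.1 hb).le
    have h2 := hS 1
    rw [serviceLength, Set.indicator_of_mem hb, cycleLength_of_idle hb, sysTime_one_of_idle hb]
    exact ⟨by positivity, by nlinarith⟩

lemma integral_idleCount_mul_serviceCount (hlam : 0 < lam) (hnu : 0 < nu) :
    ∫ z, idleCount MG1D.coord nu z * serviceCount MG1D.coord nu z ∂m =
      ∫ z, idleLength nu z * serviceLength nu z ∂m := by
  obtain ⟨-, m2, m3⟩ := h.measurable_counts hnu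
  -- The two offsets are integrated out in turn: first that of `N³` with `N²` as the weight, then
  -- that of `N²` with the service length as the weight.
  rw [h.integral_mul_serviceCount hnu m2 ?_
    (h.integrable_mul_of_le_cycleLength hlam m2 m3 (h.ae_idleCount_le hnu)
      (h.ae_serviceCount_le hnu))]
  · simp_rw [mul_comm (idleCount MG1D.coord nu _), mul_comm (idleLength nu _)]
    refine h.integral_mul_idleCount hnu measurable_serviceLength ?_
      (h.integrable_mul_of_le_cycleLength hlam measurable_serviceLength m2
        (h.ae_serviceLength_le hnu) (h.ae_idleCount_le hnu))
    exact indicator_mask (compl_mask (busy_mask (by simp) (by simp))) fun z => by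
      rw [sysTime_one_mask (by simp) (by simp) (by simp)]
  · rw [countFunctions_eq.2.1]
    refine indicator_mask (compl_mask (busy_mask (by simp) (by simp))) fun z => ?_
    obtain ⟨e0, e1, -⟩ := queue_mask (s := .offset3 0) (by simp) (by simp) (by simp) z
    rw [e0, e1, mask_of_mem (by simp)]

end IsStationaryMG1D
end Evaluation

/-! ### First and second moments of the approximate count -/

section Moments

variable {m : Measure (Source → ℝ)} {lam mu nu : ℝ}

/-- The mean excess of the squared counts over the squares of the scaled lengths. -/
noncomputable def excess (nu : ℝ) (z : Source → ℝ) : ℝ :=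
  (busy coord 0).indicator (fun z => fractVar (nu * cycleLength coord z)) z +
    (busy coord 0)ᶜ.indicator (fun z =>
      fractVar (nu * (interArrival coord 1 z - sysTime coord 0 z))) z +
    (busy coord 0)ᶜ.indicator (fun z => fractVar (nu * sysTime coord 1 z)) z

namespace IsStationaryMG1D

variable [IsProbabilityMeasure m] (h : IsStationaryMG1D m MG1D.coord lam mu nu)
include h

/-- Each count has its scaled length as conditional mean, and the lengths add up to `νL`. So
splitting a cycle at the arrival, with separate offsets, leaves first moments unchanged. -/
lemma integral_mul_approxCount (hnu : 0 < nu) {ψ : (Source → ℝ) → ℝ}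
    (hψ : Measurable ψ) (h1 : ∀ z, ψ (mask {.offset1 0}ᶜ z) = ψ z)
    (h2 : ∀ z, ψ (mask {.offset2 0}ᶜ z) = ψ z) (h3 : ∀ z, ψ (mask {.offset3 0}ᶜ z) = ψ z)
    (hint : ∀ f : (Source → ℝ) → ℝ, Measurable f →
      (∀ᵐ z ∂m, 0 ≤ f z ∧ f z ≤ nu * cycleLength MG1D.coord z + 1) →
      Integrable (fun z => ψ z * f z) m) :
    ∫ z, ψ z * approxCount MG1D.coord nu 0 z ∂m =
      ∫ z, ψ z * (nu * cycleLength MG1D.coord z) ∂m := by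
  obtain ⟨m1, m2, m3⟩ := h.measurable_counts hnu
  have i1 := hint _ m1 (h.ae_busyCount_le hnu)
  have i2 := hint _ m2 (h.ae_idleCount_le hnu)
  have i3 := hint _ m3 (h.ae_serviceCount_le hnu)
  have j1 := hint _ measurable_busyLength (h.ae_busyLength_le hnu)
  have j2 := hint _ measurable_idleLength (h.ae_idleLength_le hnu)
  have j3 := hint _ measurable_serviceLength (h.ae_serviceLength_le hnu)
  have i12 : Integrable (fun z => ψ z * busyCount MG1D.coord nu z +
    ψ z * idleCount MG1D.coord nu z) m := i1.add i2
  have j12 : Integrable (fun z => ψ z * busyLength nu z + ψ z * idleLength nu z) m := j1.add j2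
  simp_rw [approxCount_eq, ← sum_lengths, mul_add]
  rw [integral_add i12 i3, integral_add i1 i2, integral_add j12 j3, integral_add j1 j2,
    h.integral_mul_busyCount hnu hψ h1 i1, h.integral_mul_idleCount hnu hψ h2 i2,
    h.integral_mul_serviceCount hnu hψ h3 i3]

lemma integral_approxCount (hlam : 0 < lam) (hlt : lam < mu) (hnu : 0 < nu) :
    ∫ z, (approxCount MG1D.coord nu 0 z : ℝ) ∂m = nu / lam := by
  have e := h.integral_mul_approxCount hnu (ψ := fun _ => 1) measurable_const (fun _ => rfl)
    (fun _ => rfl) (fun _ => rfl) fun f hf hle => by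
      simpa using h.integrable_of_le_cycleLength hlam hf hle
  simp only [one_mul] at e
  rw [e, integral_const_mul, h.integral_cycleLength hlam hlt, mul_one_div]

lemma integral_sysTime_mul_approxCount (hlam : 0 < lam) (hlt : lam < mu) (hnu : 0 < nu) :
    ∫ z, sysTime MG1D.coord 0 z * approxCount MG1D.coord nu 0 z ∂m =
      ∫ z, sysTime MG1D.coord 0 z * (nu * cycleLength MG1D.coord z) ∂m :=
  h.integral_mul_approxCount hnu (measurable_sysTime measurable_coord 0)
    (fun z => mask_of_mem (by simp) z) (fun z => mask_of_mem (by simp) z)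
    (fun z => mask_of_mem (by simp) z)
    fun _ hf hle => h.integrable_sysTime_mul_of_le_cycleLength hlam hlt hf hle

omit h in
lemma integrable_indicator_fractVar {A : Set (Source → ℝ)} (hA : MeasurableSet A)
    {y : (Source → ℝ) → ℝ} (hy : Measurable y) (hpos : ∀ᵐ z ∂m, z ∈ A → 0 ≤ y z) :
    Integrable (A.indicator fun z => fractVar (y z)) m := by
  refine Integrable.mono' (integrable_const (1 / 4))
    ((measurable_fractVar.comp hy).indicator hA).aestronglyMeasurable ?_
  filter_upwards [hpos] with z hz
  by_cases hzA : z ∈ A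
  · rw [Set.indicator_of_mem hzA, Real.norm_of_nonneg (fractVar_nonneg (hz hzA))]
    exact fractVar_le _
  · rw [Set.indicator_of_notMem hzA]; norm_num

lemma integrable_excess_terms (hnu : 0 < nu) :
    Integrable ((busy MG1D.coord 0).indicator fun z =>
      fractVar (nu * cycleLength MG1D.coord z)) m ∧
    Integrable ((busy MG1D.coord 0)ᶜ.indicator fun z =>
      fractVar (nu * (interArrival MG1D.coord 1 z - sysTime MG1D.coord 0 z))) m ∧
    Integrable ((busy MG1D.coord 0)ᶜ.indicator fun z =>
      fractVar (nu * sysTime MG1D.coord 1 z)) m := by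
  have hb := measurableSet_busy measurable_coord 0
  refine ⟨integrable_indicator_fractVar hb (h.measurable_cycleLength.const_mul nu) ?_,
    integrable_indicator_fractVar hb.compl (((measurable_coord (.interArrival 1)).sub
      (measurable_sysTime measurable_coord 0)).const_mul nu) (Eventually.of_forall fun z hz => ?_),
    integrable_indicator_fractVar hb.compl
      ((measurable_sysTime measurable_coord 1).const_mul nu) ?_⟩
  · filter_upwards [h.ae_cycleLength_nonneg] with z hz _ using mul_nonneg hnu.le hz
  · exact mul_nonneg hnu.le (sub_nonneg.2 (not_le.1 (show ¬ interArrival MG1D.coord 1 z ≤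
      sysTime MG1D.coord 0 z from hz)).le)
  · filter_upwards [h.ae_sysTime_nonneg] with z hz _ using mul_nonneg hnu.le (hz 1)

lemma integral_busyCount_sq (hlam : 0 < lam) (hnu : 0 < nu) :
    ∫ z, busyCount MG1D.coord nu z ^ 2 ∂m = ∫ z, busyLength nu z ^ 2 ∂m +
      ∫ z, (busy MG1D.coord 0).indicator (fun z =>
        fractVar (nu * cycleLength MG1D.coord z)) z ∂m := by
  obtain ⟨m1, -, -⟩ := h.measurable_counts hnu
  have i1 := h.integrable_mul_of_le_cycleLength hlam m1 m1 (h.ae_busyCount_le hnu)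
    (h.ae_busyCount_le hnu)
  have j1 := h.integrable_mul_of_le_cycleLength hlam measurable_busyLength measurable_busyLength
    (h.ae_busyLength_le hnu) (h.ae_busyLength_le hnu)
  simp only [← sq] at i1 j1
  rw [← integral_add j1 (h.integrable_excess_terms hnu).1]
  rw [countFunctions_eq.1] at i1 ⊢
  refine h.integral_indicator_count_sq hnu (h.offset1_uniform 0)
    (measurableSet_busy measurable_coord 0) h.measurable_cycleLength
    (busy_mask (by simp) (by simp))
    (cycleLength_mask (by simp) (by simp) (by simp)) ?_ i1
  filter_upwards [h.ae_cycleLength_nonneg] with z hz _ using hz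

lemma integral_idleCount_sq (hlam : 0 < lam) (hnu : 0 < nu) :
    ∫ z, idleCount MG1D.coord nu z ^ 2 ∂m = ∫ z, idleLength nu z ^ 2 ∂m +
      ∫ z, (busy MG1D.coord 0)ᶜ.indicator (fun z =>
        fractVar (nu * (interArrival MG1D.coord 1 z - sysTime MG1D.coord 0 z))) z ∂m := by
  obtain ⟨-, m1, -⟩ := h.measurable_counts hnu
  have i1 := h.integrable_mul_of_le_cycleLength hlam m1 m1 (h.ae_idleCount_le hnu)
    (h.ae_idleCount_le hnu)
  have j1 := h.integrable_mul_of_le_cycleLength hlam measurable_idleLength measurable_idleLength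
    (h.ae_idleLength_le hnu) (h.ae_idleLength_le hnu)
  simp only [← sq] at i1 j1
  rw [← integral_add j1 (h.integrable_excess_terms hnu).2.1]
  rw [countFunctions_eq.2.1] at i1 ⊢
  refine h.integral_indicator_count_sq hnu (h.offset2_uniform 0)
    (measurableSet_busy measurable_coord 0).compl
    ((measurable_coord (.interArrival 1)).sub (measurable_sysTime measurable_coord 0))
    (compl_mask (busy_mask (by simp) (by simp))) (fun z => ?_)
    (Eventually.of_forall fun z hz => sub_nonneg.2 (not_le.1 (show ¬ interArrival MG1D.coord 1 z ≤
      sysTime MG1D.coord 0 z from hz)).le) i1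
  obtain ⟨e0, e1, -⟩ := queue_mask (s := .offset2 0) (by simp) (by simp) (by simp) z
  rw [e0, e1]

lemma integral_serviceCount_sq (hlam : 0 < lam) (hnu : 0 < nu) :
    ∫ z, serviceCount MG1D.coord nu z ^ 2 ∂m = ∫ z, serviceLength nu z ^ 2 ∂m +
      ∫ z, (busy MG1D.coord 0)ᶜ.indicator (fun z =>
        fractVar (nu * sysTime MG1D.coord 1 z)) z ∂m := by
  obtain ⟨-, -, m1⟩ := h.measurable_counts hnu
  have i1 := h.integrable_mul_of_le_cycleLength hlam m1 m1 (h.ae_serviceCount_le hnu)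
    (h.ae_serviceCount_le hnu)
  have j1 := h.integrable_mul_of_le_cycleLength hlam measurable_serviceLength
    measurable_serviceLength (h.ae_serviceLength_le hnu) (h.ae_serviceLength_le hnu)
  simp only [← sq] at i1 j1
  rw [← integral_add j1 (h.integrable_excess_terms hnu).2.2]
  rw [countFunctions_eq.2.2] at i1 ⊢
  refine h.integral_indicator_count_sq hnu (h.offset3_uniform 0)
    (measurableSet_busy measurable_coord 0).compl (measurable_sysTime measurable_coord 1)
    (compl_mask (busy_mask (by simp) (by simp)))
    (sysTime_one_mask (by simp) (by simp) (by simp)) ?_ i1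
  filter_upwards [h.ae_sysTime_nonneg] with z hz _ using hz 1

lemma integrable_sq_counts (hlam : 0 < lam) (hnu : 0 < nu) :
    Integrable (fun z => busyCount MG1D.coord nu z ^ 2) m ∧
    Integrable (fun z => idleCount MG1D.coord nu z ^ 2) m ∧
    Integrable (fun z => serviceCount MG1D.coord nu z ^ 2) m ∧
    Integrable (fun z => 2 * (idleCount MG1D.coord nu z * serviceCount MG1D.coord nu z)) m := by
  obtain ⟨m1, m2, m3⟩ := h.measurable_counts hnu
  have b1 := h.ae_busyCount_le hnu
  have b2 := h.ae_idleCount_le hnu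
  have b3 := h.ae_serviceCount_le hnu
  simp only [sq]
  exact ⟨h.integrable_mul_of_le_cycleLength hlam m1 m1 b1 b1,
    h.integrable_mul_of_le_cycleLength hlam m2 m2 b2 b2,
    h.integrable_mul_of_le_cycleLength hlam m3 m3 b3 b3,
    (h.integrable_mul_of_le_cycleLength hlam m2 m3 b2 b3).const_mul 2⟩

lemma integral_approxCount_sq_eq_sum (hlam : 0 < lam) (hnu : 0 < nu) :
    ∫ z, (approxCount MG1D.coord nu 0 z : ℝ) ^ 2 ∂m =
      ∫ z, busyCount MG1D.coord nu z ^ 2 ∂m + ∫ z, idleCount MG1D.coord nu z ^ 2 ∂m +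
      ∫ z, serviceCount MG1D.coord nu z ^ 2 ∂m +
      2 * ∫ z, idleCount MG1D.coord nu z * serviceCount MG1D.coord nu z ∂m := by
  obtain ⟨i1, i2, i3, i4⟩ := h.integrable_sq_counts hlam hnu
  have i12 : Integrable (fun z => busyCount MG1D.coord nu z ^ 2 +
    idleCount MG1D.coord nu z ^ 2) m := i1.add i2
  have i123 : Integrable (fun z => busyCount MG1D.coord nu z ^ 2 +
    idleCount MG1D.coord nu z ^ 2 + serviceCount MG1D.coord nu z ^ 2) m := i12.add i3
  simp_rw [approxCount_sq_eq]
  rw [integral_add i123 i4, integral_add i12 i3, integral_add i1 i2, integral_const_mul]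

/-- The cross term has no excess because the two offsets are independent; the whole excess comes
from the variances of the single counts. -/
lemma integral_approxCount_sq (hlam : 0 < lam) (hnu : 0 < nu) :
    ∫ z, (approxCount MG1D.coord nu 0 z : ℝ) ^ 2 ∂m =
      ∫ z, (nu * cycleLength MG1D.coord z) ^ 2 ∂m + ∫ z, excess nu z ∂m := by
  have b1 := h.ae_busyLength_le hnu
  have b2 := h.ae_idleLength_le hnu
  have b3 := h.ae_serviceLength_le hnu
  have j1 := h.integrable_mul_of_le_cycleLength hlam measurable_busyLength
    measurable_busyLength b1 b1
  have j2 := h.integrable_mul_of_le_cycleLength hlam measurable_idleLength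
    measurable_idleLength b2 b2
  have j3 := h.integrable_mul_of_le_cycleLength hlam measurable_serviceLength
    measurable_serviceLength b3 b3
  have j4 := (h.integrable_mul_of_le_cycleLength hlam measurable_idleLength
    measurable_serviceLength b2 b3).const_mul 2
  simp only [← sq] at j1 j2 j3
  have j12 : Integrable (fun z => busyLength nu z ^ 2 + idleLength nu z ^ 2) m := j1.add j2
  have j123 : Integrable (fun z => busyLength nu z ^ 2 + idleLength nu z ^ 2 +
    serviceLength nu z ^ 2) m := j12.add j3
  obtain ⟨v1, v2, v3⟩ := h.integrable_excess_terms hnu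
  have v12 : Integrable (fun z => (busy MG1D.coord 0).indicator (fun z =>
      fractVar (nu * cycleLength MG1D.coord z)) z + (busy MG1D.coord 0)ᶜ.indicator (fun z =>
        fractVar (nu * (interArrival MG1D.coord 1 z - sysTime MG1D.coord 0 z))) z) m := v1.add v2
  simp_rw [← sum_lengths_sq, excess]
  rw [h.integral_approxCount_sq_eq_sum hlam hnu, h.integral_busyCount_sq hlam hnu,
    h.integral_idleCount_sq hlam hnu, h.integral_serviceCount_sq hlam hnu,
    h.integral_idleCount_mul_serviceCount hlam hnu, integral_add j123 j4, integral_add j12 j3,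
    integral_add j1 j2, integral_const_mul, integral_add v12 v3, integral_add v1 v2]
  ring

omit [IsProbabilityMeasure m] in
lemma integral_excess_nonneg (hnu : 0 < nu) : 0 ≤ ∫ z, excess nu z ∂m := by
  refine integral_nonneg_of_ae ?_
  filter_upwards [h.ae_cycleLength_nonneg, h.ae_sysTime_nonneg] with z hL hT
  by_cases hz : z ∈ busy MG1D.coord 0
  · simpa [excess, hz] using fractVar_nonneg (mul_nonneg hnu.le hL)
  · have hI : 0 ≤ nu * (interArrival MG1D.coord 1 z - sysTime MG1D.coord 0 z) :=
      mul_nonneg hnu.le (sub_nonneg.2 (not_le.1 hz).le)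
    simpa [excess, hz] using
      add_nonneg (fractVar_nonneg hI) (fractVar_nonneg (mul_nonneg hnu.le (hT 1)))

lemma integral_excess_le (hlam : 0 < lam) (hlt : lam < mu) (hnu : 0 < nu) :
    ∫ z, excess nu z ∂m ≤ (2 - lam / mu) / 4 := by
  have hb := measurableSet_busy measurable_coord 0
  obtain ⟨v1, v2, v3⟩ := h.integrable_excess_terms hnu
  -- At most `1/4` per count: one count in every cycle and a second one only in idle cycles, which
  -- have probability `1 - ρ`.
  have hle : ∫ z, excess nu z ∂m ≤ ∫ z, (busy MG1D.coord 0)ᶜ.indicator (fun _ => (1 / 4 : ℝ)) z +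
      1 / 4 ∂m := by
    refine integral_mono ((v1.add v2).add v3)
      (((integrable_const _).indicator hb.compl).add (integrable_const _)) fun z => ?_
    have f1 := fractVar_le (nu * cycleLength MG1D.coord z)
    have f2 := fractVar_le (nu * (interArrival MG1D.coord 1 z - sysTime MG1D.coord 0 z))
    have f3 := fractVar_le (nu * sysTime MG1D.coord 1 z)
    by_cases hz : z ∈ busy MG1D.coord 0
    · simpa [excess, hz] using f1
    · simpa [excess, hz] using add_le_add f2 f3
  refine hle.trans_eq ?_
  rw [integral_add ((integrable_const _).indicator hb.compl) (integrable_const _),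
    integral_indicator_const _ hb.compl, h.measureReal_busy_compl hlam hlt]
  simp
  ring

/-- The delay used for the ages is independent of the offsets used for the counts; this is where the
approximation departs from the true system. -/
lemma integral_approxCount_mul_ageOffset (hlam : 0 < lam) (hlt : lam < mu) (hnu : 0 < nu) :
    ∫ z, approxCount MG1D.coord nu 0 z * MG1D.coord (.ageOffset 0) z ∂m = 1 / (2 * lam) := by
  have hmask : ∀ z, approxCount MG1D.coord nu 0 (mask {.ageOffset 0}ᶜ z) =
      approxCount MG1D.coord nu 0 z := fun z => by
    have e0 := sysTime_one_mask (s := .ageOffset 0) (by simp) (by simp) (by simp) z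
    have e1 := cycleLength_mask (s := .ageOffset 0) (by simp) (by simp) (by simp) z
    have e2 := busy_mask (s := .ageOffset 0) (by simp) (by simp) z
    obtain ⟨e3, e4, -⟩ := queue_mask (s := .ageOffset 0) (by simp) (by simp) (by simp) z
    have e5 : ∀ s, s ≠ .ageOffset 0 → MG1D.coord s (mask {.ageOffset 0}ᶜ z) = MG1D.coord s z :=
      fun s hs => mask_of_mem hs z
    simp only [approxCount, count1_eq, count2_eq, count3_eq, e0, e1, e3, e4,
      e5 (.offset1 0) (by simp), e5 (.offset2 0) (by simp), e5 (.offset3 0) (by simp)]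
    by_cases hz : z ∈ busy MG1D.coord 0
    · rw [if_pos hz, if_pos (e2.2 hz)]
    · rw [if_neg hz, if_neg (mt e2.1 hz)]
  have hm := measurable_approxCount hnu (Z := MG1D.coord) measurable_coord
  have hind : IndepFun (fun z => (approxCount MG1D.coord nu 0 z : ℝ))
      (MG1D.coord (.ageOffset 0)) m :=
    indepFun_of_mask (Z := MG1D.coord) (f := fun z => (approxCount MG1D.coord nu 0 z : ℝ))
      (g := MG1D.coord (.ageOffset 0)) measurable_coord h.indep
      {Source.ageOffset 0}ᶜ {Source.ageOffset 0}
      disjoint_compl_left hm (measurable_coord _) (fun z => by simp only [hmask])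
      fun z => mask_of_mem (Set.mem_singleton (Source.ageOffset 0)) z
  have hmean : ∫ z, MG1D.coord (.ageOffset 0) z ∂m = 1 / (2 * nu) := by
    have e := integral_map_of_isUniform hnu (h.ageOffset_uniform 0) fun x => x
    rw [integral_map (measurable_coord _).aemeasurable
      measurable_id'.aestronglyMeasurable] at e
    rw [e, integral_div_interval]
  have e := hind.integral_fun_mul_eq_mul_integral hm.aestronglyMeasurable
    (measurable_coord _).aestronglyMeasurable
  rw [e, h.integral_approxCount hlam hlt hnu, hmean]
  field_simp

end IsStationaryMG1D
end Moments

/-! ### Factorisation of the conditional means and the error term -/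

section Evaluation

variable {m : Measure (Source → ℝ)} {lam mu nu : ℝ}

lemma busyLength_eq (nu : ℝ) (z : Source → ℝ) : busyLength nu z =
    nu * ((busy coord 0).indicator (fun _ => (1 : ℝ)) z * service coord 1 z) := by
  by_cases hz : z ∈ busy coord 0
  · simp [busyLength, hz, cycleLength_of_busy hz]
  · simp [busyLength, hz]

lemma serviceLength_eq (nu : ℝ) (z : Source → ℝ) : serviceLength nu z =
    nu * ((busy coord 0)ᶜ.indicator (fun _ => (1 : ℝ)) z * service coord 1 z) := by
  by_cases hz : z ∈ busy coord 0
  · simp [serviceLength, hz]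
  · simp [serviceLength, hz, sysTime_one_of_idle hz]

namespace IsStationaryMG1D

variable [IsProbabilityMeasure m] (h : IsStationaryMG1D m MG1D.coord lam mu nu)
include h

omit [IsProbabilityMeasure m] in
-- In both cases of a cycle the service part is `S_1`, which is independent of `T`, of the
-- inter-arrival time and of the busy event.
lemma integral_mul_service {f : (Source → ℝ) → ℝ} (hf : Measurable f)
    (hmask : ∀ z, f (mask {.service 1}ᶜ z) = f z) :
    ∫ z, f z * service MG1D.coord 1 z ∂m = (∫ z, f z ∂m) / mu := by
  have hind : IndepFun f (service MG1D.coord 1) m :=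
    indepFun_of_mask (Z := MG1D.coord) (f := f) (g := service MG1D.coord 1) measurable_coord
      h.indep {Source.service 1}ᶜ {Source.service 1} disjoint_compl_left hf (measurable_coord _)
      hmask fun z => mask_of_mem (Set.mem_singleton (Source.service 1)) z
  have e := hind.integral_fun_mul_eq_mul_integral hf.aestronglyMeasurable
    (measurable_coord (.service 1)).aestronglyMeasurable
  rw [e, h.integral_service 1, mul_one_div]

omit [IsProbabilityMeasure m] in
lemma integral_mul_busyLength {ψ : (Source → ℝ) → ℝ} (hψ : Measurable ψ)
    (hmask : ∀ z, ψ (mask {.service 1}ᶜ z) = ψ z) :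
    ∫ z, ψ z * busyLength nu z ∂m = nu / mu * ∫ z in busy MG1D.coord 0, ψ z ∂m := by
  have hb := measurableSet_busy measurable_coord 0
  rw [← integral_indicator hb, div_mul_eq_mul_div, mul_div_assoc, ← h.integral_mul_service
    (hψ.indicator hb) (indicator_mask (busy_mask (by simp) (by simp)) hmask), ← integral_const_mul]
  refine integral_congr_ae (Eventually.of_forall fun z => ?_)
  dsimp only
  rw [busyLength_eq]
  by_cases hz : z ∈ busy MG1D.coord 0
  · simp [hz]; ring
  · simp [hz]

omit [IsProbabilityMeasure m] in
lemma integral_mul_serviceLength {ψ : (Source → ℝ) → ℝ} (hψ : Measurable ψ)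
    (hmask : ∀ z, ψ (mask {.service 1}ᶜ z) = ψ z) :
    ∫ z, ψ z * serviceLength nu z ∂m = nu / mu * ∫ z in (busy MG1D.coord 0)ᶜ, ψ z ∂m := by
  have hb := (measurableSet_busy measurable_coord 0).compl
  rw [← integral_indicator hb, div_mul_eq_mul_div, mul_div_assoc, ← h.integral_mul_service
    (hψ.indicator hb) (indicator_mask (compl_mask (busy_mask (by simp) (by simp))) hmask),
    ← integral_const_mul]
  refine integral_congr_ae (Eventually.of_forall fun z => ?_)
  dsimp only
  rw [serviceLength_eq]
  by_cases hz : z ∈ busy MG1D.coord 0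
  · simp [hz]
  · simp [hz]; ring

/-- The idle period is exponential and independent of the system time before it. -/
lemma integral_mul_idleLength (hlam : 0 < lam) (hnu : 0 < nu) {ψ : ℝ → ℝ} (hψ : Measurable ψ)
    (hint : Integrable (fun z => ψ (sysTime MG1D.coord 0 z)) m)
    (hint' : Integrable (fun z => ψ (sysTime MG1D.coord 0 z) * idleLength nu z) m) :
    ∫ z, ψ (sysTime MG1D.coord 0 z) * idleLength nu z ∂m =
      nu / lam * ∫ z in (busy MG1D.coord 0)ᶜ, ψ (sysTime MG1D.coord 0 z) ∂m := by
  have hb := (measurableSet_busy measurable_coord 0).compl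
  have e1 : (fun z => ψ (sysTime MG1D.coord 0 z) * idleLength 1 z) =
      (busy MG1D.coord 0)ᶜ.indicator fun z => ψ (sysTime MG1D.coord 0 z) *
        (interArrival MG1D.coord 1 z - sysTime MG1D.coord 0 z) := by
    ext z
    by_cases hz : z ∈ busy MG1D.coord 0 <;> simp [idleLength, hz]
  have e2 : ∀ z, ψ (sysTime MG1D.coord 0 z) * idleLength nu z =
      nu * (ψ (sysTime MG1D.coord 0 z) * idleLength 1 z) := fun z => by
    by_cases hz : z ∈ busy MG1D.coord 0
    · simp [idleLength, hz]
    · simp [idleLength, hz]; ring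
  have e3 := h.integral_indicator_busy_compl hlam (φ := fun x => x) (ψ := ψ) measurable_id hψ
    (e1 ▸ (hint'.const_mul nu⁻¹).congr (Eventually.of_forall fun z => by
      dsimp only
      rw [e2, inv_mul_cancel_left₀ hnu.ne']))
  -- The same identity with `φ = 1` evaluates the unknown factor `E[ψ(T) exp (-λT)]` as an integral
  -- over the idle event.
  have e4 := h.integral_indicator_busy_compl hlam (φ := fun _ => (1 : ℝ)) (ψ := ψ)
    measurable_const hψ (by simpa using hint.indicator hb)
  have : IsProbabilityMeasure (expMeasure lam) := isProbabilityMeasure_expMeasure hlam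
  simp only [mul_one, integral_const, probReal_univ, smul_eq_mul] at e4
  simp_rw [e2]
  rw [integral_const_mul, e1, integral_indicator hb, e3, ← e4, integral_expMeasure_id hlam]
  ring

lemma integrable_approxCount (hlam : 0 < lam) (hnu : 0 < nu) :
    Integrable (fun z => (approxCount MG1D.coord nu 0 z : ℝ)) m := by
  obtain ⟨m1, m2, m3⟩ := h.measurable_counts hnu
  simp_rw [approxCount_eq]
  exact ((h.integrable_of_le_cycleLength hlam m1 (h.ae_busyCount_le hnu)).add
    (h.integrable_of_le_cycleLength hlam m2 (h.ae_idleCount_le hnu))).add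
    (h.integrable_of_le_cycleLength hlam m3 (h.ae_serviceCount_le hnu))

lemma integrable_terms_approxAgeSum (hlam : 0 < lam) (hlt : lam < mu) (hnu : 0 < nu) :
    Integrable (fun z => sysTime MG1D.coord 0 z * approxCount MG1D.coord nu 0 z) m ∧
    Integrable (fun z => approxCount MG1D.coord nu 0 z * MG1D.coord (.ageOffset 0) z) m ∧
    Integrable (fun z => (approxCount MG1D.coord nu 0 z : ℝ) ^ 2) m ∧
    Integrable (approxAgeSum MG1D.coord nu 0) m := by
  obtain ⟨m1, m2, m3⟩ := h.measurable_counts hnu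
  have i0 := h.integrable_approxCount hlam hnu
  have i1 : Integrable (fun z => sysTime MG1D.coord 0 z * approxCount MG1D.coord nu 0 z) m := by
    simp_rw [approxCount_eq, mul_add]
    exact ((h.integrable_sysTime_mul_of_le_cycleLength hlam hlt m1 (h.ae_busyCount_le hnu)).add
      (h.integrable_sysTime_mul_of_le_cycleLength hlam hlt m2 (h.ae_idleCount_le hnu))).add
      (h.integrable_sysTime_mul_of_le_cycleLength hlam hlt m3 (h.ae_serviceCount_le hnu))
  have i2 :
      Integrable (fun z => approxCount MG1D.coord nu 0 z * MG1D.coord (.ageOffset 0) z) m := by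
    refine (i0.mul_const (1 / nu)).mono' ((measurable_approxCount hnu measurable_coord).mul
      (measurable_coord _)).aestronglyMeasurable ?_
    filter_upwards [ae_pos_of_isUniform (measurable_coord _) (h.ageOffset_uniform 0)] with z hz
    rw [Real.norm_of_nonneg (mul_nonneg (Nat.cast_nonneg _) hz.1.le)]
    exact mul_le_mul_of_nonneg_left hz.2.le (Nat.cast_nonneg _)
  have i3 : Integrable (fun z => (approxCount MG1D.coord nu 0 z : ℝ) ^ 2) m := by
    obtain ⟨j1, j2, j3, j4⟩ := h.integrable_sq_counts hlam hnu
    simp_rw [approxCount_sq_eq]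
    exact ((j1.add j2).add j3).add j4
  refine ⟨i1, i2, i3, ?_⟩
  rw [funext (approxAgeSum_eq MG1D.coord nu)]
  exact (i1.add i2).add ((i3.sub i0).div_const _)

/-- The mean `1/(2λ)` of the first delays cancels the linear term `E[N]/(2ν)` of the arithmetic sum.
-/
lemma integral_approxAgeSum (hlam : 0 < lam) (hlt : lam < mu) (hnu : 0 < nu) :
    ∫ z, approxAgeSum MG1D.coord nu 0 z ∂m =
      ∫ z, sysTime MG1D.coord 0 z * (nu * cycleLength MG1D.coord z) ∂m +
        (∫ z, (approxCount MG1D.coord nu 0 z : ℝ) ^ 2 ∂m) / (2 * nu) := by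
  obtain ⟨i1, i2, i3, -⟩ := h.integrable_terms_approxAgeSum hlam hlt hnu
  have i0 := h.integrable_approxCount hlam hnu
  have i12 : Integrable (fun z => sysTime MG1D.coord 0 z * approxCount MG1D.coord nu 0 z +
    approxCount MG1D.coord nu 0 z * MG1D.coord (.ageOffset 0) z) m := i1.add i2
  have i30 : Integrable (fun z => ((approxCount MG1D.coord nu 0 z : ℝ) ^ 2 -
    approxCount MG1D.coord nu 0 z) / (2 * nu)) m := (i3.sub i0).div_const _
  simp_rw [approxAgeSum_eq]
  rw [integral_add i12 i30, integral_add i1 i2, integral_div,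
    integral_sub i3 i0, h.integral_sysTime_mul_approxCount hlam hlt hnu,
    h.integral_approxCount_mul_ageOffset hlam hlt hnu, h.integral_approxCount hlam hlt hnu]
  generalize ∫ z, sysTime MG1D.coord 0 z * (nu * cycleLength MG1D.coord z) ∂m = a
  field_simp
  ring

lemma integral_sysTime_mul_cycleLength (hlam : 0 < lam) (hlt : lam < mu) (hnu : 0 < nu) :
    ∫ z, sysTime MG1D.coord 0 z * (nu * cycleLength MG1D.coord z) ∂m =
      nu / mu * ∫ z in busy MG1D.coord 0, sysTime MG1D.coord 0 z ∂m +
        nu / lam * ∫ z in (busy MG1D.coord 0)ᶜ, sysTime MG1D.coord 0 z ∂m +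
          nu / mu * ∫ z in (busy MG1D.coord 0)ᶜ, sysTime MG1D.coord 0 z ∂m := by
  have hT := measurable_sysTime measurable_coord 0
  have hmask : ∀ z, sysTime MG1D.coord 0 (mask {.service 1}ᶜ z) = sysTime MG1D.coord 0 z :=
    fun z => mask_of_mem (by simp) z
  have i1 := h.integrable_sysTime_mul_of_le_cycleLength hlam hlt measurable_busyLength
    (h.ae_busyLength_le hnu)
  have i2 := h.integrable_sysTime_mul_of_le_cycleLength hlam hlt measurable_idleLength
    (h.ae_idleLength_le hnu)
  have i3 := h.integrable_sysTime_mul_of_le_cycleLength hlam hlt measurable_serviceLength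
    (h.ae_serviceLength_le hnu)
  have i12 : Integrable (fun z => sysTime MG1D.coord 0 z * busyLength nu z +
    sysTime MG1D.coord 0 z * idleLength nu z) m := i1.add i2
  simp_rw [← sum_lengths, mul_add]
  rw [integral_add i12 i3, integral_add i1 i2, h.integral_mul_busyLength hT hmask,
    h.integral_mul_serviceLength hT hmask,
    h.integral_mul_idleLength hlam hnu (ψ := fun x => x) measurable_id
      (h.integrable_sysTime hlam hlt 0) i2]

lemma integral_lengths (hlam : 0 < lam) (hlt : lam < mu) (hnu : 0 < nu) :
    ∫ z, busyLength nu z ∂m = nu / mu * (lam / mu) ∧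
    ∫ z, idleLength nu z ∂m = nu / lam * (1 - lam / mu) ∧
    ∫ z, serviceLength nu z ∂m = nu / mu * (1 - lam / mu) ∧
    ∫ z, idleLength nu z * serviceLength nu z ∂m =
      nu / mu * (nu / lam * (1 - lam / mu)) := by
  have hb := (measurableSet_busy measurable_coord 0).compl
  have i := h.integrable_of_le_cycleLength hlam measurable_idleLength (h.ae_idleLength_le hnu)
  have e1 := h.integral_mul_busyLength (nu := nu) (ψ := fun _ => 1) measurable_const fun _ => rfl
  have e2 := h.integral_mul_idleLength hlam hnu (ψ := fun _ => 1) measurable_const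
    (integrable_const _) (by simpa using i)
  have e3 := h.integral_mul_serviceLength (nu := nu) (ψ := fun _ => 1) measurable_const
    fun _ => rfl
  simp only [one_mul, setIntegral_const, smul_eq_mul, mul_one, h.measureReal_busy hlam hlt,
    h.measureReal_busy_compl hlam hlt] at e1 e2 e3
  have e4 := h.integral_mul_serviceLength (nu := nu) (ψ := idleLength nu) measurable_idleLength
    (indicator_mask (compl_mask (busy_mask (by simp) (by simp))) fun z => by
      rw [show sysTime MG1D.coord 0 (mask {.service 1}ᶜ z) = sysTime MG1D.coord 0 z from
          mask_of_mem (by simp) z,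
        show interArrival MG1D.coord 1 (mask {.service 1}ᶜ z) = interArrival MG1D.coord 1 z from
          mask_of_mem (by simp) z])
  rw [← integral_indicator hb, idleLength, Set.indicator_indicator, Set.inter_self,
    ← idleLength, e2] at e4
  exact ⟨e1, e2, e3, e4⟩

/-- The closed expression is the ratio of the mean sum of the ages to the mean number of the
decisions of an inter-departure interval. -/
lemma formula_eq (hlam : 0 < lam) (hlt : lam < mu) (hnu : 0 < nu) :
    formula m MG1D.coord lam mu nu 0 = lam / nu * ∫ z, approxAgeSum MG1D.coord nu 0 z ∂m := by
  have hb := measurableSet_busy measurable_coord 0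
  obtain ⟨m1, m2, m3⟩ := h.measurable_counts hnu
  obtain ⟨l1, l2, l3, l4⟩ := h.integral_lengths hlam hlt hnu
  have c1 : ∫ z in busy MG1D.coord 0, (count1 MG1D.coord nu 0 z : ℝ) ∂m = nu / mu * (lam / mu) := by
    have e := h.integral_mul_busyCount hnu (ψ := fun _ => 1) measurable_const (fun _ => rfl)
      (by simpa using h.integrable_of_le_cycleLength hlam m1 (h.ae_busyCount_le hnu))
    simp only [one_mul] at e
    rw [← l1, ← e, ← integral_indicator hb, busyCount]
  have c2 : ∫ z in (busy MG1D.coord 0)ᶜ, (count2 MG1D.coord nu 0 z : ℝ) ∂m =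
      nu / lam * (1 - lam / mu) := by
    have e := h.integral_mul_idleCount hnu (ψ := fun _ => 1) measurable_const (fun _ => rfl)
      (by simpa using h.integrable_of_le_cycleLength hlam m2 (h.ae_idleCount_le hnu))
    simp only [one_mul] at e
    rw [← l2, ← e, ← integral_indicator hb.compl, idleCount]
  have c3 : ∫ z in (busy MG1D.coord 0)ᶜ, (count3 MG1D.coord nu 0 z : ℝ) ∂m =
      nu / mu * (1 - lam / mu) := by
    have e := h.integral_mul_serviceCount hnu (ψ := fun _ => 1) measurable_const (fun _ => rfl)
      (by simpa using h.integrable_of_le_cycleLength hlam m3 (h.ae_serviceCount_le hnu))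
    simp only [one_mul] at e
    rw [← l3, ← e, ← integral_indicator hb.compl, serviceCount]
  have sq_indicator : ∀ (A : Set (Source → ℝ)) (f : (Source → ℝ) → ℝ),
      A.indicator (fun z => f z ^ 2) = fun z => A.indicator f z ^ 2 := fun A f => by
    ext z; by_cases hz : z ∈ A <;> simp [hz]
  have s1 : ∫ z in busy MG1D.coord 0, (count1 MG1D.coord nu 0 z : ℝ) ^ 2 ∂m =
      ∫ z, busyCount MG1D.coord nu z ^ 2 ∂m := by
    rw [← integral_indicator hb, sq_indicator, busyCount]
  have s2 : ∫ z in (busy MG1D.coord 0)ᶜ, (count2 MG1D.coord nu 0 z : ℝ) ^ 2 ∂m =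
      ∫ z, idleCount MG1D.coord nu z ^ 2 ∂m := by
    rw [← integral_indicator hb.compl, sq_indicator, idleCount]
  have s3 : ∫ z in (busy MG1D.coord 0)ᶜ, (count3 MG1D.coord nu 0 z : ℝ) ^ 2 ∂m =
      ∫ z, serviceCount MG1D.coord nu z ^ 2 ∂m := by
    rw [← integral_indicator hb.compl, sq_indicator, serviceCount]
  have hmu : 0 < mu := hlam.trans hlt
  have hσ : mu - lam ≠ 0 := (sub_pos.2 hlt).ne'
  rw [h.integral_approxAgeSum hlam hlt hnu, h.integral_sysTime_mul_cycleLength hlam hlt hnu,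
    h.integral_approxCount_sq_eq_sum hlam hnu, h.integral_idleCount_mul_serviceCount hlam hnu, l4]
  simp only [formula, condMean_eq, c1, c2, c3, s1, s2, s3, h.measureReal_busy hlam hlt,
    h.measureReal_busy_compl hlam hlt]
  -- Each conditional mean carries an inverse probability `1/ρ` or `1/(1 - ρ)`; in this form both
  -- can be cancelled.
  have e : 1 - lam / mu = (mu - lam) / mu := by field_simp
  rw [e]
  generalize ∫ z in busy MG1D.coord 0, sysTime MG1D.coord 0 z ∂m = a
  generalize ∫ z in (busy MG1D.coord 0)ᶜ, sysTime MG1D.coord 0 z ∂m = b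
  field_simp
  ring

/-- The gap between the closed expression and the average age upon the periodic decisions. -/
lemma formula_sub_eq (hlam : 0 < lam) (hlt : lam < mu) (hnu : 0 < nu) :
    formula m MG1D.coord lam mu nu 0 - lam * ∫ z, (sysTime MG1D.coord 0 z *
      cycleLength MG1D.coord z + cycleLength MG1D.coord z ^ 2 / 2) ∂m =
        lam / (2 * nu ^ 2) * ∫ z, excess nu z ∂m := by
  have i1 := h.integrable_sysTime_mul_cycleLength hlam hlt
  have i2 := (h.integrable_cycleLength_sq hlam).div_const 2
  rw [h.formula_eq hlam hlt hnu, h.integral_approxAgeSum hlam hlt hnu,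
    h.integral_approxCount_sq hlam hnu, integral_add i1 i2, integral_div]
  simp_rw [mul_left_comm _ nu, mul_pow]
  rw [integral_const_mul, integral_const_mul]
  field_simp
  ring

end IsStationaryMG1D
end Evaluation

/-! ### Long-run averages and transfer from the canonical space -/

section LongRun

variable {Ω : Type*} {nu : ℝ}

lemma Agree.approx {z z' : Source → ℝ} (hz : Agree z z') :
    approxCount coord nu 0 z = approxCount coord nu 0 z' ∧
      approxAgeSum coord nu 0 z = approxAgeSum coord nu 0 z' := by
  have e0 : sysTime coord 0 z = sysTime coord 0 z' := hz.1
  have e1 : interArrival coord 1 z = interArrival coord 1 z' := hz.2 _ one_pos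
  have e2 : service coord 1 z = service coord 1 z' := hz.2 _ one_pos
  have e3 : sysTime coord 1 z = sysTime coord 1 z' := by
    rw [sysTime_succ, sysTime_succ, e0, e1, e2]
  have e4 : ∀ s, 0 < rank s → coord s z = coord s z' := hz.2
  have e5 : z ∈ busy coord 0 ↔ z' ∈ busy coord 0 := by rw [mem_busy, mem_busy, e0, e1]
  have hcount : approxCount coord nu 0 z = approxCount coord nu 0 z' := by
    simp only [approxCount, count1_eq, count2_eq, count3_eq, hz.cycle.1, hz.cycle.2, e1, e3,
      e4 (.offset1 0) one_pos, e4 (.offset2 0) one_pos, e4 (.offset3 0) one_pos]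
    by_cases hz : z ∈ busy coord 0
    · rw [if_pos hz, if_pos (e5.1 hz)]
    · rw [if_neg hz, if_neg (mt e5.2 hz)]
  exact ⟨hcount, by rw [approxAgeSum, approxAgeSum, hcount, e0, e4 (.ageOffset 0) one_pos]⟩

lemma approx_iterate_shiftMap (nu : ℝ) (n k : ℕ) (z : Source → ℝ) :
    approxCount coord nu k (shiftMap^[n] z) = approxCount coord nu (k + n) z ∧
      approxAgeSum coord nu k (shiftMap^[n] z) = approxAgeSum coord nu (k + n) z := by
  induction n generalizing z k with
  | zero => exact ⟨rfl, rfl⟩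
  | succ n ih =>
    obtain ⟨h1, h2⟩ := ih k (shiftMap z)
    exact ⟨h1.trans ((approxCount_comp coord (joint (shift coord)) nu (k + n) z).symm.trans
        (congrFun (approxCount_shift coord nu (k + n)) z)),
      h2.trans ((approxAgeSum_comp coord (joint (shift coord)) nu (k + n) z).symm.trans
        (congrFun (approxAgeSum_shift coord nu (k + n)) z))⟩

namespace IsStationaryMG1D
variable {m : Measure (Source → ℝ)} [IsProbabilityMeasure m] {lam mu nu : ℝ}

/-- Counts and age sums do not involve the clock, so the ergodic theorem applies with an arbitrary
phase, and the ratio of the two averages converges. -/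
lemma ae_tendsto_approxMeanAuD_coord (h : IsStationaryMG1D m MG1D.coord lam mu nu)
    (hlam : 0 < lam) (hlt : lam < mu) (hnu : 0 < nu) :
    ∀ᵐ z ∂m, Tendsto (fun K => approxMeanAuD MG1D.coord nu K z) atTop
      (𝓝 (formula m MG1D.coord lam mu nu 0)) := by
  have hbirk : ∀ g : (Source → ℝ) → ℝ, Measurable g → Integrable g m →
      (∀ z z', Agree z z' → g z = g z') → ∀ᵐ z ∂m, Tendsto (fun n : ℕ =>
        (∑ k ∈ Finset.range n, g (shiftMap^[k] z)) / n) atTop (𝓝 (∫ z, g z ∂m)) := by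
    intro g hg hgi hagree
    have e := h.ae_tendsto_birkhoffSum (g := fun p => g p.1) hlam hlt hnu.ne'
      (hg.comp measurable_fst) (hgi.comp_fst _) (fun z z' _ => hagree z z') 0
    rw [integral_fun_fst] at e
    simpa [birkhoffSum, iterate_phaseShift] using e
  have hC := hbirk _ (measurable_approxCount hnu measurable_coord)
    (h.integrable_approxCount hlam hnu) fun z z' hz => by rw [hz.approx.1]
  have hG := hbirk _ (measurable_approxAgeSum hnu measurable_coord)
    (h.integrable_terms_approxAgeSum hlam hlt hnu).2.2.2 fun z z' hz => hz.approx.2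
  rw [h.integral_approxCount hlam hlt hnu] at hC
  filter_upwards [hC, hG] with z hC hG
  have e := hG.div hC (div_pos hnu hlam).ne'
  rw [h.formula_eq hlam hlt hnu, show lam / nu * ∫ z, approxAgeSum MG1D.coord nu 0 z ∂m =
    (∫ z, approxAgeSum MG1D.coord nu 0 z ∂m) / (nu / lam) by field_simp]
  refine e.congr' ?_
  filter_upwards [eventually_ne_atTop 0] with n hn
  simp only [(approx_iterate_shiftMap nu _ 0 z).1, (approx_iterate_shiftMap nu _ 0 z).2, zero_add,
    Pi.div_apply]
  rw [div_div_div_cancel_right₀ (Nat.cast_ne_zero.2 hn), approxMeanAuD]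

end IsStationaryMG1D

lemma approxMeanAuD_joint (Z : Source → Ω → ℝ) (nu : ℝ) (K : ℕ) (ω : Ω) :
    approxMeanAuD coord nu K (joint Z ω) = approxMeanAuD Z nu K ω := by
  have e1 : ∀ k, approxAgeSum coord nu k (joint Z ω) = approxAgeSum Z nu k ω :=
    fun k => (approxAgeSum_comp coord (joint Z) nu k ω).symm
  have e2 : ∀ k, approxCount coord nu k (joint Z ω) = approxCount Z nu k ω :=
    fun k => (approxCount_comp coord (joint Z) nu k ω).symm
  simp only [approxMeanAuD, e1, e2]

lemma meanAuD_joint (Z : Source → Ω → ℝ) (nu τ₀ : ℝ) (n : ℕ) (ω : Ω) :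
    meanAuD coord nu τ₀ n (joint Z ω) = meanAuD Z nu τ₀ n ω := by
  have e1 : ∀ k, departureTime coord k (joint Z ω) = departureTime Z k ω :=
    fun k => (departureTime_comp coord (joint Z) k ω).symm
  have e2 : ∀ k, arrivalTime coord k (joint Z ω) = arrivalTime Z k ω :=
    fun k => (arrivalTime_comp coord (joint Z) k ω).symm
  simp only [meanAuD, aud, lastReceived, e1, e2]

namespace IsStationaryMG1D

variable [MeasurableSpace Ω] {P : Measure Ω} {Z : Source → Ω → ℝ} [IsProbabilityMeasure P]
  {lam mu : ℝ}

omit [IsProbabilityMeasure P] in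
-- The expression depends only on the joint law of the sources. Shifting preserves that law and
-- raises the index by one, whence the independence of `k`.
lemma formula_eq_coord (h : IsStationaryMG1D P Z lam mu nu) (hnu : 0 < nu) (k : ℕ) :
    formula P Z lam mu nu k = formula (P.map (joint Z)) MG1D.coord lam mu nu 0 := by
  induction k generalizing Z with
  | zero => exact (formula_map_joint hnu h.measurable).symm
  | succ k ih => rw [← formula_shift, ih h.shift, h.map_joint_shift]

lemma moments (h : IsStationaryMG1D P Z lam mu nu) (hlam : 0 < lam) (hlt : lam < mu)
    (hnu : 0 < nu) (k : ℕ) : P (busy Z k) ≠ 0 ∧ P (busy Z k)ᶜ ≠ 0 ∧ Integrable (sysTime Z k) P ∧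
      Integrable (fun ω => (count1 Z nu k ω : ℝ) ^ 2) (cond P (busy Z k)) ∧
      Integrable (fun ω => (count2 Z nu k ω : ℝ) ^ 2) (cond P (busy Z k)ᶜ) ∧
      Integrable (fun ω => (count3 Z nu k ω : ℝ) ^ 2) (cond P (busy Z k)ᶜ) := by
  induction k generalizing Z with
  | succ k ih =>
    simpa only [busy_shift, sysTime_shift, count1_shift, count2_shift, count3_shift]
      using ih h.shift
  | zero =>
    have hmu := hlam.trans hlt
    have hb := measurableSet_busy h.measurable 0
    have hne : ∀ A : Set Ω, 0 < P.real A → P A ≠ 0 := fun A hA h0 => by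
      simp [measureReal_def, h0] at hA
    have h1 : P (busy Z 0) ≠ 0 := hne _ (by rw [h.measureReal_busy hlam hlt]; positivity)
    have h2 : P (busy Z 0)ᶜ ≠ 0 := hne _ (by
      rw [h.measureReal_busy_compl hlam hlt, sub_pos, div_lt_one hmu]; exact hlt)
    -- Restricted to its event, each count is at most `νL + 1`, which has a second moment;
    -- conditioning only rescales the measure by a finite factor.
    have key : ∀ (A : Set Ω) (f : Ω → ℝ), MeasurableSet A → P A ≠ 0 →
        Measurable (A.indicator f) → (∀ᵐ ω ∂P, 0 ≤ A.indicator f ω ∧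
          A.indicator f ω ≤ nu * cycleLength Z ω + 1) →
        Integrable (fun ω => f ω ^ 2) (cond P A) := by
      intro A f hA hA0 hf hle
      have hi := h.integrable_mul_of_le_cycleLength hlam hf hf hle hle
      have e : (fun ω => A.indicator f ω * A.indicator f ω) = A.indicator fun ω => f ω ^ 2 := by
        ext ω; by_cases hω : ω ∈ A <;> simp [hω, sq]
      rw [e, integrable_indicator_iff hA] at hi
      exact hi.smul_measure (ENNReal.inv_ne_top.2 hA0)
    exact ⟨h1, h2, h.integrable_sysTime hlam hlt 0,
      key _ _ hb h1 (measurable_busyCount hnu h.measurable) (h.ae_busyCount_le hnu),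
      key _ _ hb.compl h2 (measurable_idleCount hnu h.measurable) (h.ae_idleCount_le hnu),
      key _ _ hb.compl h2 (measurable_serviceCount hnu h.measurable) (h.ae_serviceCount_le hnu)⟩

end IsStationaryMG1D
end LongRun
end MG1D

theorem theorem4 {Ω : Type*} [MeasurableSpace Ω] (P : Measure Ω) [IsProbabilityMeasure P]
    (lam mu nu : ℝ) (hlam : 0 < lam) (hlt : lam < mu) (hnu : 0 < nu)
    (Z : MG1D.Source → Ω → ℝ) (hZ : MG1D.IsStationaryMG1D P Z lam mu nu) :
    -- all conditional means in the formula are taken given events of positive probability,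
    -- and they exist
    (∀ k : ℕ, P (MG1D.busy Z k) ≠ 0 ∧ P (MG1D.busy Z k)ᶜ ≠ 0 ∧
      Integrable (MG1D.sysTime Z k) P ∧
      Integrable (fun ω => (MG1D.count1 Z nu k ω : ℝ) ^ 2) (cond P (MG1D.busy Z k)) ∧
      Integrable (fun ω => (MG1D.count2 Z nu k ω : ℝ) ^ 2) (cond P (MG1D.busy Z k)ᶜ) ∧
      Integrable (fun ω => (MG1D.count3 Z nu k ω : ℝ) ^ 2) (cond P (MG1D.busy Z k)ᶜ)) ∧
    -- the average age upon decisions in the uniform-offset approximation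
    (∀ k : ℕ, ∀ᵐ ω ∂P, Tendsto (fun K => MG1D.approxMeanAuD Z nu K ω) atTop
      (𝓝 (MG1D.formula P Z lam mu nu k))) ∧
    -- the average age upon decisions with the periodic decisions themselves
    (∃ Δ : ℝ, (∀ τ₀ : ℝ, ∀ᵐ ω ∂P, Tendsto (fun n => MG1D.meanAuD Z nu τ₀ n ω) atTop (𝓝 Δ)) ∧
      ∀ k : ℕ, 0 ≤ MG1D.formula P Z lam mu nu k - Δ ∧
        MG1D.formula P Z lam mu nu k - Δ ≤ lam * (2 - lam / mu) / (8 * nu ^ 2)) := by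
  have hm : IsProbabilityMeasure (P.map (MG1D.joint Z)) :=
    Measure.isProbabilityMeasure_map (MG1D.measurable_joint hZ.measurable).aemeasurable
  have hJ := (MG1D.measurable_joint hZ.measurable).aemeasurable (μ := P)
  have h := hZ.coord
  -- The witness is the mean age sum of a cycle under a uniform phase divided by the mean number
  -- `ν/λ` of decisions; `τ₀` does not enter.
  refine ⟨hZ.moments hlam hlt hnu, fun k => ?_, lam * ∫ z, (MG1D.sysTime MG1D.coord 0 z *
    MG1D.cycleLength MG1D.coord z + MG1D.cycleLength MG1D.coord z ^ 2 / 2) ∂(P.map (MG1D.joint Z)),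
    fun τ₀ => ?_, fun k => ?_⟩
  · rw [hZ.formula_eq_coord hnu]
    simpa only [MG1D.approxMeanAuD_joint] using
      ae_of_ae_map hJ (h.ae_tendsto_approxMeanAuD_coord hlam hlt hnu)
  · simpa only [MG1D.meanAuD_joint] using
      ae_of_ae_map hJ (h.ae_tendsto_meanAuD_coord hlam hlt hnu τ₀)
  · rw [hZ.formula_eq_coord hnu, h.formula_sub_eq hlam hlt hnu]
    have hc : 0 ≤ lam / (2 * nu ^ 2) := by positivity
    refine ⟨mul_nonneg hc (h.integral_excess_nonneg hnu),
      (mul_le_mul_of_nonneg_left (h.integral_excess_le hlam hlt hnu) hc).trans_eq ?_⟩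
    field_simp
    ring
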